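/- Let $X=X^0\supset X^1\supset X^2\supset\cdots$ be real Banach spaces (e.g. Hilbert spaces), with continuous inclusions, each $X^n$ being dense in $X$; let $\mathbb L(Y,Z)$ be the bounded linear operators, $\mathbb L(Y)=\mathbb L(Y,Y)$, and $X^*$ the dual of $X$. Let $T_0<T_1$, $n_0\ge 1$ an integer, $C_L,C_Q\ge 1$, $\omega\in\mathbb R$, $L:[T_0,T_1]\to\mathbb L(X,X^*)$, $Q(t)\in\mathbb L(X^1,X)$ and linear operators $A(t):\mathrm{Dom}(A(t))\subset X\to X$, $t\in[T_0,T_1]$, satisfy: (L.1) For every $t$, $\langle L(t)u,v\rangle=\langle L(t)v,u\rangle$ and $C_L^{-1}|v|_X\le |v|_{L(t)}\le C_L|v|_X$, where $|v|_{L(t)}=\langle L(t)v,v\rangle^{1/2}$; and $\sup_{T_0\le t_0\le t_1\le T_1} l(t_0,t_1)<\infty$, where $$l(t_0,t_1)=\sup\Big\{\prod_{j=1}^{k}\frac{|v_j|_{L(s_j)}}{|v_j|_{L(s_{j-1})}}:\ k\in\mathbb N,\ t_0=s_0\le s_1\le\dots\le s_k=t_1,\ v_1,\dots,v_k\in X\setminus\{0\}\Big\}.$$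 (L.2) For every $t$, $X^1\subset \mathrm{Dom}(A(t))$, $A(t)$ is the closure of its restriction to $X^1$, $\lambda-A(t):\mathrm{Dom}(A(t))\to X$ is surjective for some $\lambda>\omega$, and $\langle L(t)v,A(t)v\rangle\le\omega\langle L(t)v,v\rangle$ for all $v\in X^1$. Moreover $A\in C^0([T_0,T_1],\mathbb L(X^1,X))$. (L.3) For every $1\le n\le n_0$, $Q(t)$ restricts to an isomorphism from $X^n$ to $X^{n-1}$ for every $t$, with $|Q(t)|_{\mathbb L(X^n,X^{n-1})}\le C_Q$ and $|Q(t)^{-1}|_{\mathbb L(X^{n-1},X^n)}\le C_Q$, and $Q\in W^{1,1}([T_0,T_1],\mathbb L(X^n,X^{n-1}))$. The commutator $[Q,A]=QA-AQ$ belongs to $C^0([T_0,T_1],\mathbb L(X^n,X^{n-1}))$ for every $1\le n\le n_0$; that is, for every $t$ and every $v\in X^1$ with $Q(t)v\in X^1$ one has $A(t)v\in X^1$, the operator $v\mapsto Q(t)A(t)v-A(t)Q(t)v$ defined on these (dense in $X^1$) vectors $v$ extends to $[Q,A](t)\in\mathbb L(X^1,X)$, this maps $X^n$ boundedly to $X^{n-1}$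 for $1\le n\le n_0$, and it depends continuously on $t$ in $\mathbb L(X^n,X^{n-1})$. Let $\Delta=\{(t,t_0):T_0\le t_0\le t\le T_1\}$. Then there is a unique family $U(t,t_0)\in\mathbb L(X)$, $(t,t_0)\in\Delta$, such that: (1) for every $0\le n\le n_0$, $U(t,t_0)$ restricts to an element of $\mathbb L(X^n)$, and $(t,t_0)\mapsto U(t,t_0)v$ is in $C^0(\Delta,X^n)$ for every $v\in X^n$; (2) $U(t_0,t_0)=I$ and $U(t,t_1)U(t_1,t_0)=U(t,t_0)$ for $T_0\le t_0\le t_1\le t\le T_1$; (3) for every $v\in X^1$, in $X$, $\partial_tU(t,t_0)v=A(t)U(t,t_0)v$ and $\partial_{t_0}U(t,t_0)v=-U(t,t_0)A(t_0)v$ (one-sided derivatives at the end points of $\Delta$). Moreover, for every $0\le n\le n_0$, $v\in X^n$ and $(t,t_0)\in\Delta$, $$|Q(t)^nU(t,t_0)v|_{L(t)}\le l(t_0,t)\,\exp\Big(\omega(t-t_0)+C_L^2\sum_{j=1}^n C_Q^{2j-1}\int_{t_0}^t\big|Q'(\tau)+[Q,A](\tau)\big|_{\mathbb L(X^j,X^{j-1})}\,d\tau\Big)\,|Q(t_0)^nv|_{L(t_0)}.$$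 -/

import Mathlib

open Set MeasureTheory

noncomputable section

namespace EvolutionScale

section Scale

variable {X : ℕ → Type*} [∀ n, NormedAddCommGroup (X n)] [∀ n, NormedSpace ℝ (X n)]

/-- The inclusion of `X n` into `X 0` obtained by composing the one-step inclusions
`ι n : X (n + 1) → X n`. -/
def incl (ι : ∀ n, X (n + 1) →L[ℝ] X n) : ∀ n, X n →L[ℝ] X 0
  | 0 => ContinuousLinearMap.id ℝ (X 0)
  | n + 1 => (incl ι n).comp (ι n)

/-- `X 0 ⊇ X 1 ⊇ X 2 ⊇ ⋯` with continuous inclusions, each `X n` being dense in `X 0`. -/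
structure IsDenseScale (ι : ∀ n, X (n + 1) →L[ℝ] X n) : Prop where
  injective : ∀ n, Function.Injective (ι n)
  dense : ∀ n, DenseRange (incl ι n)

/-- The power `Q ^ n : X n → X 0`, where `Q n : X (n + 1) → X n` is the realization of one operator
`Q` on each level of the scale. -/
def powQ (Q : ∀ n, X (n + 1) →L[ℝ] X n) : ∀ n, X n →L[ℝ] X 0
  | 0 => ContinuousLinearMap.id ℝ (X 0)
  | n + 1 => (powQ Q n).comp (Q n)

end Scale

section Energy

variable {H : Type*} [NormedAddCommGroup H] [NormedSpace ℝ H]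

/-- The norm `|v|_{L} = ⟨L v, v⟩ ^ (1/2)` of an operator `L : H → H*`. -/
def energyNorm (L : H →L[ℝ] StrongDual ℝ H) (v : H) : ℝ :=
  Real.sqrt (L v v)

/-- The products `∏ⱼ |vⱼ|_{L(sⱼ)} / |vⱼ|_{L(sⱼ₋₁)}` over all finite chains
`t₀ = s₀ ≤ s₁ ≤ ⋯ ≤ s_k = t₁` and all nonzero vectors `v₁, …, v_k`. -/
def variationProducts (L : ℝ → H →L[ℝ] StrongDual ℝ H) (t₀ t₁ : ℝ) : Set ℝ :=
  {p | ∃ (k : ℕ) (s : Fin (k + 1) → ℝ) (v : Fin k → H),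
    Monotone s ∧ s 0 = t₀ ∧ s (Fin.last k) = t₁ ∧ (∀ j, v j ≠ 0) ∧
    p = ∏ j : Fin k, energyNorm (L (s j.succ)) (v j) / energyNorm (L (s j.castSucc)) (v j)}

/-- The total variation `l(t₀, t₁)` of the norms `|·|_{L(t)}`. -/
def variation (L : ℝ → H →L[ℝ] StrongDual ℝ H) (t₀ t₁ : ℝ) : ℝ :=
  sSup (variationProducts L t₀ t₁)

end Energy

/-- `f ∈ W^{1,1}([a, b], E)` (continuous representative) with derivative `f' ∈ L¹([a, b], E)`. -/
structure HasW11Deriv {E : Type*} [NormedAddCommGroup E] [NormedSpace ℝ E]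
    (a b : ℝ) (f f' : ℝ → E) : Prop where
  integrable : IntegrableOn f' (Icc a b) volume
  eq_integral : ∀ t ∈ Icc a b, f t = f a + ∫ τ in a..t, f' τ

/-- The triangle `{(t, t₀) : T₀ ≤ t₀ ≤ t ≤ T₁}`. -/
def triangle (T₀ T₁ : ℝ) : Set (ℝ × ℝ) :=
  {p | T₀ ≤ p.2 ∧ p.2 ≤ p.1 ∧ p.1 ≤ T₁}

section Assumptions

/-- (L.1): the forms `L t` are symmetric, define norms equivalent to that of `H` with constant
`C_L`, uniformly in time, and these norms have finite total variation in time. -/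
structure AssumptionL1 {H : Type*} [NormedAddCommGroup H] [NormedSpace ℝ H]
    (T₀ T₁ : ℝ) (L : ℝ → H →L[ℝ] StrongDual ℝ H) (C_L : ℝ) : Prop where
  symm : ∀ t ∈ Icc T₀ T₁, ∀ u v, L t u v = L t v u
  lower : ∀ t ∈ Icc T₀ T₁, ∀ v, C_L⁻¹ * ‖v‖ ≤ energyNorm (L t) v
  upper : ∀ t ∈ Icc T₀ T₁, ∀ v, energyNorm (L t) v ≤ C_L * ‖v‖
  finite_variation : ∃ M : ℝ, ∀ t₀ t₁, T₀ ≤ t₀ → t₀ ≤ t₁ → t₁ ≤ T₁ →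
    ∀ p ∈ variationProducts L t₀ t₁, p ≤ M

variable {X : ℕ → Type*} [∀ n, NormedAddCommGroup (X n)] [∀ n, NormedSpace ℝ (X n)]

/-- (L.2): `A t` is a closed operator in `X 0` with core `X 1`, `lam - A t` is onto for some
`lam > ω`, `A` is continuous in time with values in the bounded operators from `X 1` to `X 0`, and
`A t` is dissipative up to `ω` on `X 1` with respect to `L t`. -/
structure AssumptionL2 (ι : ∀ n, X (n + 1) →L[ℝ] X n) (T₀ T₁ : ℝ)
    (L : ℝ → X 0 →L[ℝ] StrongDual ℝ (X 0)) (A : ℝ → X 0 →ₗ.[ℝ] X 0) (ω : ℝ) : Prop where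
  closed : ∀ t ∈ Icc T₀ T₁, (A t).IsClosed
  core : ∀ t ∈ Icc T₀ T₁, (A t).HasCore (LinearMap.range (ι 0).toLinearMap)
  surjective : ∀ t ∈ Icc T₀ T₁, ∃ lam > ω, ∀ y : X 0, ∃ x : (A t).domain, lam • (x : X 0) - A t x = y
  continuous : ∃ A₁ : ℝ → X 1 →L[ℝ] X 0, ContinuousOn A₁ (Icc T₀ T₁) ∧
    ∀ t ∈ Icc T₀ T₁, ∀ v : X 1, ∃ h : ι 0 v ∈ (A t).domain, A t ⟨ι 0 v, h⟩ = A₁ t v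
  dissipative : ∀ t ∈ Icc T₀ T₁, ∀ (v : X 1) (h : ι 0 v ∈ (A t).domain),
    L t (ι 0 v) (A t ⟨ι 0 v, h⟩) ≤ ω * L t (ι 0 v) (ι 0 v)

/-- The bounded operator `K : X 1 → X 0` is the commutator `[Q, A] = Q A - A Q`: the latter is
defined at every `v ∈ X 1` with `Q v ∈ X 1` (the space of such `v` is dense in `X 1`, and it is
`X 2` as soon as `Q` is an isomorphism from `X 2` to `X 1`), and there it agrees with `K`. -/
def IsCommutator (ι₀ : X 1 →L[ℝ] X 0) (Q : X 1 →L[ℝ] X 0) (A : X 0 →ₗ.[ℝ] X 0)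
    (K : X 1 →L[ℝ] X 0) : Prop :=
  ∀ v w : X 1, ι₀ w = Q v →
    ∃ (hv : ι₀ v ∈ A.domain) (hw : ι₀ w ∈ A.domain) (z : X 1),
      ι₀ z = A ⟨ι₀ v, hv⟩ ∧ K v = Q z - A ⟨ι₀ w, hw⟩

/-- (L.3): `Q n t : X (n + 1) → X n`, `n < n₀`, are the realizations of one operator `Q t`. They are
isomorphisms bounded by `C_Q` together with their inverses, of class `W^{1,1}` in time with
derivative `Q' n`, and the realizations `K n t : X (n + 1) → X n` of the commutator `[Q t, A t]` are
bounded operators depending continuously on time. -/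
structure AssumptionL3 (ι : ∀ n, X (n + 1) →L[ℝ] X n) (T₀ T₁ : ℝ) (n₀ : ℕ)
    (A : ℝ → X 0 →ₗ.[ℝ] X 0) (Q Q' K : ∀ n, ℝ → X (n + 1) →L[ℝ] X n) (C_Q : ℝ) : Prop where
  restrict : ∀ n, n + 1 < n₀ → ∀ t ∈ Icc T₀ T₁, ∀ v : X (n + 2),
    ι n (Q (n + 1) t v) = Q n t (ι (n + 1) v)
  regular : ∀ n < n₀, HasW11Deriv T₀ T₁ (Q n) (Q' n)
  invertible : ∀ n < n₀, ∀ t ∈ Icc T₀ T₁, (Q n t).IsInvertible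
  norm_le : ∀ n < n₀, ∀ t ∈ Icc T₀ T₁, ‖Q n t‖ ≤ C_Q
  norm_inverse_le : ∀ n < n₀, ∀ t ∈ Icc T₀ T₁, ‖(Q n t).inverse‖ ≤ C_Q
  commutator : ∀ t ∈ Icc T₀ T₁, IsCommutator (ι 0) (Q 0 t) (A t) (K 0 t)
  commutator_restrict : ∀ n, n + 1 < n₀ → ∀ t ∈ Icc T₀ T₁, ∀ v : X (n + 2),
    ι n (K (n + 1) t v) = K n t (ι (n + 1) v)
  commutator_continuous : ∀ n < n₀, ContinuousOn (K n) (Icc T₀ T₁)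

/-- `U` is a strongly continuous evolution operator of `v_t = A(t) v` on `X 0, …, X n₀`. Only the
values `U t t₀` with `(t, t₀)` in the triangle matter. -/
structure IsEvolutionOperator (ι : ∀ n, X (n + 1) →L[ℝ] X n) (T₀ T₁ : ℝ) (n₀ : ℕ)
    (A : ℝ → X 0 →ₗ.[ℝ] X 0) (U : ℝ → ℝ → X 0 →L[ℝ] X 0) : Prop where
  /-- `U t t₀` restricts to a bounded operator on `X n`, strongly continuous in `(t, t₀)`. -/
  regular : ∀ n ≤ n₀, ∃ V : ℝ → ℝ → X n →L[ℝ] X n,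
    (∀ t t₀, (t, t₀) ∈ triangle T₀ T₁ → ∀ v, incl ι n (V t t₀ v) = U t t₀ (incl ι n v)) ∧
    ∀ v, ContinuousOn (fun p : ℝ × ℝ => V p.1 p.2 v) (triangle T₀ T₁)
  refl : ∀ t₀ ∈ Icc T₀ T₁, U t₀ t₀ = ContinuousLinearMap.id ℝ (X 0)
  comp : ∀ t t₁ t₀, T₀ ≤ t₀ → t₀ ≤ t₁ → t₁ ≤ t → t ≤ T₁ → (U t t₁).comp (U t₁ t₀) = U t t₀
  /-- `∂_t U(t, t₀) v = A(t) U(t, t₀) v` for `v ∈ X 1` (one-sided at the end points). -/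
  deriv_fst : ∀ t t₀, (t, t₀) ∈ triangle T₀ T₁ → ∀ v : X 1,
    ∃ h : U t t₀ (ι 0 v) ∈ (A t).domain,
      HasDerivWithinAt (fun s => U s t₀ (ι 0 v)) (A t ⟨U t t₀ (ι 0 v), h⟩) (Icc t₀ T₁) t
  /-- `∂_{t₀} U(t, t₀) v = - U(t, t₀) A(t₀) v` for `v ∈ X 1` (one-sided at the end points). -/
  deriv_snd : ∀ t t₀, (t, t₀) ∈ triangle T₀ T₁ → ∀ v : X 1,
    ∃ h : ι 0 v ∈ (A t₀).domain,
      HasDerivWithinAt (fun s => U t s (ι 0 v)) (-(U t t₀ (A t₀ ⟨ι 0 v, h⟩))) (Icc T₀ t) t₀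

end Assumptions

end EvolutionScale

end

/-! The evolution operator is built by Yosida approximation on the pair `X 1 ⊂ X 0` and then lifted
to the higher levels by a perturbation argument that no longer involves the generator.

With `R = (lam - A)⁻¹`, the Yosida approximations `A_lam = lam (lam R - 1)` are bounded, and they
are dissipative in the energy norms up to a rate tending to `ω`. Since the quotient `|v|_{L(t)} /
l(s, t)` does not increase in `t`, an energy estimate without any differentiability of `L` bounds
the solution families `S_lam` by `l(s, t)` times an exponential (`energy_estimate`, `S_energy`).

On `X 1` everything is conjugated with `Q`. Put `B = [Q, A] Q⁻¹`, and let `R₁` be the resolvent of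
`A + B`. Then `Q A_lam Q⁻¹` is the Yosida approximation of `A + B`, equal to `A_lam + lam R₁ B lam
R` (`Q_yosidaY`). Hence `Q(t) S_lam(t, s) Q(s)⁻¹` is the Dyson series perturbing `S_lam` by the
coefficient `Q' Q⁻¹ + lam R₁ B lam R`, bounded uniformly in `lam` (`Q_SY`). So `A_lam S_lam v` stays
bounded for `v` in `X 1`, and dissipativity shows that two approximations differ by `O((1/lam +
1/mu)^(1/2))` (`exists_cauchy_bound`). The limit `U` exists on `X 0` by density. On `X 1` it equals
`Q⁻¹ W Q`, where `W` is the perturbation of `U` by `(Q' + [Q, A]) Q⁻¹` (`tendsto_SY`,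
`j_conjugate`); both differential equations pass to the limit in integral form.

For higher levels, let `W_n` perturb the realization `U_n` on `X n` by `(Q' + [Q, A]) Q⁻¹` and set
`U_{n+1} = Q⁻¹ W_n Q`. Dyson series are natural with respect to intertwining operators, so the
inclusion of `X (n + 1)` intertwines `U_{n+1}` and `U_n` by induction (`ι_lift`). Conjugation does
not change the growth measured in `|Q^n v|_{L(t)}`. That norm is equivalent to the norm of `X n`
with constant `C_L C_Q^n`, so the perturbation at level `n` costs the exponent `(C_L C_Q^n)² C_Q ∫
‖Q' + [Q, A]‖`, which is the summand `j = n + 1` of the estimate.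

Uniqueness: for `v` in `X 1` the function `s ↦ V(t, s) U(s, t₀) v` has derivative zero, and `X 1` is
dense. -/

namespace EvolutionScale

/-! ### Calculus for absolutely continuous functions by comparing increments -/

section Analysis

open Set MeasureTheory Filter Topology

/-- A real function whose small increments are dominated by arbitrarily small multiples of those of
another function does not grow. -/
theorem le_of_small_increments {f m : ℝ → ℝ} {a b : ℝ} (hab : a ≤ b)
    (h : ∀ ε > 0, ∃ δ > 0, ∀ s s', a ≤ s → s ≤ s' → s' ≤ b → s' - s < δ →
      f s' - f s ≤ ε * (m s' - m s)) : f b ≤ f a := by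
  have key : ∀ ε > 0, f b - f a ≤ ε * (m b - m a) := by
    intro ε hε
    obtain ⟨δ, hδ, H⟩ := h ε hε
    obtain ⟨n, hn⟩ := exists_nat_gt ((b - a) / δ)
    have hn0 : (0 : ℝ) < n := lt_of_le_of_lt (div_nonneg (by linarith) hδ.le) hn
    set η := (b - a) / n with hη
    have hη0 : 0 ≤ η := div_nonneg (by linarith) hn0.le
    have hnη : n * η = b - a := by rw [hη]; field_simp
    have hηδ : η < δ := by
      rw [hη, div_lt_iff₀ hn0]
      rwa [div_lt_iff₀ hδ, mul_comm] at hn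
    have ind : ∀ k : ℕ, k ≤ n → f (a + k * η) - f a ≤ ε * (m (a + k * η) - m a) := by
      intro k
      induction k with
      | zero => intro _; simp
      | succ k ih =>
        intro hk
        have h1 := ih (by omega)
        have hk' : ((k + 1 : ℕ) : ℝ) ≤ n := by exact_mod_cast hk
        have h2 := H (a + k * η) (a + (k + 1 : ℕ) * η)
          (by have : 0 ≤ (k : ℝ) * η := by positivity
              linarith)
          (by push_cast; nlinarith)
          (by nlinarith [mul_le_mul_of_nonneg_right hk' hη0])
          (by push_cast; linarith)
        nlinarith
    have := ind n le_rfl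
    rw [hnη] at this
    simpa using this
  by_contra hlt
  push Not at hlt
  -- A positive excess `f b - f a` is refuted by taking `ε` equal to half of it divided by `c`; the
  -- added 1 keeps `c` positive.
  set c := |m b - m a| + 1 with hc
  have hc0 : 0 < c := by positivity
  have h1 := key ((f b - f a) / (2 * c)) (div_pos (by linarith) (by positivity))
  have h2 : (f b - f a) / (2 * c) * (m b - m a) ≤ (f b - f a) / (2 * c) * c := by
    apply mul_le_mul_of_nonneg_left _ (div_nonneg (by linarith) (by positivity))
    rw [hc]; linarith [le_abs_self (m b - m a)]
  have h3 : (f b - f a) / (2 * c) * c = (f b - f a) / 2 := by field_simp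
  linarith

set_option linter.unusedSectionVars false

variable {E : Type*} [NormedAddCommGroup E] [NormedSpace ℝ E]
variable {G : Type*} [NormedAddCommGroup G] [NormedSpace ℝ G]

theorem eq_of_small_increments {f : ℝ → E} {m : ℝ → ℝ} {a b : ℝ} (hab : a ≤ b)
    (h : ∀ ε > 0, ∃ δ > 0, ∀ s s', a ≤ s → s ≤ s' → s' ≤ b → s' - s < δ →
      ‖f s' - f s‖ ≤ ε * (m s' - m s)) : f b = f a := by
  have : ‖f b - f a‖ ≤ ‖f a - f a‖ := by
    refine le_of_small_increments (f := fun s => ‖f s - f a‖) (m := m) hab fun ε hε => ?_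
    obtain ⟨δ, hδ, H⟩ := h ε hε
    refine ⟨δ, hδ, fun s s' h1 h2 h3 h4 => le_trans ?_ (H s s' h1 h2 h3 h4)⟩
    have := norm_sub_norm_le (f s' - f a) (f s - f a)
    simpa using this
  simpa [sub_eq_zero] using this

theorem intervalIntegrable_mono {f : ℝ → E} {a b s t : ℝ} (h : IntervalIntegrable f volume a b)
    (hs : a ≤ s) (hst : s ≤ t) (ht : t ≤ b) : IntervalIntegrable f volume s t := by
  apply h.mono_set
  rw [uIcc_of_le hst, uIcc_of_le (hs.trans (hst.trans ht))]
  exact Icc_subset_Icc hs ht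

theorem integral_sub_integral {f : ℝ → E} {a b s t : ℝ} (h : IntervalIntegrable f volume a b)
    (hs : a ≤ s) (hst : s ≤ t) (ht : t ≤ b) :
    (∫ r in a..t, f r) - ∫ r in a..s, f r = ∫ r in s..t, f r :=
  intervalIntegral.integral_interval_sub_left
    (intervalIntegrable_mono h le_rfl (hs.trans hst) ht)
    (intervalIntegrable_mono h le_rfl hs (hst.trans ht))

theorem intervalIntegrable_clm_comp (T : E →L[ℝ] G) {f : ℝ → E} {a b : ℝ}
    (h : IntervalIntegrable f volume a b) : IntervalIntegrable (fun r => T (f r)) volume a b :=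
  ⟨T.integrable_comp h.1, T.integrable_comp h.2⟩

theorem exists_modulus {f : ℝ → E} {a b : ℝ} (hf : ContinuousOn f (Icc a b)) {ε : ℝ} (hε : 0 < ε) :
    ∃ δ > 0, ∀ s ∈ Icc a b, ∀ t ∈ Icc a b, |s - t| < δ → ‖f s - f t‖ ≤ ε := by
  obtain ⟨δ, hδ, H⟩ := Metric.uniformContinuousOn_iff.1
    (isCompact_Icc.uniformContinuousOn_of_continuous hf) ε hε
  refine ⟨δ, hδ, fun s hs t ht hst => ?_⟩
  have := H s hs t ht (by rwa [Real.dist_eq])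
  rw [dist_eq_norm] at this
  exact this.le

/-- Product rule for indefinite integrals of an operator-valued and a vector-valued function. -/
theorem integral_product_rule [CompleteSpace E] [CompleteSpace G] {P P' : ℝ → E →L[ℝ] G}
    {y y' : ℝ → E} {p : ℝ → ℝ} {a b : ℝ} (hab : a ≤ b)
    (hp : IntervalIntegrable p volume a b) (hPp : ∀ r ∈ Icc a b, ‖P' r‖ ≤ p r)
    (hy' : IntervalIntegrable y' volume a b)
    (hP' : ∀ x, IntervalIntegrable (fun r => P' r x) volume a b)
    (hP : ∀ x, ∀ s t, a ≤ s → s ≤ t → t ≤ b → P t x - P s x = ∫ r in s..t, P' r x)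
    (hy : ∀ s t, a ≤ s → s ≤ t → t ≤ b → y t - y s = ∫ r in s..t, y' r)
    (hPc : ContinuousOn P (Icc a b)) (hyc : ContinuousOn y (Icc a b))
    (hi : IntervalIntegrable (fun r => P' r (y r)) volume a b)
    (hi' : IntervalIntegrable (fun r => P r (y' r)) volume a b) :
    P b (y b) - P a (y a) = ∫ r in a..b, (P' r (y r) + P r (y' r)) := by
  set g : ℝ → ℝ := fun r => p r + ‖y' r‖ with hg
  have hgi : IntervalIntegrable g volume a b := hp.add hy'.norm
  have hI := hi.add hi'
  have := eq_of_small_increments (a := a) (b := b)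
    (f := fun t => P t (y t) - ∫ r in a..t, (P' r (y r) + P r (y' r)))
    (m := fun t => ∫ r in a..t, g r) hab ?_
  · simp only [intervalIntegral.integral_same, sub_zero] at this
    rw [← this]; abel
  intro ε hε
  obtain ⟨δ₁, hδ₁, H₁⟩ := exists_modulus hPc hε
  obtain ⟨δ₂, hδ₂, H₂⟩ := exists_modulus hyc hε
  refine ⟨min δ₁ δ₂, lt_min hδ₁ hδ₂, fun s s' hs hss' hs' hlt => ?_⟩
  have i1 := intervalIntegrable_mono hi hs hss' hs'
  have i2 := intervalIntegrable_mono hi' hs hss' hs'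
  have i3 := intervalIntegrable_mono hy' hs hss' hs'
  have i4 := intervalIntegrable_mono (hP' (y s)) hs hss' hs'
  have i5 : IntervalIntegrable (fun r => P s' (y' r)) volume s s' := intervalIntegrable_clm_comp (P s') i3
  -- The defect on `[s, s']` is an integral in which `P'` meets an increment of `y` and `y'` an
  -- increment of `P`; uniform continuity makes both small. `P'` itself need only be strongly
  -- integrable with an integrable bound, as happens for evolution families.
  have e1 : P s' (y s') - (∫ r in a..s', (P' r (y r) + P r (y' r))) -
      (P s (y s) - ∫ r in a..s, (P' r (y r) + P r (y' r))) =
      ∫ r in s..s', ((P' r (y s) - P' r (y r)) + (P s' (y' r) - P r (y' r))) := by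
    rw [intervalIntegral.integral_add (i4.sub i1) (i5.sub i2), intervalIntegral.integral_sub i4 i1,
      intervalIntegral.integral_sub i5 i2, ← hP (y s) s s' hs hss' hs',
      ContinuousLinearMap.intervalIntegral_comp_comm _ i3, ← hy s s' hs hss' hs', map_sub]
    have := integral_sub_integral hI hs hss' hs'
    rw [intervalIntegral.integral_add i1 i2] at this
    rw [sub_eq_iff_eq_add] at this
    rw [this]
    abel
  change ‖P s' (y s') - (∫ r in a..s', (P' r (y r) + P r (y' r))) -
      (P s (y s) - ∫ r in a..s, (P' r (y r) + P r (y' r)))‖ ≤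
      ε * ((∫ r in a..s', g r) - ∫ r in a..s, g r)
  rw [e1, integral_sub_integral hgi hs hss' hs', ← intervalIntegral.integral_const_mul]
  refine intervalIntegral.norm_integral_le_of_norm_le hss' (ae_of_all _ fun r hr => ?_)
    ((intervalIntegrable_mono hgi hs hss' hs').const_mul ε)
  have hrI : r ∈ Icc a b := ⟨hs.trans hr.1.le, hr.2.trans hs'⟩
  have hsI : s ∈ Icc a b := ⟨hs, hss'.trans hs'⟩
  have hsI' : s' ∈ Icc a b := ⟨hs.trans hss', hs'⟩
  rw [← map_sub, ← sub_apply]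
  refine (norm_add_le _ _).trans ?_
  have b1 : ‖P' r (y s - y r)‖ ≤ p r * ε := by
    refine (ContinuousLinearMap.le_opNorm _ _).trans ?_
    refine mul_le_mul (hPp r hrI) (H₂ s hsI r hrI ?_) (norm_nonneg _)
      ((norm_nonneg _).trans (hPp r hrI))
    rw [abs_sub_comm, abs_of_nonneg (by linarith [hr.1])]
    linarith [hr.2, min_le_right δ₁ δ₂]
  have b2 : ‖(P s' - P r) (y' r)‖ ≤ ε * ‖y' r‖ := by
    refine (ContinuousLinearMap.le_opNorm _ _).trans ?_
    refine mul_le_mul_of_nonneg_right (H₁ s' hsI' r hrI ?_) (norm_nonneg _)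
    rw [abs_of_nonneg (by linarith [hr.2])]
    linarith [hr.1, min_le_left δ₁ δ₂]
  simp only [hg]
  nlinarith

/-- The increment form of `d(x ^ (k + 1)) = (k + 1) x ^ k dx`, for use with a primitive that need
not be differentiable everywhere. -/
theorem pow_mul_sub_le {x y : ℝ} (hx : 0 ≤ x) (hxy : x ≤ y) (k : ℕ) :
    (k + 1) * (x ^ k * (y - x)) ≤ y ^ (k + 1) - x ^ (k + 1) := by
  induction k with
  | zero => simp
  | succ k ih =>
    have h1 : x * ((k + 1) * (x ^ k * (y - x))) ≤ y * (y ^ (k + 1) - x ^ (k + 1)) :=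
      mul_le_mul hxy ih (by have := sub_nonneg.2 hxy; positivity) (hx.trans hxy)
    push_cast
    have e : (k + 1 + 1) * (x ^ (k + 1) * (y - x)) =
      x * ((k + 1) * (x ^ k * (y - x))) + x ^ (k + 1) * (y - x) := by ring
    rw [e]
    have e2 : y ^ (k + 1 + 1) - x ^ (k + 1 + 1) =
      y * (y ^ (k + 1) - x ^ (k + 1)) + x ^ (k + 1) * (y - x) := by ring
    rw [e2]
    linarith

/-- `∫ φ Φ ^ k / k! ≤ Φ ^ (k + 1) / (k + 1)!` for the primitive `Φ` of a nonnegative function. -/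
theorem integral_mul_pow_primitive_le {φ : ℝ → ℝ} {s t : ℝ} (hst : s ≤ t)
    (hφ : IntervalIntegrable φ volume s t) (hφ0 : ∀ r, 0 ≤ φ r) (k : ℕ) :
    ∫ r in s..t, φ r * ((∫ u in s..r, φ u) ^ k / k.factorial) ≤
      (∫ u in s..t, φ u) ^ (k + 1) / (k + 1).factorial := by
  set Φ : ℝ → ℝ := fun r => ∫ u in s..r, φ u with hΦ
  have hΦc : ContinuousOn Φ (Icc s t) := by
    have := intervalIntegral.continuousOn_primitive_interval (f := φ) (μ := volume) (a := s) (b := t)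
      (by rw [uIcc_of_le hst]; exact (intervalIntegrable_iff_integrableOn_Icc_of_le hst).1 hφ)
    rwa [uIcc_of_le hst] at this
  have hmono : ∀ u v, s ≤ u → u ≤ v → v ≤ t → Φ u ≤ Φ v := by
    intro u v h1 h2 h3
    have := integral_sub_integral hφ h1 h2 h3
    have h4 : 0 ≤ ∫ r in u..v, φ r := intervalIntegral.integral_nonneg h2 fun r _ => hφ0 r
    simp only [hΦ]
    linarith
  have hΦ0 : ∀ v, s ≤ v → v ≤ t → 0 ≤ Φ v := fun v h1 h2 => by
    have := hmono s v le_rfl h1 h2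
    simpa [hΦ] using this
  have hint : IntervalIntegrable (fun r => φ r * Φ r ^ k) volume s t := by
    apply hφ.mul_continuousOn
    rw [uIcc_of_le hst]
    exact hΦc.pow k
  have key : (∫ r in s..t, φ r * Φ r ^ k) ≤ Φ t ^ (k + 1) / (k + 1) := by
    have := le_of_small_increments (a := s) (b := t) hst
      (f := fun v => (∫ r in s..v, φ r * Φ r ^ k) - Φ v ^ (k + 1) / (k + 1)) (m := Φ) ?_
    · simp only [intervalIntegral.integral_same, hΦ] at this
      simp only [hΦ]
      have h0 : (0 : ℝ) ^ (k + 1) / (k + 1) = 0 := by simp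
      linarith
    intro ε hε
    obtain ⟨δ, hδ, H⟩ := exists_modulus (hΦc.pow k) hε
    refine ⟨δ, hδ, fun u v h1 h2 h3 h4 => ?_⟩
    have e1 := integral_sub_integral hint h1 h2 h3
    have e2 := integral_sub_integral hφ h1 h2 h3
    -- Replacing `Φ r` by its value at the right end and comparing with `pow_mul_sub_le` at the left
    -- end leaves the error `(Φ v ^ k - Φ u ^ k) * (Φ v - Φ u)`, which is small relative to the
    -- increment of `Φ`.
    have hle : (∫ r in u..v, φ r * Φ r ^ k) ≤ ∫ r in u..v, φ r * Φ v ^ k := by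
      refine intervalIntegral.integral_mono_on h2 (intervalIntegrable_mono hint h1 h2 h3)
        ((intervalIntegrable_mono hφ h1 h2 h3).mul_const _) fun r hr => ?_
      exact mul_le_mul_of_nonneg_left (pow_le_pow_left₀ (hΦ0 r (h1.trans hr.1) (hr.2.trans h3))
        (hmono r v (h1.trans hr.1) hr.2 h3) k) (hφ0 r)
    rw [intervalIntegral.integral_mul_const, ← e2] at hle
    have hb := pow_mul_sub_le (hΦ0 u h1 (h2.trans h3)) (hmono u v h1 h2 h3) k
    have hk : (0 : ℝ) < k + 1 := by positivity
    have hb' : Φ u ^ k * (Φ v - Φ u) ≤ Φ v ^ (k + 1) / (k + 1) - Φ u ^ (k + 1) / (k + 1) := by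
      rw [← sub_div, le_div_iff₀ hk]; linarith
    have hm := H v ⟨h1.trans h2, h3⟩ u ⟨h1, h2.trans h3⟩ (by rw [abs_of_nonneg] <;> linarith)
    rw [Real.norm_eq_abs] at hm
    have hm' := (le_abs_self _).trans hm
    have hd := sub_nonneg.2 (hmono u v h1 h2 h3)
    have h5 : (Φ v ^ k - Φ u ^ k) * (Φ v - Φ u) ≤ ε * (Φ v - Φ u) :=
      mul_le_mul_of_nonneg_right hm' hd
    change _ ≤ ε * (Φ v - Φ u)
    change (Φ v - Φ u) * Φ v ^ k ≥ _ at hle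
    nlinarith
  have e : (∫ r in s..t, φ r * (Φ r ^ k / k.factorial)) =
      (∫ r in s..t, φ r * Φ r ^ k) / k.factorial := by
    rw [← intervalIntegral.integral_div]
    exact intervalIntegral.integral_congr fun r _ => (mul_div_assoc _ _ _).symm
  rw [e, Nat.factorial_succ]
  push_cast
  rw [div_mul_eq_div_div]
  exact div_le_div_of_nonneg_right key (by positivity)

/-- A continuous seminorm of an integral is at most the integral of a bound of the seminorm. -/
theorem seminorm_integral_le [CompleteSpace E] (N : Seminorm ℝ E) {c : ℝ} (hN : ∀ x, N x ≤ c * ‖x‖)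
    {s t : ℝ} (hst : s ≤ t) {f : ℝ → E} {g : ℝ → ℝ} (hf : IntervalIntegrable f volume s t)
    (hg : IntervalIntegrable g volume s t) (hfg : ∀ r ∈ Icc s t, N (f r) ≤ g r) :
    N (∫ r in s..t, f r) ≤ ∫ r in s..t, g r := by
  set x₀ := ∫ r in s..t, f r with hx₀
  by_cases h0 : x₀ = 0
  · rw [h0, map_zero]
    exact intervalIntegral.integral_nonneg hst fun r hr => (apply_nonneg N _).trans (hfg r hr)
  -- Hahn–Banach gives a functional below `N` that attains `N x₀` at `x₀`. It is continuous because
  -- `N` is, so it commutes with the integral.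
  obtain ⟨ℓ, h1, h2⟩ := exists_extension_of_le_sublinear
    (LinearPMap.mkSpanSingleton x₀ (N x₀) h0 : E →ₗ.[ℝ] ℝ) N
    (fun r hr x => by rw [map_smul_eq_mul, Real.norm_of_nonneg hr.le]) (map_add_le_add N) (by
      rintro ⟨x, hx⟩
      obtain ⟨r, rfl⟩ := Submodule.mem_span_singleton.1 hx
      rw [LinearPMap.mkSpanSingleton'_apply, map_smul_eq_mul]
      exact mul_le_mul_of_nonneg_right (le_abs_self r) (apply_nonneg N _))
  have hℓ : ℓ x₀ = N x₀ := by
    rw [← LinearPMap.mkSpanSingleton_apply ℝ ℝ h0 (N x₀)]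
    exact h1 ⟨x₀, Submodule.mem_span_singleton_self x₀⟩
  set ℓ' : E →L[ℝ] ℝ := ℓ.mkContinuous c fun x => by
    rw [Real.norm_eq_abs, abs_le]
    refine ⟨?_, (h2 x).trans (hN x)⟩
    have := (h2 (-x)).trans (hN (-x))
    rw [map_neg, norm_neg] at this
    linarith
  have h3 : ℓ' x₀ = ∫ r in s..t, ℓ' (f r) := (ℓ'.intervalIntegral_comp_comm hf).symm
  rw [← hℓ]
  change ℓ' x₀ ≤ _
  rw [h3]
  exact intervalIntegral.integral_mono_on hst (intervalIntegrable_clm_comp ℓ' hf) hg fun r hr =>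
    (h2 (f r)).trans (hfg r hr)

end Analysis

end EvolutionScale

/-! ### Dyson series: perturbation of a two-parameter family by an integrable coefficient -/

namespace EvolutionScale

noncomputable section Dyson

open Set MeasureTheory Filter Topology

set_option linter.unusedSectionVars false

/-- The projection of `ℝ` onto `[a, b]`. -/
def clamp (a b t : ℝ) : ℝ := max a (min b t)

theorem continuous_clamp (a b : ℝ) : Continuous (clamp a b) := by
  unfold clamp; fun_prop

theorem clamp_mono (a b : ℝ) : Monotone (clamp a b) := fun _ _ h =>
  max_le_max le_rfl (min_le_min le_rfl h)

theorem le_clamp (a b t : ℝ) : a ≤ clamp a b t := le_max_left _ _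

theorem clamp_le {a b : ℝ} (hab : a ≤ b) (t : ℝ) : clamp a b t ≤ b :=
  max_le hab (min_le_left _ _)

theorem clamp_mem {a b : ℝ} (hab : a ≤ b) (t : ℝ) : clamp a b t ∈ Icc a b :=
  ⟨le_clamp a b t, clamp_le hab t⟩

theorem clamp_of_mem {a b t : ℝ} (h1 : a ≤ t) (h2 : t ≤ b) : clamp a b t = t := by
  rw [clamp, min_eq_right h2, max_eq_right h1]

variable {E : Type*} [NormedAddCommGroup E] [NormedSpace ℝ E]
variable {G : Type*} [NormedAddCommGroup G] [NormedSpace ℝ G]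

/-- A strongly continuous, uniformly bounded two-parameter family of operators. -/
structure IsStrongFamily (V : ℝ → ℝ → E →L[ℝ] E) (M : ℝ) : Prop where
  cont : ∀ x, Continuous fun p : ℝ × ℝ => V p.1 p.2 x
  bound : ∀ t s, ‖V t s‖ ≤ M

/-- A strongly measurable family of operators dominated by an integrable function. -/
structure IsCoefficient (F : ℝ → E →L[ℝ] E) (φ : ℝ → ℝ) : Prop where
  integrable : Integrable φ
  norm_le : ∀ r, ‖F r‖ ≤ φ r
  meas : ∀ w : ℝ → E, Continuous w → AEStronglyMeasurable (fun r => F r (w r)) volume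

/-- Submultiplicative bounds `κ s t` of `V t s` in time dependent norms `N t` that are equivalent
to the norm of `E`, on the triangle `a ≤ s ≤ t ≤ b`. -/
structure IsGrowthBound (N : ℝ → Seminorm ℝ E) (κ : ℝ → ℝ → ℝ) (a b c C : ℝ)
    (V : ℝ → ℝ → E →L[ℝ] E) : Prop where
  const_nonneg : 0 ≤ c
  seminorm_le : ∀ t ∈ Icc a b, ∀ x, N t x ≤ c * ‖x‖
  norm_le : ∀ t ∈ Icc a b, ∀ x, ‖x‖ ≤ c * N t x
  nonneg : ∀ s t, a ≤ s → s ≤ t → t ≤ b → 0 ≤ κ s t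
  mul_le : ∀ s r t, a ≤ s → s ≤ r → r ≤ t → t ≤ b → κ s r * κ r t ≤ κ s t
  le_const : ∀ s t, a ≤ s → s ≤ t → t ≤ b → κ s t ≤ C
  bound : ∀ s t, a ≤ s → s ≤ t → t ≤ b → ∀ x, N t (V t s x) ≤ κ s t * N s x

variable {V : ℝ → ℝ → E →L[ℝ] E} {F : ℝ → E →L[ℝ] E} {M : ℝ} {φ : ℝ → ℝ}

theorem IsStrongFamily.const_nonneg (hV : IsStrongFamily V M) : 0 ≤ M :=
  (norm_nonneg _).trans (hV.bound 0 0)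

theorem IsCoefficient.nonneg (hF : IsCoefficient F φ) (r : ℝ) : 0 ≤ φ r :=
  (norm_nonneg _).trans (hF.norm_le r)

/-- Strong convergence of bounded operators, tested on a convergent family of vectors. -/
theorem tendsto_clm_apply {α : Type*} {l : Filter α} {T : α → E →L[ℝ] G} {T₀ : E →L[ℝ] G}
    {x : α → E} {x₀ : E} {M : ℝ} (hT : ∀ᶠ i in l, ‖T i‖ ≤ M)
    (h : Tendsto (fun i => T i x₀) l (𝓝 (T₀ x₀))) (hx : Tendsto x l (𝓝 x₀)) :
    Tendsto (fun i => T i (x i)) l (𝓝 (T₀ x₀)) := by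
  have h1 : Tendsto (fun i => T i (x i - x₀)) l (𝓝 0) := by
    have h2 : Tendsto (fun i => M * ‖x i - x₀‖) l (𝓝 0) := by
      have := (tendsto_sub_nhds_zero_iff.2 hx).norm.const_mul M
      simpa using this
    refine squeeze_zero_norm' ?_ h2
    filter_upwards [hT] with i hi
    exact (ContinuousLinearMap.le_opNorm _ _).trans
      (mul_le_mul_of_nonneg_right hi (norm_nonneg _))
  have := h1.add h
  simpa using this

/-- The uniform operator bound turns strong continuity into joint continuity in times and vector,
and hence gives measurability of the integrands below. -/
theorem IsStrongFamily.continuous_apply (hV : IsStrongFamily V M) :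
    Continuous fun p : ℝ × ℝ × E => V p.1 p.2.1 p.2.2 := by
  rw [continuous_iff_continuousAt]
  rintro ⟨t, s, x⟩
  refine tendsto_clm_apply (T := fun p : ℝ × ℝ × E => V p.1 p.2.1) (T₀ := V t s) (M := M)
    (Eventually.of_forall fun p => hV.bound _ _) ?_ ?_
  · exact ((hV.cont x).comp (continuous_fst.prodMk (continuous_fst.comp continuous_snd))).tendsto
      (t, s, x)
  · exact (continuous_snd.comp continuous_snd).tendsto (t, s, x)

theorem IsStrongFamily.aestronglyMeasurable (hV : IsStrongFamily V M) (t : ℝ) {g : ℝ → E}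
    {μ : Measure ℝ} (hg : AEStronglyMeasurable g μ) :
    AEStronglyMeasurable (fun r => V t r (g r)) μ :=
  hV.continuous_apply.comp_aestronglyMeasurable
    (aestronglyMeasurable_const.prodMk (aestronglyMeasurable_id.prodMk hg))

theorem volterra_norm_le (hV : IsStrongFamily V M) (hF : IsCoefficient F φ) (t r : ℝ) (x : E) :
    ‖V t r (F r x)‖ ≤ M * φ r * ‖x‖ := by
  refine ((V t r).le_opNorm _).trans ?_
  rw [mul_assoc]
  exact mul_le_mul (hV.bound t r) ((F r).le_of_opNorm_le (hF.norm_le r) x) (norm_nonneg _)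
    hV.const_nonneg

theorem volterra_intervalIntegrable (hV : IsStrongFamily V M) (hF : IsCoefficient F φ)
    {y : ℝ → E} (hy : Continuous y) (t s u : ℝ) :
    IntervalIntegrable (fun r => V t r (F r (y r))) volume s u := by
  have h1 : IntervalIntegrable (fun r => M * φ r * ‖y r‖) volume s u :=
    (hF.integrable.intervalIntegrable.const_mul M).mul_continuousOn hy.norm.continuousOn
  refine h1.mono_fun' (hV.aestronglyMeasurable t (hF.meas y hy).restrict) ?_
  exact ae_of_all _ fun r => volterra_norm_le hV hF t r (y r)

variable (V F) in
/-- The terms of the Dyson series for the perturbation of `V` by `F`. -/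
def dysonTerm : ℕ → ℝ → ℝ → E → E
  | 0, t, s, x => V t s x
  | k + 1, t, s, x => ∫ r in s..t, V t r (F r (dysonTerm k r s x))

/-- The geometric bound is crude but holds for all pairs of times, in either order; it serves as a
dominating function. Summability comes later, from the factorial bound on the triangle. -/
theorem dysonTerm_continuous_and_bounded (hV : IsStrongFamily V M) (hF : IsCoefficient F φ) (x : E)
    (k : ℕ) : (Continuous fun p : ℝ × ℝ => dysonTerm V F k p.1 p.2 x) ∧
      ∀ t s, ‖dysonTerm V F k t s x‖ ≤ M * (M * ∫ r, φ r) ^ k * ‖x‖ := by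
  induction k with
  | zero =>
    refine ⟨hV.cont x, fun t s => ?_⟩
    simpa [dysonTerm] using (V t s).le_of_opNorm_le (hV.bound t s) x
  | succ k ih =>
    obtain ⟨hc, hb⟩ := ih
    set K := M * (M * ∫ r, φ r) ^ k * ‖x‖ with hK
    have hbound : ∀ t s r, ‖V t r (F r (dysonTerm V F k r s x))‖ ≤ M * φ r * K := fun t s r =>
      (volterra_norm_le hV hF t r _).trans (mul_le_mul_of_nonneg_left (hb r s)
        (mul_nonneg hV.const_nonneg (hF.nonneg r)))
    have hcs : ∀ s, Continuous fun r => dysonTerm V F k r s x := fun s =>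
      hc.comp (continuous_id.prodMk continuous_const)
    have hint : Integrable fun r => M * φ r * K := (hF.integrable.const_mul M).mul_const K
    constructor
    · rw [continuous_iff_continuousAt]
      rintro ⟨t₀, s₀⟩
      -- The integral from `s` to `t` is a difference of two primitives based at 0, so one statement
      -- with a free upper limit handles both moving ends.
      have main : ∀ b₀ : ℝ, ContinuousAt (fun q : (ℝ × ℝ) × ℝ =>
          ∫ r in (0 : ℝ)..q.2, V q.1.1 r (F r (dysonTerm V F k r q.1.2 x))) ((t₀, s₀), b₀) := by
        intro b₀
        refine intervalIntegral.continuousAt_parametric_primitive_of_dominated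
          (F := fun p : ℝ × ℝ => fun r => V p.1 r (F r (dysonTerm V F k r p.2 x)))
          (fun r => M * φ r * K) (-|b₀| - 1) (|b₀| + 1) ?_ ?_ hint.intervalIntegrable ?_ ?_ ?_ ?_
        · exact fun p => hV.aestronglyMeasurable _ (hF.meas _ (hcs _)).restrict
        · exact Eventually.of_forall fun p => ae_of_all _ fun r => hbound _ _ r
        · refine ae_of_all _ fun r => Continuous.continuousAt ?_
          exact hV.continuous_apply.comp (continuous_fst.prodMk (continuous_const.prodMk
            ((F r).continuous.comp (hc.comp (continuous_const.prodMk continuous_snd)))))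
        · constructor <;> linarith [abs_nonneg b₀]
        · constructor <;> linarith [neg_abs_le b₀, le_abs_self b₀]
        · simp
      have h1 : ContinuousAt (fun p : ℝ × ℝ =>
          ∫ r in (0 : ℝ)..p.1, V p.1 r (F r (dysonTerm V F k r p.2 x))) (t₀, s₀) :=
        ContinuousAt.comp (f := fun p : ℝ × ℝ => (p, p.1)) (main t₀) (by fun_prop)
      have h2 : ContinuousAt (fun p : ℝ × ℝ =>
          ∫ r in (0 : ℝ)..p.2, V p.1 r (F r (dysonTerm V F k r p.2 x))) (t₀, s₀) :=
        ContinuousAt.comp (f := fun p : ℝ × ℝ => (p, p.2)) (main s₀) (by fun_prop)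
      refine (h1.sub h2).congr (Eventually.of_forall fun p => ?_)
      exact intervalIntegral.integral_interval_sub_left
        (volterra_intervalIntegrable hV hF (hcs _) _ _ _)
        (volterra_intervalIntegrable hV hF (hcs _) _ _ _)
    · intro t s
      have h1 : ‖dysonTerm V F (k + 1) t s x‖ ≤ |∫ r in s..t, M * φ r * K| := by
        refine intervalIntegral.norm_integral_le_abs_of_norm_le (ae_of_all _ fun r => hbound t s r)
          hint.intervalIntegrable
      have hK0 : 0 ≤ K := (norm_nonneg _).trans (hb 0 0)
      have hnn : ∀ r, 0 ≤ M * φ r * K := fun r =>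
        mul_nonneg (mul_nonneg hV.const_nonneg (hF.nonneg r)) hK0
      have h2 : |∫ r in s..t, M * φ r * K| ≤ ∫ r, M * φ r * K := by
        rw [← Real.norm_eq_abs, intervalIntegral.norm_integral_eq_norm_integral_uIoc,
          Real.norm_of_nonneg (integral_nonneg hnn)]
        exact setIntegral_le_integral hint (ae_of_all _ hnn)
      refine h1.trans (h2.trans (le_of_eq ?_))
      rw [integral_mul_const, integral_const_mul, hK]
      ring

theorem dysonTerm_continuous (hV : IsStrongFamily V M) (hF : IsCoefficient F φ) (x : E) (k : ℕ)
    (s : ℝ) : Continuous fun r => dysonTerm V F k r s x :=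
  (dysonTerm_continuous_and_bounded hV hF x k).1.comp (continuous_id.prodMk continuous_const)

theorem dysonTerm_add (hV : IsStrongFamily V M) (hF : IsCoefficient F φ) (k : ℕ) (t s : ℝ)
    (x y : E) : dysonTerm V F k t s (x + y) = dysonTerm V F k t s x + dysonTerm V F k t s y := by
  induction k generalizing t with
  | zero => simp [dysonTerm]
  | succ k ih =>
    simp only [dysonTerm, ih, map_add]
    exact intervalIntegral.integral_add
      (volterra_intervalIntegrable hV hF (dysonTerm_continuous hV hF x k s) _ _ _)
      (volterra_intervalIntegrable hV hF (dysonTerm_continuous hV hF y k s) _ _ _)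

theorem dysonTerm_smul (k : ℕ) (t s c : ℝ) (x : E) :
    dysonTerm V F k t s (c • x) = c • dysonTerm V F k t s x := by
  induction k generalizing t with
  | zero => simp [dysonTerm]
  | succ k ih => simp only [dysonTerm, ih, map_smul, intervalIntegral.integral_smul]

variable {N : ℝ → Seminorm ℝ E} {κ : ℝ → ℝ → ℝ} {a b c C : ℝ}

/-- Passing from `N r` to the norm and back costs `c ^ 2`. With `c = C_L * C_Q ^ n` this is where
`C_L ^ 2` and most of the powers of `C_Q` in the final exponent originate. -/
theorem IsGrowthBound.seminorm_apply_le (hN : IsGrowthBound N κ a b c C V)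
    (hF : IsCoefficient F φ) {r : ℝ} (hr : r ∈ Icc a b) (x : E) :
    N r (F r x) ≤ c ^ 2 * φ r * N r x := by
  have h1 := hN.seminorm_le r hr (F r x)
  have h2 := (F r).le_of_opNorm_le (hF.norm_le r) x
  have h3 := hN.norm_le r hr x
  calc N r (F r x) ≤ c * (φ r * (c * N r x)) :=
        h1.trans (mul_le_mul_of_nonneg_left
          (h2.trans (mul_le_mul_of_nonneg_left h3 (hF.nonneg r))) hN.const_nonneg)
    _ = _ := by ring

theorem IsGrowthBound.growth_const_nonneg (hN : IsGrowthBound N κ a b c C V) (hab : a ≤ b) :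
    0 ≤ C :=
  (hN.nonneg a a le_rfl le_rfl hab).trans (hN.le_const a a le_rfl le_rfl hab)

theorem IsCoefficient.sq_mul_integrable (hF : IsCoefficient F φ) (c : ℝ) :
    Integrable fun r => c ^ 2 * φ r :=
  hF.integrable.const_mul _

theorem IsCoefficient.sq_mul_nonneg (hF : IsCoefficient F φ) (c r : ℝ) : 0 ≤ c ^ 2 * φ r :=
  mul_nonneg (sq_nonneg c) (hF.nonneg r)

theorem continuousOn_primitive_pow {f : ℝ → ℝ} (hf : Integrable f) (s t : ℝ) (k : ℕ) :
    IntervalIntegrable (fun r => f r * ((∫ u in s..r, f u) ^ k / k.factorial)) volume s t := by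
  refine hf.intervalIntegrable.mul_continuousOn (Continuous.continuousOn ?_)
  exact ((intervalIntegral.continuous_primitive (fun _ _ => hf.intervalIntegrable) s).pow k).div_const
    _

variable [CompleteSpace E] [CompleteSpace G]

/-- Supermultiplicativity `κ s r * κ r t ≤ κ s t` lets the growth factor leave the iterated integral
with constant exactly one; what remains is the integral of a product over a simplex. -/
theorem dysonTerm_seminorm_le (hN : IsGrowthBound N κ a b c C V) (hV : IsStrongFamily V M)
    (hF : IsCoefficient F φ) (k : ℕ) {s t : ℝ} (hs : a ≤ s) (hst : s ≤ t) (ht : t ≤ b) (x : E) :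
    N t (dysonTerm V F k t s x) ≤
      κ s t * ((∫ r in s..t, c ^ 2 * φ r) ^ k / k.factorial) * N s x := by
  induction k generalizing t with
  | zero => simpa [dysonTerm] using hN.bound s t hs hst ht x
  | succ k ih =>
    set Φ : ℝ → ℝ := fun r => ∫ u in s..r, c ^ 2 * φ u with hΦ
    have hI := continuousOn_primitive_pow (hF.sq_mul_integrable c) s t k
    have hNs : 0 ≤ N s x := apply_nonneg _ _
    have h1 : N t (dysonTerm V F (k + 1) t s x) ≤
        ∫ r in s..t, κ s t * N s x * (c ^ 2 * φ r * (Φ r ^ k / k.factorial)) := by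
      refine seminorm_integral_le (N t) (hN.seminorm_le t ⟨hs.trans hst, ht⟩) hst
        (volterra_intervalIntegrable hV hF (dysonTerm_continuous hV hF x k s) _ _ _)
        (hI.const_mul _) fun r hr => ?_
      have hrI : r ∈ Icc a b := ⟨hs.trans hr.1, hr.2.trans ht⟩
      have hκ := hN.nonneg r t hrI.1 hr.2 ht
      have hcφ := hF.sq_mul_nonneg c r
      have hΦ0 : 0 ≤ Φ r ^ k / k.factorial := by
        have : 0 ≤ Φ r := intervalIntegral.integral_nonneg hr.1 fun u _ => hF.sq_mul_nonneg c u
        positivity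
      calc N t (V t r (F r (dysonTerm V F k r s x)))
          ≤ κ r t * (c ^ 2 * φ r * (κ s r * (Φ r ^ k / k.factorial) * N s x)) := by
            refine (hN.bound r t hrI.1 hr.2 ht _).trans (mul_le_mul_of_nonneg_left ?_ hκ)
            exact (hN.seminorm_apply_le hF hrI _).trans
              (mul_le_mul_of_nonneg_left (ih hr.1 hrI.2) hcφ)
        _ = (κ s r * κ r t) * (N s x * (c ^ 2 * φ r * (Φ r ^ k / k.factorial))) := by ring
        _ ≤ κ s t * (N s x * (c ^ 2 * φ r * (Φ r ^ k / k.factorial))) :=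
            mul_le_mul_of_nonneg_right (hN.mul_le s r t hs hr.1 hr.2 ht) (by positivity)
        _ = _ := by ring
    refine h1.trans ?_
    rw [intervalIntegral.integral_const_mul]
    have h2 := integral_mul_pow_primitive_le hst (hF.sq_mul_integrable c).intervalIntegrable
      (hF.sq_mul_nonneg c) k
    calc _ ≤ κ s t * N s x * (Φ t ^ (k + 1) / (k + 1).factorial) :=
          mul_le_mul_of_nonneg_left h2 (mul_nonneg (hN.nonneg s t hs hst ht) hNs)
      _ = _ := by ring

theorem IsCoefficient.integral_le (hF : IsCoefficient F φ) (c : ℝ) {s t : ℝ} (hst : s ≤ t) :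
    (∫ r in s..t, c ^ 2 * φ r) ≤ c ^ 2 * ∫ r, φ r := by
  rw [intervalIntegral.integral_of_le hst, ← integral_const_mul]
  exact setIntegral_le_integral (hF.sq_mul_integrable c) (ae_of_all _ (hF.sq_mul_nonneg c))

theorem IsCoefficient.integral_nonneg (hF : IsCoefficient F φ) (c : ℝ) {s t : ℝ} (hst : s ≤ t) :
    0 ≤ ∫ r in s..t, c ^ 2 * φ r :=
  intervalIntegral.integral_nonneg hst fun r _ => hF.sq_mul_nonneg c r

theorem dysonTerm_norm_le (hN : IsGrowthBound N κ a b c C V) (hV : IsStrongFamily V M)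
    (hF : IsCoefficient F φ) (k : ℕ) {s t : ℝ} (hs : a ≤ s) (hst : s ≤ t) (ht : t ≤ b) (x : E) :
    ‖dysonTerm V F k t s x‖ ≤
      c ^ 2 * C * ‖x‖ * ((c ^ 2 * ∫ r, φ r) ^ k / k.factorial) := by
  have h1 := hN.norm_le t ⟨hs.trans hst, ht⟩ (dysonTerm V F k t s x)
  have h2 := dysonTerm_seminorm_le hN hV hF k hs hst ht x
  have h3 := hN.seminorm_le s ⟨hs, hst.trans ht⟩ x
  have hc := hN.const_nonneg
  have hC := hN.growth_const_nonneg (hs.trans (hst.trans ht))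
  have h0 := hF.integral_nonneg c hst
  have h4 : (∫ r in s..t, c ^ 2 * φ r) ^ k / k.factorial ≤
      (c ^ 2 * ∫ r, φ r) ^ k / k.factorial :=
    div_le_div_of_nonneg_right (pow_le_pow_left₀ h0 (hF.integral_le c hst) k) (by positivity)
  calc _ ≤ c * (C * ((c ^ 2 * ∫ r, φ r) ^ k / k.factorial) * (c * ‖x‖)) := by
        refine h1.trans (mul_le_mul_of_nonneg_left (h2.trans ?_) hc)
        refine mul_le_mul (mul_le_mul (hN.le_const s t hs hst ht) h4 (by positivity) hC) h3
          (apply_nonneg _ _) (mul_nonneg hC ?_)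
        exact le_trans (by positivity) h4
    _ = _ := by ring

theorem summable_dysonBound (K z : ℝ) : Summable fun k : ℕ => K * (z ^ k / k.factorial) :=
  (Real.summable_pow_div_factorial z).mul_left K

theorem tsum_dysonBound (K z : ℝ) : ∑' k : ℕ, K * (z ^ k / k.factorial) = K * Real.exp z := by
  rw [tsum_mul_left, Real.exp_eq_exp_ℝ, NormedSpace.exp_eq_tsum_div]

theorem dysonTerm_summable (hN : IsGrowthBound N κ a b c C V) (hV : IsStrongFamily V M)
    (hF : IsCoefficient F φ) {s t : ℝ} (hs : a ≤ s) (hst : s ≤ t) (ht : t ≤ b) (x : E) :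
    Summable fun k => dysonTerm V F k t s x :=
  Summable.of_norm_bounded (summable_dysonBound _ _) fun k =>
    dysonTerm_norm_le hN hV hF k hs hst ht x

variable (V F a b) in
/-- The sum of the Dyson series on the triangle `a ≤ s ≤ t ≤ b`, extended to the plane. -/
def dysonSum (t s : ℝ) (x : E) : E :=
  ∑' k, dysonTerm V F k (clamp a b (max s t)) (clamp a b s) x

theorem dysonSum_eq {s t : ℝ} (hs : a ≤ s) (hst : s ≤ t) (ht : t ≤ b) (x : E) :
    dysonSum V F a b t s x = ∑' k, dysonTerm V F k t s x := by
  rw [dysonSum, max_eq_right hst, clamp_of_mem (hs.trans hst) ht, clamp_of_mem hs (hst.trans ht)]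

/-- `W` is the perturbation of `V` by `F`: the sum of the Dyson series. -/
def IsDyson (V : ℝ → ℝ → E →L[ℝ] E) (F : ℝ → E →L[ℝ] E) (a b : ℝ) (W : ℝ → ℝ → E →L[ℝ] E) : Prop :=
  ∀ t s x, W t s x = dysonSum V F a b t s x

theorem exists_isDyson (hN : IsGrowthBound N κ a b c C V) (hV : IsStrongFamily V M)
    (hF : IsCoefficient F φ) (hab : a ≤ b) : ∃ W : ℝ → ℝ → E →L[ℝ] E, IsDyson V F a b W := by
  have tri : ∀ t s, clamp a b s ≤ clamp a b (max s t) := fun t s =>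
    clamp_mono a b (le_max_left s t)
  have hsum : ∀ t s x, Summable fun k => dysonTerm V F k (clamp a b (max s t)) (clamp a b s) x :=
    fun t s x => dysonTerm_summable hN hV hF (le_clamp _ _ _) (tri t s) (clamp_le hab _) x
  refine ⟨fun t s => LinearMap.mkContinuous
    { toFun := dysonSum V F a b t s
      map_add' := fun x y => ?_
      map_smul' := fun r x => ?_ } (c ^ 2 * C * Real.exp (c ^ 2 * ∫ r, φ r)) fun x => ?_,
    fun t s x => rfl⟩
  · simp only [dysonSum, dysonTerm_add hV hF]
    exact (hsum t s x).tsum_add (hsum t s y)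
  · simp only [dysonSum, dysonTerm_smul, RingHom.id_apply]
    exact (hsum t s x).tsum_const_smul r
  · have := tsum_of_norm_bounded (summable_dysonBound (c ^ 2 * C * ‖x‖) (c ^ 2 * ∫ r, φ r)).hasSum
      fun k => dysonTerm_norm_le hN hV hF k (le_clamp a b s) (tri t s) (clamp_le hab _) x
    rw [tsum_dysonBound] at this
    refine this.trans (le_of_eq ?_)
    ring

variable {W : ℝ → ℝ → E →L[ℝ] E}

theorem IsDyson.isStrongFamily (hW : IsDyson V F a b W) (hN : IsGrowthBound N κ a b c C V)
    (hV : IsStrongFamily V M) (hF : IsCoefficient F φ) (hab : a ≤ b) :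
    IsStrongFamily W (c ^ 2 * C * Real.exp (c ^ 2 * ∫ r, φ r)) := by
  have tri : ∀ t s, clamp a b s ≤ clamp a b (max s t) := fun t s =>
    clamp_mono a b (le_max_left s t)
  have hb : ∀ k x t s, ‖dysonTerm V F k (clamp a b (max s t)) (clamp a b s) x‖ ≤
      c ^ 2 * C * ‖x‖ * ((c ^ 2 * ∫ r, φ r) ^ k / k.factorial) := fun k x t s =>
    dysonTerm_norm_le hN hV hF k (le_clamp a b s) (tri t s) (clamp_le hab _) x
  constructor
  · intro x
    have : (fun p : ℝ × ℝ => W p.1 p.2 x) = fun p => dysonSum V F a b p.1 p.2 x :=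
      funext fun p => hW p.1 p.2 x
    rw [this]
    refine continuous_tsum (fun k => ?_) (summable_dysonBound (c ^ 2 * C * ‖x‖) (c ^ 2 * ∫ r, φ r))
      fun k p => hb k x p.1 p.2
    refine (dysonTerm_continuous_and_bounded hV hF x k).1.comp (f := fun p : ℝ × ℝ =>
      (clamp a b (max p.2 p.1), clamp a b p.2)) ?_
    have := continuous_clamp a b
    fun_prop
  · intro t s
    refine ContinuousLinearMap.opNorm_le_bound _ ?_ fun x => ?_
    · exact mul_nonneg (mul_nonneg (sq_nonneg c) (hN.growth_const_nonneg hab)) (Real.exp_pos _).le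
    · have := tsum_of_norm_bounded
        (summable_dysonBound (c ^ 2 * C * ‖x‖) (c ^ 2 * ∫ r, φ r)).hasSum fun k => hb k x t s
      rw [tsum_dysonBound] at this
      rw [hW]
      refine this.trans (le_of_eq ?_)
      ring

/-- Growth of a Dyson series, with the exact constant. -/
theorem IsDyson.isGrowthBound (hW : IsDyson V F a b W) (hN : IsGrowthBound N κ a b c C V)
    (hV : IsStrongFamily V M) (hF : IsCoefficient F φ) (hab : a ≤ b) :
    IsGrowthBound N (fun s t => κ s t * Real.exp (∫ r in s..t, c ^ 2 * φ r)) a b c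
      (C * Real.exp (c ^ 2 * ∫ r, φ r)) W where
  const_nonneg := hN.const_nonneg
  seminorm_le := hN.seminorm_le
  norm_le := hN.norm_le
  nonneg s t hs hst ht := mul_nonneg (hN.nonneg s t hs hst ht) (Real.exp_pos _).le
  mul_le s r t hs hsr hrt ht := by
    have h := intervalIntegral.integral_add_adjacent_intervals
      ((hF.sq_mul_integrable c).intervalIntegrable (a := s) (b := r))
      ((hF.sq_mul_integrable c).intervalIntegrable (a := r) (b := t))
    rw [← h, Real.exp_add]
    have := mul_le_mul_of_nonneg_right (hN.mul_le s r t hs hsr hrt ht)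
      (mul_nonneg (Real.exp_pos (∫ u in s..r, c ^ 2 * φ u)).le
        (Real.exp_pos (∫ u in r..t, c ^ 2 * φ u)).le)
    refine le_trans (le_of_eq ?_) this
    ring
  le_const s t hs hst ht :=
    mul_le_mul (hN.le_const s t hs hst ht) (Real.exp_le_exp.2 (hF.integral_le c hst))
      (Real.exp_pos _).le (hN.growth_const_nonneg hab)
  bound s t hs hst ht x := by
    have hsum := (dysonTerm_summable hN hV hF hs hst ht x).hasSum
    rw [← dysonSum_eq hs hst ht, ← hW] at hsum
    have hcont : Continuous (N t) := by
      refine Seminorm.continuous_of_continuousAt_zero ?_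
      rw [ContinuousAt, map_zero]
      refine squeeze_zero (fun x => apply_nonneg (N t) x)
        (hN.seminorm_le t ⟨hs.trans hst, ht⟩) ?_
      have : Tendsto (fun x : E => c * ‖x‖) (𝓝 0) (𝓝 (c * ‖(0 : E)‖)) :=
        (continuous_const.mul continuous_norm).tendsto 0
      simpa using this
    have h1 := (hcont.tendsto _).comp hsum.tendsto_sum_nat
    refine le_of_tendsto' h1 fun n => ?_
    have h2 : N t (∑ k ∈ Finset.range n, dysonTerm V F k t s x) ≤
        ∑ k ∈ Finset.range n, N t (dysonTerm V F k t s x) := Finset.le_sum_of_subadditive (N t) (map_zero _).le (map_add_le_add _) _ _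
    refine h2.trans ((Finset.sum_le_sum fun k _ =>
      dysonTerm_seminorm_le hN hV hF k hs hst ht x).trans ?_)
    rw [← Finset.sum_mul, ← Finset.mul_sum]
    refine mul_le_mul_of_nonneg_right (mul_le_mul_of_nonneg_left ?_ (hN.nonneg s t hs hst ht))
      (apply_nonneg _ _)
    exact Real.sum_le_exp_of_nonneg (hF.integral_nonneg c hst) n

/-- The zeroth term is split off, and the recursion for the others is summed under the integral by
dominated convergence. -/
theorem IsDyson.volterra (hW : IsDyson V F a b W) (hN : IsGrowthBound N κ a b c C V)
    (hV : IsStrongFamily V M) (hF : IsCoefficient F φ)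
    {s t : ℝ} (hs : a ≤ s) (hst : s ≤ t) (ht : t ≤ b) (x : E) :
    W t s x = V t s x + ∫ r in s..t, V t r (F r (W r s x)) := by
  have hsum := dysonTerm_summable hN hV hF hs hst ht x
  rw [hW, dysonSum_eq hs hst ht, hsum.tsum_eq_zero_add]
  congr 1
  set K := c ^ 2 * C * ‖x‖
  set z := c ^ 2 * ∫ r, φ r
  have := intervalIntegral.hasSum_integral_of_dominated_convergence (μ := volume) (a := s) (b := t)
    (F := fun k r => V t r (F r (dysonTerm V F k r s x))) (f := fun r => V t r (F r (W r s x)))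
    (fun k r => M * φ r * (K * (z ^ k / k.factorial))) ?_ ?_ ?_ ?_ ?_
  · exact this.tsum_eq
  · exact fun k => hV.aestronglyMeasurable t (hF.meas _ (dysonTerm_continuous hV hF x k s)).restrict
  · refine fun k => ae_of_all _ fun r hr => ?_
    rw [uIoc_of_le hst] at hr
    exact (volterra_norm_le hV hF t r _).trans (mul_le_mul_of_nonneg_left
      (dysonTerm_norm_le hN hV hF k hs hr.1.le (hr.2.trans ht) x)
      (mul_nonneg hV.const_nonneg (hF.nonneg r)))
  · exact ae_of_all _ fun r _ => (summable_dysonBound K z).mul_left _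
  · simp only [tsum_mul_left]
    exact ((hF.integrable.const_mul M).mul_const _).intervalIntegrable
  · refine ae_of_all _ fun r hr => ?_
    rw [uIoc_of_le hst] at hr
    have h1 := (dysonTerm_summable hN hV hF hs hr.1.le (hr.2.trans ht) x).hasSum
    rw [← dysonSum_eq hs hr.1.le (hr.2.trans ht), ← hW] at h1
    exact ((V t r).comp (F r)).hasSum h1

/-- The homogeneous Volterra equation has only the trivial solution. -/
theorem volterra_eq_zero (hN : IsGrowthBound N κ a b c C V)
    (hV : IsStrongFamily V M) (hF : IsCoefficient F φ) {s : ℝ} (hs : a ≤ s)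
    {d : ℝ → E} (hd : Continuous d)
    (h : ∀ t, s ≤ t → t ≤ b → d t = ∫ r in s..t, V t r (F r (d r))) {t : ℝ} (hst : s ≤ t)
    (ht : t ≤ b) : d t = 0 := by
  obtain ⟨K, hK⟩ := isCompact_Icc.exists_bound_of_continuousOn (s := Icc s b) hd.continuousOn
  have hsb := hst.trans ht
  have hC := hN.growth_const_nonneg (hs.trans hsb)
  have hK0 : 0 ≤ K := (norm_nonneg _).trans (hK s ⟨le_rfl, hsb⟩)
  have hc := hN.const_nonneg
  set Φ : ℝ → ℝ := fun r => ∫ u in s..r, c ^ 2 * φ u with hΦ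
  -- Feeding the equation into itself `k` times gains the factor `(C * Φ t) ^ k / k!`, which tends
  -- to zero.
  have ind : ∀ k : ℕ, ∀ t, s ≤ t → t ≤ b →
      N t (d t) ≤ c * K * C ^ k * (Φ t ^ k / k.factorial) := by
    intro k
    induction k with
    | zero =>
      intro t hst ht
      have := (hN.seminorm_le t ⟨hs.trans hst, ht⟩ (d t)).trans
        (mul_le_mul_of_nonneg_left (hK t ⟨hst, ht⟩) hc)
      simpa using this
    | succ k ih =>
      intro t hst ht
      have hI := continuousOn_primitive_pow (hF.sq_mul_integrable c) s t k
      have h1 : N t (d t) ≤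
          ∫ r in s..t, c * K * C ^ (k + 1) * (c ^ 2 * φ r * (Φ r ^ k / k.factorial)) := by
        rw [h t hst ht]
        refine seminorm_integral_le (N t) (hN.seminorm_le t ⟨hs.trans hst, ht⟩) hst
          (volterra_intervalIntegrable hV hF hd _ _ _) (hI.const_mul _) fun r hr => ?_
        have hrI : r ∈ Icc a b := ⟨hs.trans hr.1, hr.2.trans ht⟩
        calc N t (V t r (F r (d r)))
            ≤ C * (c ^ 2 * φ r * (c * K * C ^ k * (Φ r ^ k / k.factorial))) := by
              refine (hN.bound r t hrI.1 hr.2 ht _).trans (mul_le_mul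
                (hN.le_const r t hrI.1 hr.2 ht) ?_ (apply_nonneg _ _) hC)
              exact (hN.seminorm_apply_le hF hrI _).trans
                (mul_le_mul_of_nonneg_left (ih r hr.1 hrI.2) (hF.sq_mul_nonneg c r))
          _ = _ := by ring
      refine h1.trans ?_
      rw [intervalIntegral.integral_const_mul]
      exact mul_le_mul_of_nonneg_left (integral_mul_pow_primitive_le hst
        (hF.sq_mul_integrable c).intervalIntegrable (hF.sq_mul_nonneg c) k) (by positivity)
  have hlim : Tendsto (fun k : ℕ => c * K * ((C * Φ t) ^ k / k.factorial)) atTop (𝓝 0) := by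
    have := (FloorSemiring.tendsto_pow_div_factorial_atTop (C * Φ t)).const_mul (c * K)
    simpa using this
  have h0 : N t (d t) ≤ 0 := by
    refine ge_of_tendsto' hlim fun k => (ind k t hst ht).trans (le_of_eq ?_)
    rw [mul_pow]
    ring
  have h1 := hN.norm_le t ⟨hs.trans hst, ht⟩ (d t)
  have h2 := mul_nonpos_of_nonneg_of_nonpos hc h0
  exact norm_le_zero_iff.1 (h1.trans h2)

theorem IsDyson.unique (hW : IsDyson V F a b W) (hN : IsGrowthBound N κ a b c C V)
    (hV : IsStrongFamily V M) (hF : IsCoefficient F φ) {s : ℝ} (hs : a ≤ s)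
    {y : ℝ → E} (hy : Continuous y) {x : E}
    (h : ∀ t, s ≤ t → t ≤ b → y t = V t s x + ∫ r in s..t, V t r (F r (y r))) {t : ℝ} (hst : s ≤ t)
    (ht : t ≤ b) : y t = W t s x := by
  have hab := hs.trans (hst.trans ht)
  have hWc : Continuous fun r => W r s x :=
    ((hW.isStrongFamily hN hV hF hab).cont x).comp (continuous_id.prodMk continuous_const)
  refine sub_eq_zero.1 (volterra_eq_zero hN hV hF hs (d := fun r => y r - W r s x)
    (hy.sub hWc) (fun t hst ht => ?_) hst ht)
  simp only [map_sub]
  rw [intervalIntegral.integral_sub (volterra_intervalIntegrable hV hF hy _ _ _)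
    (volterra_intervalIntegrable hV hF hWc _ _ _), h t hst ht, hW.volterra hN hV hF hs hst ht x]
  abel

/-- `M` and `φ` do not depend on `i`, so the geometric bound of the terms dominates all the
integrands at once. -/
theorem dysonTerm_tendsto {V' : ℕ → ℝ → ℝ → E →L[ℝ] E} {F' : ℕ → ℝ → E →L[ℝ] E}
    (hV' : ∀ i, IsStrongFamily (V' i) M) (hF' : ∀ i, IsCoefficient (F' i) φ)
    (hVlim : ∀ s t, a ≤ s → s ≤ t → t ≤ b → ∀ x, Tendsto (fun i => V' i t s x) atTop (𝓝 (V t s x)))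
    (hFlim : ∀ r ∈ Icc a b, ∀ x, Tendsto (fun i => F' i r x) atTop (𝓝 (F r x)))
    (k : ℕ) {s t : ℝ} (hs : a ≤ s) (hst : s ≤ t) (ht : t ≤ b) (x : E) :
    Tendsto (fun i => dysonTerm (V' i) (F' i) k t s x) atTop (𝓝 (dysonTerm V F k t s x)) := by
  induction k generalizing t with
  | zero => exact hVlim s t hs hst ht x
  | succ k ih =>
    set K := M * (M * ∫ r, φ r) ^ k * ‖x‖ with hK
    refine intervalIntegral.tendsto_integral_filter_of_dominated_convergence
      (fun r => M * φ r * K) ?_ ?_ ?_ ?_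
    · exact Eventually.of_forall fun i => (hV' i).aestronglyMeasurable t
        ((hF' i).meas _ (dysonTerm_continuous (hV' i) (hF' i) x k s)).restrict
    · refine Eventually.of_forall fun i => ae_of_all _ fun r _ => ?_
      exact (volterra_norm_le (hV' i) (hF' i) t r _).trans (mul_le_mul_of_nonneg_left
        ((dysonTerm_continuous_and_bounded (hV' i) (hF' i) x k).2 r s)
        (mul_nonneg (hV' i).const_nonneg ((hF' i).nonneg r)))
    · exact (((hF' 0).integrable.const_mul M).mul_const K).intervalIntegrable
    · refine ae_of_all _ fun r hr => ?_
      rw [uIoc_of_le hst] at hr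
      have hr' := hr.2.trans ht
      refine tendsto_clm_apply (Eventually.of_forall fun i => (hV' i).bound t r)
        (hVlim r t (hs.trans hr.1.le) hr.2 ht _) ?_
      exact tendsto_clm_apply (Eventually.of_forall fun i => (hF' i).norm_le r)
        (hFlim r ⟨hs.trans hr.1.le, hr'⟩ _) (ih hr.1.le hr')

/-- Dyson series depend continuously on the unperturbed family and on the perturbation. -/
theorem IsDyson.tendsto {V' W' : ℕ → ℝ → ℝ → E →L[ℝ] E} {F' : ℕ → ℝ → E →L[ℝ] E}
    {κ' : ℕ → ℝ → ℝ → ℝ}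
    (hW : IsDyson V F a b W) (hW' : ∀ i, IsDyson (V' i) (F' i) a b (W' i))
    (hN' : ∀ i, IsGrowthBound N (κ' i) a b c C (V' i))
    (hV' : ∀ i, IsStrongFamily (V' i) M) (hF' : ∀ i, IsCoefficient (F' i) φ)
    (hVlim : ∀ s t, a ≤ s → s ≤ t → t ≤ b → ∀ x, Tendsto (fun i => V' i t s x) atTop (𝓝 (V t s x)))
    (hFlim : ∀ r ∈ Icc a b, ∀ x, Tendsto (fun i => F' i r x) atTop (𝓝 (F r x)))
    {s t : ℝ} (hs : a ≤ s) (hst : s ≤ t) (ht : t ≤ b) (x : E) :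
    Tendsto (fun i => W' i t s x) atTop (𝓝 (W t s x)) := by
  have e : (fun i => W' i t s x) = fun i => ∑' k, dysonTerm (V' i) (F' i) k t s x :=
    funext fun i => by rw [hW', dysonSum_eq hs hst ht]
  rw [e, hW, dysonSum_eq hs hst ht]
  -- The growth functions `κ' i` may vary with `i`, but `c`, `C` and `φ` are common, so a single
  -- convergent exponential series dominates.
  exact tendsto_tsum_of_dominated_convergence
    (summable_dysonBound (c ^ 2 * C * ‖x‖) (c ^ 2 * ∫ r, φ r))
    (fun k => dysonTerm_tendsto hV' hF' hVlim hFlim k hs hst ht x)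
    (Eventually.of_forall fun i k => dysonTerm_norm_le (hN' i) (hV' i) (hF' i) k hs hst ht x)

/-- A bounded operator passes through the integrals. The coefficients need only be intertwined
almost everywhere, which suits weak derivatives `Q'`, and no bound is needed on the target family.
-/
theorem dysonTerm_intertwine {V' : ℝ → ℝ → G →L[ℝ] G} {F' : ℝ → G →L[ℝ] G} {T : E →L[ℝ] G}
    (hV : IsStrongFamily V M) (hF : IsCoefficient F φ)
    (hTV : ∀ s t, a ≤ s → s ≤ t → t ≤ b → ∀ x, T (V t s x) = V' t s (T x))
    (hTF : ∀ᵐ r, r ∈ Icc a b → ∀ x, T (F r x) = F' r (T x))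
    (k : ℕ) {s t : ℝ} (hs : a ≤ s) (hst : s ≤ t) (ht : t ≤ b) (x : E) :
    T (dysonTerm V F k t s x) = dysonTerm V' F' k t s (T x) := by
  induction k generalizing t with
  | zero => exact hTV s t hs hst ht x
  | succ k ih =>
    simp only [dysonTerm]
    rw [← ContinuousLinearMap.intervalIntegral_comp_comm _
      (volterra_intervalIntegrable hV hF (dysonTerm_continuous hV hF x k s) _ _ _)]
    refine intervalIntegral.integral_congr_ae ?_
    filter_upwards [hTF] with r hTr hr
    rw [uIoc_of_le hst] at hr
    rw [hTV r t (hs.trans hr.1.le) hr.2 ht, hTr ⟨hs.trans hr.1.le, hr.2.trans ht⟩,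
      ih hr.1.le (hr.2.trans ht)]

/-- An operator that intertwines the data of two Dyson series intertwines their sums. -/
theorem IsDyson.intertwine {V' W' : ℝ → ℝ → G →L[ℝ] G} {F' : ℝ → G →L[ℝ] G} {T : E →L[ℝ] G}
    (hW : IsDyson V F a b W) (hW' : IsDyson V' F' a b W')
    (hN : IsGrowthBound N κ a b c C V) (hV : IsStrongFamily V M) (hF : IsCoefficient F φ)
    (hTV : ∀ s t, a ≤ s → s ≤ t → t ≤ b → ∀ x, T (V t s x) = V' t s (T x))
    (hTF : ∀ᵐ r, r ∈ Icc a b → ∀ x, T (F r x) = F' r (T x))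
    {s t : ℝ} (hs : a ≤ s) (hst : s ≤ t) (ht : t ≤ b) (x : E) :
    T (W t s x) = W' t s (T x) := by
  rw [hW, hW', dysonSum_eq hs hst ht, dysonSum_eq hs hst ht,
    T.map_tsum (dysonTerm_summable hN hV hF hs hst ht x)]
  exact tsum_congr fun k => dysonTerm_intertwine hV hF hTV hTF k hs hst ht x

end Dyson

end EvolutionScale

/-! ### Evolution families of bounded coefficients, and the variation of constants formula -/

namespace EvolutionScale

noncomputable section Bounded

open Set MeasureTheory Filter Topology

set_option linter.unusedSectionVars false

variable {E : Type*} [NormedAddCommGroup E] [NormedSpace ℝ E]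
variable {F : ℝ → E →L[ℝ] E} {M : ℝ} {φ : ℝ → ℝ}

variable (E) in
/-- The trivial family of operators. -/
def idFamily (_ _ : ℝ) : E →L[ℝ] E := ContinuousLinearMap.id ℝ E

theorem idFamily_isStrongFamily : IsStrongFamily (idFamily E) 1 where
  cont _ := continuous_const
  bound _ _ := ContinuousLinearMap.norm_id_le

theorem idFamily_isGrowthBound (a b : ℝ) :
    IsGrowthBound (fun _ => normSeminorm ℝ E) (fun _ _ => 1) a b 1 1 (idFamily E) where
  const_nonneg := zero_le_one
  seminorm_le _ _ x := by simp
  norm_le _ _ x := by simp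
  nonneg _ _ _ _ _ := zero_le_one
  mul_le _ _ _ _ _ _ _ := by simp
  le_const _ _ _ _ _ := le_rfl
  bound _ _ _ _ _ x := by simp [idFamily]

theorem IsCoefficient.intervalIntegrable (hF : IsCoefficient F φ) {y : ℝ → E} (hy : Continuous y)
    (s t : ℝ) : IntervalIntegrable (fun r => F r (y r)) volume s t :=
  volterra_intervalIntegrable idFamily_isStrongFamily hF hy t s t

theorem IsStrongFamily.intervalIntegrable {V : ℝ → ℝ → E →L[ℝ] E} (hV : IsStrongFamily V M) (t : ℝ)
    {f : ℝ → E} {s u : ℝ} (hf : IntervalIntegrable f volume s u) :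
    IntervalIntegrable (fun r => V t r (f r)) volume s u := by
  refine (hf.norm.const_mul M).mono_fun' ?_ (ae_of_all _ fun r =>
    (V t r).le_of_opNorm_le (hV.bound t r) (f r))
  exact hV.aestronglyMeasurable t hf.def'.aestronglyMeasurable

variable [CompleteSpace E] {a b : ℝ} {S : ℝ → ℝ → E →L[ℝ] E}

/-- `S` is the evolution family of the ordinary differential equation `u' = F u` on `[a, b]`. -/
def IsBoundedEvolution (F : ℝ → E →L[ℝ] E) (a b : ℝ) (S : ℝ → ℝ → E →L[ℝ] E) : Prop :=
  IsDyson (idFamily E) F a b S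

theorem exists_isBoundedEvolution (hF : IsCoefficient F φ) (hab : a ≤ b) :
    ∃ S, IsBoundedEvolution F a b S :=
  exists_isDyson (idFamily_isGrowthBound a b) idFamily_isStrongFamily hF hab

namespace IsBoundedEvolution

theorem isStrongFamily (hS : IsBoundedEvolution F a b S) (hF : IsCoefficient F φ) (hab : a ≤ b) :
    IsStrongFamily S (Real.exp (∫ r, φ r)) := by
  simpa using IsDyson.isStrongFamily hS (idFamily_isGrowthBound a b) idFamily_isStrongFamily hF hab

theorem continuous_left (hS : IsBoundedEvolution F a b S) (hF : IsCoefficient F φ) (hab : a ≤ b)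
    (s : ℝ) (x : E) : Continuous fun r => S r s x :=
  ((hS.isStrongFamily hF hab).cont x).comp (continuous_id.prodMk continuous_const)

theorem forward (hS : IsBoundedEvolution F a b S) (hF : IsCoefficient F φ) {s t : ℝ} (hs : a ≤ s)
    (hst : s ≤ t) (ht : t ≤ b) (x : E) : S t s x = x + ∫ r in s..t, F r (S r s x) :=
  IsDyson.volterra hS (idFamily_isGrowthBound a b) idFamily_isStrongFamily hF hs hst ht x

theorem refl (hS : IsBoundedEvolution F a b S) (hF : IsCoefficient F φ) {s : ℝ} (hs : a ≤ s)
    (hsb : s ≤ b) (x : E) : S s s x = x := by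
  rw [hS.forward hF hs le_rfl hsb]; simp

theorem unique (hS : IsBoundedEvolution F a b S) (hF : IsCoefficient F φ) {s : ℝ} (hs : a ≤ s)
    {y : ℝ → E} (hy : Continuous y) {x : E}
    (h : ∀ t, s ≤ t → t ≤ b → y t = x + ∫ r in s..t, F r (y r)) {t : ℝ} (hst : s ≤ t)
    (ht : t ≤ b) : y t = S t s x :=
  IsDyson.unique hS (idFamily_isGrowthBound a b) idFamily_isStrongFamily hF hs hy h hst ht

/-- As functions of the final time, both sides solve the same integral equation started at `r`. -/
theorem comp (hS : IsBoundedEvolution F a b S) (hF : IsCoefficient F φ) {s r t : ℝ} (hs : a ≤ s)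
    (hsr : s ≤ r) (hrt : r ≤ t) (ht : t ≤ b) (x : E) : S t r (S r s x) = S t s x := by
  have hab := hs.trans (hsr.trans (hrt.trans ht))
  have hc := hS.continuous_left hF hab s x
  refine (hS.unique hF (hs.trans hsr) hc (fun u hu hub => ?_) hrt ht).symm
  rw [hS.forward hF hs (hsr.trans hu) hub x, hS.forward hF hs hsr (hu.trans hub) x, add_assoc,
    intervalIntegral.integral_add_adjacent_intervals (hF.intervalIntegrable hc _ _)
      (hF.intervalIntegrable hc _ _)]

theorem norm_sub_le (hS : IsBoundedEvolution F a b S) (hF : IsCoefficient F φ) {s t : ℝ}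
    (hs : a ≤ s) (hst : s ≤ t) (ht : t ≤ b) (x : E) :
    ‖S t s x - x‖ ≤ Real.exp (∫ r, φ r) * (∫ r in s..t, φ r) * ‖x‖ := by
  have hab := hs.trans (hst.trans ht)
  rw [hS.forward hF hs hst ht x, add_sub_cancel_left, mul_right_comm,
    ← intervalIntegral.integral_const_mul]
  refine intervalIntegral.norm_integral_le_of_norm_le hst (ae_of_all _ fun r _ => ?_)
    (hF.integrable.intervalIntegrable.const_mul _)
  rw [mul_comm]
  refine (F r).le_of_opNorm_le_of_le (hF.norm_le r) ?_
  exact (S r s).le_of_opNorm_le ((hS.isStrongFamily hF hab).bound r s) x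

theorem norm_sub_right_le (hS : IsBoundedEvolution F a b S) (hF : IsCoefficient F φ) {s r t : ℝ}
    (hs : a ≤ s) (hsr : s ≤ r) (hrt : r ≤ t) (ht : t ≤ b) (x : E) :
    ‖S t s x - S t r x‖ ≤ Real.exp (∫ r, φ r) ^ 2 * (∫ u in s..r, φ u) * ‖x‖ := by
  have hab := hs.trans (hsr.trans (hrt.trans ht))
  rw [← hS.comp hF hs hsr hrt ht x, ← map_sub]
  refine ((S t r).le_of_opNorm_le_of_le ((hS.isStrongFamily hF hab).bound t r)
    (hS.norm_sub_le hF hs hsr (hrt.trans ht) x)).trans (le_of_eq ?_)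
  ring

/-- In the initial time the continuity holds in operator norm, controlled by the primitive of `φ`.
`integral_product_rule` requires this of its operator factor. -/
theorem continuousOn_right (hS : IsBoundedEvolution F a b S) (hF : IsCoefficient F φ) {t : ℝ}
    (ht : t ≤ b) : ContinuousOn (S t) (Icc a t) := by
  set Φ : ℝ → ℝ := fun r => ∫ u in a..r, φ u with hΦ
  have hΦc : Continuous Φ := intervalIntegral.continuous_primitive
    (fun _ _ => hF.integrable.intervalIntegrable) a
  have key : ∀ s r, a ≤ s → s ≤ r → r ≤ t →
      ‖S t s - S t r‖ ≤ Real.exp (∫ r, φ r) ^ 2 * |Φ r - Φ s| := by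
    intro s r hs hsr hr
    refine ContinuousLinearMap.opNorm_le_bound _ (by positivity) fun x => ?_
    rw [sub_apply, hΦ, intervalIntegral.integral_interval_sub_left
      hF.integrable.intervalIntegrable hF.integrable.intervalIntegrable, abs_of_nonneg
      (intervalIntegral.integral_nonneg hsr fun u _ => hF.nonneg u)]
    exact hS.norm_sub_right_le hF hs hsr hr ht x
  intro s hs
  rw [ContinuousWithinAt, tendsto_iff_norm_sub_tendsto_zero]
  have hlim : Tendsto (fun r => Real.exp (∫ r, φ r) ^ 2 * |Φ r - Φ s|) (𝓝[Icc a t] s) (𝓝 0) := by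
    have : Continuous fun r => Real.exp (∫ r, φ r) ^ 2 * |Φ r - Φ s| := by fun_prop
    have h := (this.tendsto s).mono_left (nhdsWithin_le_nhds (s := Icc a t))
    simpa using h
  refine squeeze_zero' (Eventually.of_forall fun r => norm_nonneg _) ?_ hlim
  filter_upwards [self_mem_nhdsWithin] with r hr
  rcases le_total s r with h | h
  · rw [norm_sub_rev]; exact key s r hs.1 h hr.2
  · rw [abs_sub_comm]; exact key r s hr.1 h hs.2

/-- The integral form of `∂_s S(t, s) = -S(t, s) F(s)`. Because `F` is merely measurable in time,
increments are compared: the composition law gives `S t p - S t q = S t q (S q p - 1)`, and the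
forward equation rewrites the last factor. -/
theorem backward (hS : IsBoundedEvolution F a b S) (hF : IsCoefficient F φ) {s t : ℝ} (hs : a ≤ s)
    (hst : s ≤ t) (ht : t ≤ b) (x : E) : S t s x = x + ∫ r in s..t, S t r (F r x) := by
  have hab := hs.trans (hst.trans ht)
  set M := Real.exp (∫ r, φ r) with hM
  have hM0 : 0 < M := Real.exp_pos _
  have hSf := hS.isStrongFamily hF hab
  have hI : IntervalIntegrable (fun r => S t r (F r x)) volume s t :=
    volterra_intervalIntegrable hSf hF continuous_const t s t
  set Φ : ℝ → ℝ := fun r => ∫ u in s..r, φ u with hΦ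
  have hΦc : Continuous Φ := intervalIntegral.continuous_primitive
    (fun _ _ => hF.integrable.intervalIntegrable) s
  have hφi : ∀ u v, IntervalIntegrable φ volume u v := fun u v => hF.integrable.intervalIntegrable
  have key := eq_of_small_increments (a := s) (b := t) (m := Φ)
    (f := fun r => S t r x + ∫ u in s..r, S t u (F u x)) hst ?_
  · simp only [intervalIntegral.integral_same, add_zero] at key
    rw [← key, hS.refl hF (hs.trans hst) ht]
  intro ε hε
  -- Each of the two errors below is at most `M ^ 2 * (ε / D) * φ r * ‖x‖`, so `D` makes their sum
  -- at most `ε * φ r`.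
  set D := 2 * M ^ 2 * ‖x‖ + 1 with hD
  have hD0 : 0 < D := by positivity
  obtain ⟨δ, hδ, H⟩ := exists_modulus (hΦc.continuousOn (s := Icc s t)) (div_pos hε hD0)
  refine ⟨δ, hδ, fun p q hp hpq hq hlt => ?_⟩
  have hpa := hs.trans hp
  have hqb := hq.trans ht
  have hsub : ∀ u v, Φ v - Φ u = ∫ r in u..v, φ r := fun u v =>
    intervalIntegral.integral_interval_sub_left (hφi _ _) (hφi _ _)
  have hη : ∀ r ∈ Icc p q, Φ q - Φ r ≤ ε / D ∧ Φ r - Φ p ≤ ε / D := by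
    intro r hr
    have h1 : r ∈ Icc s t := ⟨hp.trans hr.1, hr.2.trans hq⟩
    constructor
    · refine (le_abs_self _).trans (H q ⟨hp.trans hpq, hq⟩ r h1 ?_)
      rw [abs_of_nonneg] <;> linarith [hr.1, hr.2]
    · refine (le_abs_self _).trans (H r h1 p ⟨hp, hpq.trans hq⟩ ?_)
      rw [abs_of_nonneg] <;> linarith [hr.1, hr.2]
  have hc := hS.continuous_left hF hab p x
  have i1 : IntervalIntegrable (fun r => S t r (F r x)) volume p q :=
    volterra_intervalIntegrable hSf hF continuous_const t p q
  have i2 : IntervalIntegrable (fun r => F r (S r p x)) volume p q := hF.intervalIntegrable hc _ _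
  have i3 : IntervalIntegrable (fun r => S t q (F r (S r p x))) volume p q :=
    intervalIntegrable_clm_comp (S t q) i2
  have e1 : (S t q x + ∫ u in s..q, S t u (F u x)) - (S t p x + ∫ u in s..p, S t u (F u x)) =
      ∫ r in p..q, (S t r (F r x) - S t q (F r (S r p x))) := by
    rw [intervalIntegral.integral_sub i1 i3, ContinuousLinearMap.intervalIntegral_comp_comm _ i2,
      ← integral_sub_integral hI hp hpq hq]
    have h1 : S t p x = S t q x + S t q (∫ r in p..q, F r (S r p x)) := by
      rw [← hS.comp hF hpa hpq hq ht x, hS.forward hF hpa hpq hqb x, map_add]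
    rw [h1]; abel
  change ‖(S t q x + ∫ u in s..q, S t u (F u x)) - (S t p x + ∫ u in s..p, S t u (F u x))‖ ≤
    ε * (Φ q - Φ p)
  rw [e1, hsub, ← intervalIntegral.integral_const_mul]
  refine intervalIntegral.norm_integral_le_of_norm_le hpq (ae_of_all _ fun r hr => ?_)
    ((hφi _ _).const_mul _)
  have hrI : r ∈ Icc p q := ⟨hr.1.le, hr.2⟩
  have b1 : ‖S t r (F r x) - S t q (F r x)‖ ≤ M ^ 2 * (ε / D) * (φ r * ‖x‖) := by
    refine (hS.norm_sub_right_le hF (hpa.trans hrI.1) hrI.2 hq ht _).trans ?_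
    rw [← hsub]
    have := (hη r hrI).1
    exact mul_le_mul (by gcongr) ((F r).le_of_opNorm_le (hF.norm_le r) x) (norm_nonneg _)
      (by positivity)
  have b2 : ‖S t q (F r (x - S r p x))‖ ≤ M * (φ r * (M * (ε / D) * ‖x‖)) := by
    refine (S t q).le_of_opNorm_le_of_le (hSf.bound t q)
      ((F r).le_of_opNorm_le_of_le (hF.norm_le r) ?_)
    rw [norm_sub_rev]
    refine (hS.norm_sub_le hF hpa hrI.1 (hrI.2.trans hqb) x).trans ?_
    rw [← hsub]
    have := (hη r hrI).2
    gcongr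
  have e2 : S t r (F r x) - S t q (F r (S r p x)) =
      (S t r (F r x) - S t q (F r x)) + S t q (F r (x - S r p x)) := by
    simp only [map_sub]; abel
  rw [e2]
  refine (norm_add_le_of_le b1 b2).trans ?_
  have hφ0 := hF.nonneg r
  have e3 : M ^ 2 * (ε / D) * (φ r * ‖x‖) + M * (φ r * (M * (ε / D) * ‖x‖)) =
      (ε / D) * φ r * (2 * M ^ 2 * ‖x‖) := by ring
  rw [e3]
  have h5 : (ε / D) * φ r * (2 * M ^ 2 * ‖x‖) ≤ (ε / D) * φ r * D :=
    mul_le_mul_of_nonneg_left (by rw [hD]; linarith) (by positivity)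
  refine h5.trans (le_of_eq ?_)
  field_simp

/-- The variation of constants formula. -/
theorem duhamel (hS : IsBoundedEvolution F a b S) (hF : IsCoefficient F φ) {s t : ℝ} (hs : a ≤ s)
    (hst : s ≤ t) (ht : t ≤ b) {y f : ℝ → E} (hy : Continuous y)
    (hf : IntervalIntegrable f volume s t)
    (h : ∀ u v, s ≤ u → u ≤ v → v ≤ t → y v - y u = ∫ r in u..v, (F r (y r) + f r)) :
    y t = S t s (y s) + ∫ r in s..t, S t r (f r) := by
  have hab := hs.trans (hst.trans ht)
  have hSf := hS.isStrongFamily hF hab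
  have iF : ∀ z : ℝ → E, Continuous z → ∀ u v,
      IntervalIntegrable (fun r => S t r (F r (z r))) volume u v := fun z hz u v =>
    volterra_intervalIntegrable hSf hF hz t u v
  have iSf : IntervalIntegrable (fun r => S t r (f r)) volume s t := hSf.intervalIntegrable t hf
  -- Differentiating `r ↦ S t r (y r)` makes the two terms containing `F` cancel, leaving `S t r (f
  -- r)`.
  have key := integral_product_rule (P := S t) (P' := fun r => -((S t r).comp (F r)))
    (y := y) (y' := fun r => F r (y r) + f r) (p := fun r => Real.exp (∫ r, φ r) * φ r)
    (a := s) (b := t) hst (hF.integrable.intervalIntegrable.const_mul _) (fun r _ => ?_)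
    ((hF.intervalIntegrable hy _ _).add hf) (fun x => ?_) (fun x u v hu huv hv => ?_) h
    ((hS.continuousOn_right hF ht).mono (Icc_subset_Icc_left hs)) hy.continuousOn ?_ ?_
  · rw [hS.refl hF (hs.trans hst) ht, sub_eq_iff_eq_add'] at key
    rw [key]
    congr 1
    refine intervalIntegral.integral_congr fun r _ => ?_
    simp
  · rw [norm_neg]
    exact (ContinuousLinearMap.opNorm_comp_le _ _).trans
      (mul_le_mul (hSf.bound t r) (hF.norm_le r) (norm_nonneg _) hSf.const_nonneg)
  · exact (iF (fun _ => x) continuous_const s t).neg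
  · have i1 := iF (fun _ => x) continuous_const u v
    have i2 := iF (fun _ => x) continuous_const v t
    rw [hS.backward hF (hs.trans hu) (huv.trans hv) ht x,
      hS.backward hF (hs.trans (hu.trans huv)) hv ht x,
      ← intervalIntegral.integral_add_adjacent_intervals i1 i2]
    have : (∫ r in u..v, (-((S t r).comp (F r))) x) = -∫ r in u..v, S t r (F r x) := by
      rw [← intervalIntegral.integral_neg]
      rfl
    rw [this]
    abel
  · exact (iF y hy s t).neg
  · simp only [map_add]
    exact (iF y hy s t).add iSf

end IsBoundedEvolution

end Bounded

end EvolutionScale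

/-! ### Energy forms, dissipative operators and their resolvents -/

namespace EvolutionScale

noncomputable section Resolvent

open Set MeasureTheory Filter Topology

set_option linter.unusedSectionVars false

variable {H : Type*} [NormedAddCommGroup H] [NormedSpace ℝ H]

/-- A symmetric form whose energy norm is equivalent to the norm. -/
structure IsEnergyForm (b : H →L[ℝ] StrongDual ℝ H) (C : ℝ) : Prop where
  one_le : 1 ≤ C
  symm : ∀ u v, b u v = b v u
  lower : ∀ v, C⁻¹ * ‖v‖ ≤ energyNorm b v
  upper : ∀ v, energyNorm b v ≤ C * ‖v‖

namespace IsEnergyForm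

variable {b : H →L[ℝ] StrongDual ℝ H} {C : ℝ}

theorem pos (hb : IsEnergyForm b C) : 0 < C := zero_lt_one.trans_le hb.one_le

theorem norm_le (hb : IsEnergyForm b C) (v : H) : ‖v‖ ≤ C * energyNorm b v := by
  have := mul_le_mul_of_nonneg_left (hb.lower v) hb.pos.le
  rwa [mul_inv_cancel_left₀ hb.pos.ne'] at this

theorem nonneg (hb : IsEnergyForm b C) (v : H) : 0 ≤ b v v := by
  by_cases hv : v = 0
  · simp [hv]
  have h1 : 0 < C⁻¹ * ‖v‖ := mul_pos (inv_pos.2 hb.pos) (norm_pos_iff.2 hv)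
  exact (Real.sqrt_pos.1 (h1.trans_le (hb.lower v))).le

theorem sq_energyNorm (hb : IsEnergyForm b C) (v : H) : energyNorm b v ^ 2 = b v v :=
  Real.sq_sqrt (hb.nonneg v)

theorem energyNorm_nonneg (v : H) : 0 ≤ energyNorm b v := Real.sqrt_nonneg _

theorem apply_le (hb : IsEnergyForm b C) (u v : H) :
    b u v ≤ energyNorm b u * energyNorm b v := by
  have h : ∀ r : ℝ, 0 ≤ b v v * (r * r) + 2 * b u v * r + b u u := fun r => by
    have := hb.nonneg (u + r • v)
    simp only [map_add, map_smul, add_apply, smul_apply, smul_eq_mul] at this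
    rw [hb.symm v u] at this
    linarith
  have h1 := discrim_le_zero h
  rw [discrim, ← hb.sq_energyNorm u, ← hb.sq_energyNorm v] at h1
  refine (abs_le_of_sq_le_sq' ?_ (mul_nonneg (energyNorm_nonneg u) (energyNorm_nonneg v))).2
  nlinarith

theorem apply_le_norm (hb : IsEnergyForm b C) (u v : H) : b u v ≤ C ^ 2 * ‖u‖ * ‖v‖ := by
  refine (hb.apply_le u v).trans ?_
  have := mul_le_mul (hb.upper u) (hb.upper v) (energyNorm_nonneg v)
    (mul_nonneg hb.pos.le (norm_nonneg u))
  refine this.trans (le_of_eq (by ring))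

theorem energyNorm_add_le (hb : IsEnergyForm b C) (u v : H) :
    energyNorm b (u + v) ≤ energyNorm b u + energyNorm b v := by
  have h1 := hb.apply_le u v
  refine abs_le_of_sq_le_sq' ?_ (add_nonneg (energyNorm_nonneg u) (energyNorm_nonneg v)) |>.2
  rw [hb.sq_energyNorm, add_sq, hb.sq_energyNorm, hb.sq_energyNorm]
  simp only [map_add, add_apply]
  rw [hb.symm v u]
  linarith

theorem energyNorm_smul (b : H →L[ℝ] StrongDual ℝ H) (r : ℝ) (v : H) :
    energyNorm b (r • v) = ‖r‖ * energyNorm b v := by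
  rw [energyNorm, energyNorm, map_smul, map_smul, smul_apply, smul_eq_mul, smul_eq_mul, ← mul_assoc,
    Real.sqrt_mul (mul_self_nonneg r), Real.sqrt_mul_self_eq_abs, Real.norm_eq_abs]

/-- The energy norm as a seminorm. -/
def seminorm (hb : IsEnergyForm b C) : Seminorm ℝ H :=
  Seminorm.of (energyNorm b) hb.energyNorm_add_le (energyNorm_smul b)

end IsEnergyForm

/-- `R` is the resolvent of `A` at `lam`. -/
structure IsResolvent (A : H →ₗ.[ℝ] H) (lam : ℝ) (R : H →L[ℝ] H) : Prop where
  right : ∀ y, ∃ h : R y ∈ A.domain, lam • R y - A ⟨R y, h⟩ = y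
  left : ∀ x : A.domain, R (lam • (x : H) - A x) = x

/-- `A` is dissipative up to `ω` in the energy norm of `b`. -/
def IsDissipative (b : H →L[ℝ] StrongDual ℝ H) (A : H →ₗ.[ℝ] H) (ω : ℝ) : Prop :=
  ∀ x : A.domain, b x (A x) ≤ ω * b x x

variable {b : H →L[ℝ] StrongDual ℝ H} {C ω lam : ℝ} {A : H →ₗ.[ℝ] H} {R : H →L[ℝ] H}

theorem IsDissipative.coercive (hA : IsDissipative b A ω) (hb : IsEnergyForm b C)
    (x : A.domain) : (lam - ω) * energyNorm b x ≤ energyNorm b (lam • (x : H) - A x) := by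
  have h1 := hb.apply_le x (lam • (x : H) - A x)
  have h2 := hA x
  simp only [map_sub, map_smul, smul_eq_mul] at h1
  rw [← hb.sq_energyNorm] at h1 h2
  rcases (IsEnergyForm.energyNorm_nonneg (b := b) (x : H)).eq_or_lt with h0 | h0
  · rw [← h0, mul_zero]
    exact IsEnergyForm.energyNorm_nonneg _
  · have h3 : energyNorm b x * ((lam - ω) * energyNorm b x) ≤
        energyNorm b x * energyNorm b (lam • (x : H) - A x) := by
      nlinarith
    exact le_of_mul_le_mul_left h3 h0

theorem IsResolvent.energyNorm_le (hR : IsResolvent A lam R) (hA : IsDissipative b A ω)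
    (hb : IsEnergyForm b C) (hlam : ω < lam) (y : H) :
    energyNorm b (R y) ≤ (lam - ω)⁻¹ * energyNorm b y := by
  obtain ⟨h, e⟩ := hR.right y
  have := hA.coercive (lam := lam) hb ⟨R y, h⟩
  rw [e] at this
  rw [inv_mul_eq_div, le_div_iff₀ (by linarith), mul_comm]
  exact this

theorem IsResolvent.norm_le (hR : IsResolvent A lam R) (hA : IsDissipative b A ω)
    (hb : IsEnergyForm b C) (hlam : ω < lam) : ‖R‖ ≤ C ^ 2 * (lam - ω)⁻¹ := by
  have h0 : 0 ≤ (lam - ω)⁻¹ := inv_nonneg.2 (by linarith)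
  refine R.opNorm_le_bound (by positivity) fun y => (hb.norm_le _).trans ?_
  have h1 := (hR.energyNorm_le hA hb hlam y).trans (mul_le_mul_of_nonneg_left (hb.upper y) h0)
  refine (mul_le_mul_of_nonneg_left h1 hb.pos.le).trans (le_of_eq (by ring))

/-- Coercivity supplies injectivity and the bound of the inverse, so surjectivity is all that
remains to be assumed. -/
theorem IsDissipative.exists_isResolvent (hA : IsDissipative b A ω) (hb : IsEnergyForm b C)
    (hlam : ω < lam) (hsurj : ∀ y : H, ∃ x : A.domain, lam • (x : H) - A x = y) :
    ∃ R, IsResolvent A lam R := by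
  set f : A.domain →ₗ[ℝ] H := lam • A.domain.subtype - A.toFun with hf
  have hf' : ∀ x : A.domain, f x = lam • (x : H) - A x := fun x => rfl
  have hinj : Function.Injective f := by
    rw [injective_iff_map_eq_zero]
    intro x hx
    have h1 := hA.coercive (lam := lam) hb x
    rw [← hf', hx] at h1
    have h2 : energyNorm b (0 : H) = 0 := by simp [energyNorm]
    rw [h2] at h1
    have h3 : energyNorm b (x : H) ≤ 0 := by
      by_contra h
      push Not at h
      nlinarith [mul_pos (sub_pos.2 hlam) h]
    have h4 := (hb.norm_le (x : H)).trans (mul_nonpos_of_nonneg_of_nonpos hb.pos.le h3)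
    exact Subtype.ext (norm_le_zero_iff.1 h4)
  set e := LinearEquiv.ofBijective f ⟨hinj, fun y => hsurj y⟩ with he
  have hright : ∀ y, lam • (e.symm y : H) - A (e.symm y) = y := fun y => by
    rw [← hf']
    exact e.apply_symm_apply y
  have hbd : ∀ y, ‖(A.domain.subtype ∘ₗ e.symm.toLinearMap) y‖ ≤
      C ^ 2 * (lam - ω)⁻¹ * ‖y‖ := fun y => by
    have h0 : 0 ≤ (lam - ω)⁻¹ := inv_nonneg.2 (by linarith)
    have h1 := hA.coercive (lam := lam) hb (e.symm y)
    rw [hright, ← le_div_iff₀' (by linarith), ← inv_mul_eq_div] at h1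
    refine (hb.norm_le _).trans ((mul_le_mul_of_nonneg_left (h1.trans
      (mul_le_mul_of_nonneg_left (hb.upper y) h0)) hb.pos.le).trans (le_of_eq (by ring)))
  refine ⟨(A.domain.subtype ∘ₗ e.symm.toLinearMap).mkContinuous _ hbd, fun y => ?_, fun x => ?_⟩
  · exact ⟨(e.symm y).2, hright y⟩
  · have : e.symm (f x) = x := e.symm_apply_apply x
    change ((e.symm (f x) : A.domain) : H) = x
    rw [this]

/-- Some power has norm below one, and `1 - T` is a commuting factor of `1 - T ^ n`. Powers are used
because `T` will contract only in the energy norm; equivalence with the norm costs a constant `K`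
that need not be absorbed for `n = 1`. -/
theorem isUnit_one_sub_of_norm_pow_le [CompleteSpace H] {T : H →L[ℝ] H} {K q : ℝ}
    (hq : q < 1) (hq0 : 0 ≤ q) (h : ∀ n : ℕ, ‖T ^ n‖ ≤ K * q ^ n) : IsUnit (1 - T) := by
  have hlim : Tendsto (fun n : ℕ => K * q ^ n) atTop (𝓝 0) := by
    have := (tendsto_pow_atTop_nhds_zero_of_lt_one hq0 hq).const_mul K
    simpa using this
  obtain ⟨n, hn⟩ := (hlim.eventually (gt_mem_nhds zero_lt_one)).exists
  have h1 : IsUnit (1 - T ^ n) := isUnit_one_sub_of_norm_lt_one ((h n).trans_lt hn)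
  rw [← mul_neg_geom_sum] at h1
  have hcomm : Commute (1 - T) (∑ i ∈ Finset.range n, T ^ i) :=
    (Commute.one_left _).sub_left (Commute.sum_right _ _ _ fun i _ => (Commute.refl T).pow_right i)
  exact (hcomm.isUnit_mul_iff.1 h1).1

/-- Surjectivity of `lam - A` propagates to nearby larger `lam`. -/
theorem IsDissipative.surjective_of_lt [CompleteSpace H] (hA : IsDissipative b A ω)
    (hb : IsEnergyForm b C) {mu : ℝ} (hlam : ω < lam)
    (hsurj : ∀ y : H, ∃ x : A.domain, lam • (x : H) - A x = y) (hmu : |lam - mu| < lam - ω) :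
    ∀ y : H, ∃ x : A.domain, mu • (x : H) - A x = y := by
  obtain ⟨R, hR⟩ := hA.exists_isResolvent hb hlam hsurj
  -- The factorization is `mu - A = (1 - (lam - mu) R) (lam - A)`; the first factor is inverted by a
  -- Neumann argument in the energy norm.
  set T := (lam - mu) • R with hT
  set q := |lam - mu| * (lam - ω)⁻¹ with hq
  have hpos : 0 < lam - ω := by linarith
  have hq0 : 0 ≤ q := by positivity
  have hq1 : q < 1 := by
    rw [hq, ← div_eq_mul_inv, div_lt_one hpos]; exact hmu
  have hT1 : ∀ y, energyNorm b (T y) ≤ q * energyNorm b y := fun y => by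
    rw [hT, smul_apply, IsEnergyForm.energyNorm_smul, Real.norm_eq_abs, hq, mul_assoc]
    exact mul_le_mul_of_nonneg_left (hR.energyNorm_le hA hb hlam y) (abs_nonneg _)
  have hTn : ∀ (n : ℕ) (y : H), energyNorm b ((T ^ n) y) ≤ q ^ n * energyNorm b y := by
    intro n
    induction n with
    | zero => intro y; simp
    | succ n ih =>
      intro y
      rw [pow_succ', mul_apply_eq_comp, pow_succ', mul_assoc]
      exact (hT1 _).trans (mul_le_mul_of_nonneg_left (ih y) hq0)
  have hunit : IsUnit (1 - T) := by
    refine isUnit_one_sub_of_norm_pow_le (K := C ^ 2) hq1 hq0 fun n => ?_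
    refine ContinuousLinearMap.opNorm_le_bound _ (by positivity) fun y => (hb.norm_le _).trans ?_
    have := (hTn n y).trans (mul_le_mul_of_nonneg_left (hb.upper y) (pow_nonneg hq0 n))
    exact (mul_le_mul_of_nonneg_left this hb.pos.le).trans (le_of_eq (by ring))
  obtain ⟨u, hu⟩ := hunit
  intro y
  set z := (↑u⁻¹ : H →L[ℝ] H) y with hz
  have hz' : z - T z = y := by
    have : (u * ↑u⁻¹ : H →L[ℝ] H) y = y := by rw [Units.mul_inv]; rfl
    rw [hu] at this
    simpa using this
  obtain ⟨h, e⟩ := hR.right z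
  refine ⟨⟨R z, h⟩, ?_⟩
  have h2 : A ⟨R z, h⟩ = lam • R z - z := by
    rw [eq_sub_iff_add_eq, eq_comm, ← sub_eq_iff_eq_add']
    exact e
  have h3 : T z = lam • R z - mu • R z := by rw [hT, smul_apply, sub_smul]
  rw [h2, ← hz', h3]
  change mu • R z - (lam • R z - z) = z - (lam • R z - mu • R z)
  abel

/-- From a given parameter, every other one whose distance to `ω` is less than twice as large can be
reached. Steps by the factor `3 / 2` go beyond `lam`, and one step back ends the argument. -/
theorem IsDissipative.surjective [CompleteSpace H] (hA : IsDissipative b A ω)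
    (hb : IsEnergyForm b C) {lam₀ : ℝ} (hlam₀ : ω < lam₀)
    (hsurj : ∀ y : H, ∃ x : A.domain, lam₀ • (x : H) - A x = y) (hlam : ω < lam) :
    ∀ y : H, ∃ x : A.domain, lam • (x : H) - A x = y := by
  have hpos : 0 < lam₀ - ω := by linarith
  have key : ∀ n : ℕ, ∀ y : H, ∃ x : A.domain,
      (ω + (3 / 2) ^ n * (lam₀ - ω)) • (x : H) - A x = y := by
    intro n
    induction n with
    | zero => simpa using hsurj
    | succ n ih =>
      have hp : (0 : ℝ) < (3 / 2) ^ n * (lam₀ - ω) := by positivity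
      refine hA.surjective_of_lt hb (by linarith) ih ?_
      rw [pow_succ, abs_lt]
      constructor <;> linarith
  obtain ⟨n, hn⟩ := pow_unbounded_of_one_lt ((lam - ω) / (lam₀ - ω)) (by norm_num : (1 : ℝ) < 3 / 2)
  rw [div_lt_iff₀ hpos] at hn
  refine hA.surjective_of_lt hb (by linarith) (key n) ?_
  rw [abs_lt]
  constructor <;> linarith

section Core

variable {Y : Type*} [NormedAddCommGroup Y] [NormedSpace ℝ Y] {j a : Y →L[ℝ] H}

/-- `A` is the closure of `a`, viewed as an operator with domain the range of `j`. -/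
structure IsClosureOf (A : H →ₗ.[ℝ] H) (j a : Y →L[ℝ] H) : Prop where
  apply_eq : ∀ v, ∃ h : j v ∈ A.domain, A ⟨j v, h⟩ = a v
  approx : ∀ x : A.domain, ∃ v : ℕ → Y, Tendsto (fun n => j (v n)) atTop (𝓝 x) ∧
    Tendsto (fun n => a (v n)) atTop (𝓝 (A x))

theorem isClosureOf_of_hasCore (hA : A.IsClosed)
    (hcore : A.HasCore (LinearMap.range j.toLinearMap))
    (ha : ∀ v, ∃ h : j v ∈ A.domain, A ⟨j v, h⟩ = a v) : IsClosureOf A j a := by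
  refine ⟨ha, fun x => ?_⟩
  have hcl : (A.domRestrict (LinearMap.range j.toLinearMap)).IsClosable :=
    hA.isClosable.leIsClosable LinearPMap.domRestrict_le
  have h1 : ((x : H), A x) ∈
      (A.domRestrict (LinearMap.range j.toLinearMap)).graph.topologicalClosure := by
    rw [hcl.graph_closure_eq_closure_graph, hcore.closure_eq]
    exact A.mem_graph x
  rw [← SetLike.mem_coe, Submodule.topologicalClosure_coe, mem_closure_iff_seq_limit] at h1
  obtain ⟨p, hp, hlim⟩ := h1
  have h2 : ∀ n, ∃ v, (j v, a v) = p n := by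
    intro n
    obtain ⟨y, hy1, hy2⟩ := (LinearPMap.mem_graph_iff _).1 (hp n)
    obtain ⟨v, hv⟩ := y.2.1
    refine ⟨v, Prod.ext (hv.trans hy1) ?_⟩
    obtain ⟨h, e⟩ := ha v
    rw [← hy2, ← e]
    exact (LinearPMap.domRestrict_apply (y := ⟨j v, h⟩) hv.symm).symm
  choose v hv using h2
  refine ⟨v, ?_, ?_⟩
  · have := (continuous_fst.tendsto _).comp hlim
    refine this.congr fun n => ?_
    rw [Function.comp_apply, ← hv n]
  · have := (continuous_snd.tendsto _).comp hlim
    refine this.congr fun n => ?_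
    rw [Function.comp_apply, ← hv n]

theorem IsClosureOf.isDissipative (hA : IsClosureOf A j a)
    (h : ∀ v, b (j v) (a v) ≤ ω * b (j v) (j v)) : IsDissipative b A ω := by
  intro x
  obtain ⟨v, h1, h2⟩ := hA.approx x
  have hc : ∀ {f g : ℕ → H} {p q : H}, Tendsto f atTop (𝓝 p) → Tendsto g atTop (𝓝 q) →
      Tendsto (fun n => b (f n) (g n)) atTop (𝓝 (b p q)) := by
    intro f g p q hf hg
    have hcont : Continuous fun z : H × H => b z.1 z.2 := by fun_prop
    exact (hcont.tendsto (p, q)).comp (hf.prodMk_nhds hg)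
  exact le_of_tendsto_of_tendsto' (hc h1 h2) ((hc h1 h1).const_mul ω) fun n => h (v n)

theorem IsResolvent.apply_core (hR : IsResolvent A lam R) (hA : IsClosureOf A j a) (v : Y) :
    R (lam • j v - a v) = j v := by
  obtain ⟨h, e⟩ := hA.apply_eq v
  have := hR.left ⟨j v, h⟩
  rwa [e] at this

/-- The image of the core under `lam - A` is dense. -/
theorem IsResolvent.approx (hR : IsResolvent A lam R) (hA : IsClosureOf A j a) (y : H) :
    ∃ v : ℕ → Y, Tendsto (fun n => lam • j (v n) - a (v n)) atTop (𝓝 y) := by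
  obtain ⟨h, e⟩ := hR.right y
  obtain ⟨v, h1, h2⟩ := hA.approx ⟨R y, h⟩
  refine ⟨v, ?_⟩
  rw [← e]
  exact (h1.const_smul lam).sub h2

/-- The resolvent on the next level of the scale. -/
theorem IsResolvent.commutator (hR : IsResolvent A lam R) {q k : Y →L[ℝ] H} {ι : Y →L[ℝ] H}
    (hA : IsClosureOf A ι a) (hq : q.IsInvertible)
    (hcomm : ∀ v w : Y, ι w = q v →
      ∃ (hv : ι v ∈ A.domain) (hw : ι w ∈ A.domain) (z : Y),
        ι z = A ⟨ι v, hv⟩ ∧ k v = q z - A ⟨ι w, hw⟩) (y : H) :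
    R (ι (q.inverse (y - k (q.inverse (R y))))) = ι (q.inverse (R y)) := by
  obtain ⟨w, hw⟩ := hR.approx hA y
  have hc1 : Continuous fun y => R (ι (q.inverse (y - k (q.inverse (R y))))) := by fun_prop
  have hc2 : Continuous fun y => ι (q.inverse (R y)) := by fun_prop
  -- Both sides are continuous in `y`, so it suffices to take `y = (lam - A) w` with `w` in the
  -- core.
  refine tendsto_nhds_unique ((hc1.tendsto y).comp hw) (((hc2.tendsto y).comp hw).congr fun n => ?_)
  simp only [Function.comp_apply]
  rw [hR.apply_core hA]
  -- For `v = Q⁻¹ w` the commutator relation reads `Q ((lam - A) v) = y - K v`, with `A v` again in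
  -- `Y`; applying `R` to `(lam - A) v` returns `v`.
  set v := q.inverse (ι (w n)) with hv
  have hqv : ι (w n) = q v := (hq.self_apply_inverse _).symm
  obtain ⟨hvd, hwd, z, hz, hk⟩ := hcomm v (w n) hqv
  obtain ⟨h1, e1⟩ := hA.apply_eq (w n)
  rw [e1] at hk
  have e2 : q.inverse (lam • ι (w n) - a (w n) - k v) = lam • v - z := by
    rw [hk, hqv]
    have : lam • q v - a (w n) - (q z - a (w n)) = q (lam • v - z) := by
      rw [map_sub, map_smul]; abel
    rw [this, hq.inverse_apply_self]
  rw [e2, map_sub, map_smul, hz]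
  exact (hR.left ⟨ι v, hvd⟩).symm

end Core

/-- Dissipativity for differences of Yosida regularizations. -/
theorem IsResolvent.dissipative_sub {mu : ℝ} {R' : H →L[ℝ] H} (hR : IsResolvent A lam R)
    (hR' : IsResolvent A mu R') (hA : IsDissipative b A ω) (x x' : H) :
    b (R x - R' x') ((lam • R x - x) - (mu • R' x' - x')) ≤
      ω * b (R x - R' x') (R x - R' x') := by
  obtain ⟨h, e⟩ := hR.right x
  obtain ⟨h', e'⟩ := hR'.right x'
  have e1 : lam • R x - x = A ⟨R x, h⟩ := by
    rw [sub_eq_iff_eq_add] at e ⊢; rw [e]; abel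
  have e2 : mu • R' x' - x' = A ⟨R' x', h'⟩ := by
    rw [sub_eq_iff_eq_add] at e' ⊢; rw [e']; abel
  rw [e1, e2, ← LinearPMap.map_sub]
  exact hA (⟨R x, h⟩ - ⟨R' x', h'⟩)

end Resolvent

end EvolutionScale

/-! ### Energy estimate in norms of finite variation in time -/

namespace EvolutionScale

noncomputable section EnergyEstimate

open Set MeasureTheory Filter Topology

set_option linter.unusedSectionVars false

variable {H : Type*} [NormedAddCommGroup H] [NormedSpace ℝ H]

set_option maxHeartbeats 1000000 in
/-- Energy estimate for a differentiable path in energy norms whose variation in time is controlled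
by `ρ`. -/
theorem energy_estimate [CompleteSpace H] {b : ℝ → H →L[ℝ] StrongDual ℝ H} {C ω ε ρ₀ s t : ℝ}
    {ρ : ℝ → ℝ} {d g : ℝ → H} (hst : s ≤ t) (hb : ∀ r ∈ Icc s t, IsEnergyForm (b r) C)
    (hρs : 1 ≤ ρ s) (hρ₀ : 0 < ρ₀) (hρ : ∀ r ∈ Icc s t, ρ₀ ≤ ρ r)
    (hρb : ∀ p q, s ≤ p → p ≤ q → q ≤ t → ∀ v,
      energyNorm (b q) v * ρ p ≤ ρ q * energyNorm (b p) v)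
    (hd : ContinuousOn d (Icc s t)) (hg : ContinuousOn g (Icc s t))
    (hdg : ∀ p q, s ≤ p → p ≤ q → q ≤ t → d q - d p = ∫ r in p..q, g r)
    (hε : 0 ≤ ε) (h : ∀ r ∈ Icc s t, b r (d r) (g r) ≤ ω * b r (d r) (d r) + ε) :
    b t (d t) (d t) ≤ ρ t ^ 2 * Real.exp (2 * ω * (t - s)) *
      (b s (d s) (d s) + 2 * ε * (ρ₀⁻¹ ^ 2 * Real.exp (2 * |ω| * (t - s))) * (t - s)) := by
  obtain ⟨D, hD⟩ := isCompact_Icc.exists_bound_of_continuousOn hd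
  obtain ⟨G, hG⟩ := isCompact_Icc.exists_bound_of_continuousOn hg
  have hD0 : 0 ≤ D := (norm_nonneg _).trans (hD s ⟨le_rfl, hst⟩)
  have hG0 : 0 ≤ G := (norm_nonneg _).trans (hG s ⟨le_rfl, hst⟩)
  -- `K` bounds the reciprocal of the weight `σ` below, also when its exponential and `ρ` are taken
  -- at different times.
  set K := ρ₀⁻¹ ^ 2 * Real.exp (2 * |ω| * (t - s)) with hK
  have hK0 : 0 < K := by positivity
  set σ : ℝ → ℝ := fun r => ρ r ^ 2 * Real.exp (2 * ω * (r - s)) with hσ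
  have hρpos : ∀ r ∈ Icc s t, 0 < ρ r := fun r hr => hρ₀.trans_le (hρ r hr)
  have hσpos : ∀ r ∈ Icc s t, 0 < σ r := fun r hr => by
    have := hρpos r hr
    simp only [hσ]
    positivity
  have hgi : IntervalIntegrable g volume s t := by
    apply ContinuousOn.intervalIntegrable
    rwa [uIcc_of_le hst]
  -- The squared energy divided by `σ`, less the accumulated error, does not grow. Increments
  -- replace derivatives since the forms may jump in time.
  have key := le_of_small_increments (a := s) (b := t) (m := fun r => r)
    (f := fun r => b r (d r) (d r) / σ r - 2 * ε * K * (r - s)) hst ?_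
  · have hs0 : σ s = ρ s ^ 2 := by simp [hσ]
    have h1 : b s (d s) (d s) / σ s ≤ b s (d s) (d s) := by
      rw [hs0]
      exact div_le_self ((hb s ⟨le_rfl, hst⟩).nonneg _) (one_le_pow₀ hρs)
    have h2 : b t (d t) (d t) / σ t ≤ b s (d s) (d s) + 2 * ε * K * (t - s) := by
      simp only [sub_self, mul_zero, sub_zero] at key
      linarith
    rw [div_le_iff₀ (hσpos t ⟨hst, le_rfl⟩), mul_comm] at h2
    exact h2
  intro η hη
  -- `η₁` absorbs the deviation of `g` from its value at `p`, and `δ₁` the term quadratic in the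
  -- step; each takes half of `η`.
  set η₁ := η / (2 * (2 * K * C ^ 2 * D + 1)) with hη₁
  set δ₁ := η / (2 * (K * C ^ 2 * G ^ 2 + 1)) with hδ₁
  have hη₁0 : 0 < η₁ := by positivity
  have hδ₁0 : 0 < δ₁ := by positivity
  have hη₁' : K * (2 * C ^ 2 * D * η₁) ≤ η / 2 := by
    have e : η / 2 = (2 * K * C ^ 2 * D + 1) * η₁ := by
      rw [hη₁]; field_simp
    rw [e]; nlinarith
  have hδ₁' : K * (C ^ 2 * G ^ 2 * δ₁) ≤ η / 2 := by
    have e : η / 2 = (K * C ^ 2 * G ^ 2 + 1) * δ₁ := by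
      rw [hδ₁]; field_simp
    rw [e]; nlinarith
  obtain ⟨δ, hδ, Hδ⟩ := exists_modulus hg hη₁0
  refine ⟨min δ δ₁, lt_min hδ hδ₁0, fun p q hp hpq hq hlt => ?_⟩
  have hpI : p ∈ Icc s t := ⟨hp, hpq.trans hq⟩
  have hqI : q ∈ Icc s t := ⟨hp.trans hpq, hq⟩
  set z := q - p with hz
  have hz0 : 0 ≤ z := sub_nonneg.2 hpq
  have hzδ : z < δ := hlt.trans_le (min_le_left _ _)
  have hzδ₁ : z ≤ δ₁ := (hlt.trans_le (min_le_right _ _)).le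
  have hbp := hb p hpI
  set Δ := ∫ r in p..q, g r with hΔ
  have hdq : d q = d p + Δ := by rw [hΔ, ← hdg p q hp hpq hq]; abel
  have hgpq := intervalIntegrable_mono hgi hp hpq hq
  have hΔG : ‖Δ‖ ≤ z * G := by
    have := intervalIntegral.norm_integral_le_of_norm_le_const (f := g) (a := p) (b := q) (C := G)
      fun r hr => by
        rw [uIoc_of_le hpq] at hr
        exact hG r ⟨hp.trans hr.1.le, hr.2.trans hq⟩
    rwa [abs_of_nonneg hz0, mul_comm] at this
  have hΔg : ‖Δ - z • g p‖ ≤ z * η₁ := by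
    have e : Δ - z • g p = ∫ r in p..q, (g r - g p) := by
      rw [intervalIntegral.integral_sub hgpq (intervalIntegrable_const), intervalIntegral.integral_const]
    have := intervalIntegral.norm_integral_le_of_norm_le_const (f := fun r => g r - g p)
      (a := p) (b := q) (C := η₁) fun r hr => by
        rw [uIoc_of_le hpq] at hr
        refine Hδ r ⟨hp.trans hr.1.le, hr.2.trans hq⟩ p hpI ?_
        rw [abs_of_nonneg (by linarith [hr.1])]
        linarith [hr.2]
    rw [e]
    rwa [abs_of_nonneg hz0, mul_comm] at this
  have b1 : b p (d p) Δ ≤ z * (ω * b p (d p) (d p) + ε) + C ^ 2 * D * (z * η₁) := by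
    have e : b p (d p) Δ = z * b p (d p) (g p) + b p (d p) (Δ - z • g p) := by
      rw [map_sub, map_smul, smul_eq_mul]; ring
    rw [e]
    refine add_le_add (mul_le_mul_of_nonneg_left (h p hpI) hz0)
      ((hbp.apply_le_norm _ _).trans ?_)
    exact mul_le_mul (mul_le_mul_of_nonneg_left (hD p hpI) (sq_nonneg C)) hΔg (norm_nonneg _)
      (by positivity)
  have b2 : b p Δ Δ ≤ C ^ 2 * (z * G) * (z * G) :=
    (hbp.apply_le_norm _ _).trans (mul_le_mul (mul_le_mul_of_nonneg_left hΔG (sq_nonneg C)) hΔG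
      (norm_nonneg _) (by positivity))
  have e3 : b p (d q) (d q) = b p (d p) (d p) + 2 * b p (d p) Δ + b p Δ Δ := by
    rw [hdq]
    simp only [map_add, add_apply]
    rw [hbp.symm Δ (d p)]; ring
  have hNp := hbp.nonneg (d p)
  have hexp : 1 + 2 * ω * z ≤ Real.exp (2 * ω * z) := by
    linarith [Real.add_one_le_exp (2 * ω * z)]
  have b3 : b p (d q) (d q) ≤ Real.exp (2 * ω * z) * b p (d p) (d p) +
      z * (2 * ε + 2 * C ^ 2 * D * η₁ + C ^ 2 * G ^ 2 * δ₁) := by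
    have h1 := mul_le_mul_of_nonneg_right hexp hNp
    have h2 : C ^ 2 * (z * G) * (z * G) ≤ z * (C ^ 2 * G ^ 2 * δ₁) := by
      have : z * (C ^ 2 * G ^ 2 * z) ≤ z * (C ^ 2 * G ^ 2 * δ₁) := by gcongr
      linarith
    rw [e3]
    linarith
  -- Exchanging the form at `p` for the form at `q` costs exactly the factor by which `ρ ^ 2`
  -- changes, so this exchange contributes no error.
  have b4 : b q (d q) (d q) * ρ p ^ 2 ≤ ρ q ^ 2 * b p (d q) (d q) := by
    rw [← (hb q hqI).sq_energyNorm, ← hbp.sq_energyNorm, ← mul_pow, ← mul_pow]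
    exact pow_le_pow_left₀ (mul_nonneg (IsEnergyForm.energyNorm_nonneg _) (hρpos p hpI).le)
      (hρb p q hp hpq hq _) 2
  have hE : Real.exp (2 * ω * (q - s)) = Real.exp (2 * ω * (p - s)) * Real.exp (2 * ω * z) := by
    rw [← Real.exp_add]; congr 1; rw [hz]; ring
  have hρp := hρpos p hpI
  have hρq := hρpos q hqI
  have b5 : b q (d q) (d q) / σ q ≤
      b p (d q) (d q) / (ρ p ^ 2 * Real.exp (2 * ω * (q - s))) := by
    rw [div_le_div_iff₀ (hσpos q hqI) (by positivity)]
    have := mul_le_mul_of_nonneg_right b4 (Real.exp_pos (2 * ω * (q - s))).le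
    simp only [hσ]
    linarith
  have hK1 : (ρ p ^ 2 * Real.exp (2 * ω * (q - s)))⁻¹ ≤ K := by
    rw [mul_inv, ← inv_pow, ← Real.exp_neg, hK]
    have h1 : (ρ p)⁻¹ ≤ ρ₀⁻¹ := inv_anti₀ hρ₀ (hρ p hpI)
    have h2 : -(2 * ω * (q - s)) ≤ 2 * |ω| * (t - s) := by
      have h3 : 0 ≤ q - s := sub_nonneg.2 hqI.1
      have h4 : q - s ≤ t - s := by linarith [hqI.2]
      have h5 := neg_abs_le ω
      nlinarith [mul_le_mul_of_nonneg_left h4 (abs_nonneg ω), mul_nonneg (by linarith : 0 ≤ ω + |ω|) h3]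
    exact mul_le_mul (pow_le_pow_left₀ (inv_nonneg.2 hρp.le) h1 2) (Real.exp_le_exp.2 h2)
      (Real.exp_pos _).le (by positivity)
  have b6 : b p (d q) (d q) / (ρ p ^ 2 * Real.exp (2 * ω * (q - s))) ≤
      b p (d p) (d p) / σ p + K * (z * (2 * ε + 2 * C ^ 2 * D * η₁ + C ^ 2 * G ^ 2 * δ₁)) := by
    rw [div_eq_mul_inv]
    have hpos : 0 ≤ (ρ p ^ 2 * Real.exp (2 * ω * (q - s)))⁻¹ := by positivity
    refine (mul_le_mul_of_nonneg_right b3 hpos).trans ?_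
    rw [add_mul]
    refine add_le_add (le_of_eq ?_) ?_
    · rw [hE]
      simp only [hσ]
      field_simp
    · rw [mul_comm]
      exact mul_le_mul_of_nonneg_right hK1 (by positivity)
  have b7 : K * (z * (2 * ε + 2 * C ^ 2 * D * η₁ + C ^ 2 * G ^ 2 * δ₁)) ≤
      2 * ε * K * z + η * z := by
    have : K * (z * (2 * ε + 2 * C ^ 2 * D * η₁ + C ^ 2 * G ^ 2 * δ₁)) =
      2 * ε * K * z + z * (K * (2 * C ^ 2 * D * η₁) + K * (C ^ 2 * G ^ 2 * δ₁)) := by ring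
    rw [this]
    have := mul_le_mul_of_nonneg_left (add_le_add hη₁' hδ₁') hz0
    linarith
  change b q (d q) (d q) / σ q - 2 * ε * K * (q - s) -
    (b p (d p) (d p) / σ p - 2 * ε * K * (p - s)) ≤ η * z
  have e8 : 2 * ε * K * (q - s) = 2 * ε * K * (p - s) + 2 * ε * K * z := by rw [hz]; ring
  rw [e8]
  linarith

/-! ### Properties of the variation `l(s, t)` -/

section Variation

variable {L : ℝ → H →L[ℝ] StrongDual ℝ H} {s r t : ℝ}

theorem variationProducts_refl (t : ℝ) : 1 ∈ variationProducts L t t :=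
  ⟨0, fun _ => t, Fin.elim0, monotone_const, rfl, rfl, fun j => j.elim0, by simp⟩

theorem variationProducts_append {p : ℝ} (hp : p ∈ variationProducts L s r) (hrt : r ≤ t) {v : H}
    (hv : v ≠ 0) :
    p * (energyNorm (L t) v / energyNorm (L r) v) ∈ variationProducts L s t := by
  obtain ⟨k, σ, w, hσ, h0, hl, hw, rfl⟩ := hp
  refine ⟨k + 1, Fin.snoc (α := fun _ => ℝ) σ t, Fin.snoc (α := fun _ => H) w v, ?_, ?_, ?_, ?_, ?_⟩
  · rw [Fin.monotone_iff_le_succ]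
    intro i
    rcases Fin.eq_castSucc_or_eq_last i with ⟨j, rfl⟩ | rfl
    · rw [Fin.snoc_castSucc, ← Fin.castSucc_succ, Fin.snoc_castSucc]
      exact hσ (Fin.castSucc_lt_succ).le
    · rw [Fin.snoc_castSucc, Fin.succ_last, Fin.snoc_last, hl]
      exact hrt
  · rw [← Fin.castSucc_zero, Fin.snoc_castSucc, h0]
  · rw [Fin.snoc_last]
  · intro j
    rcases Fin.eq_castSucc_or_eq_last j with ⟨i, rfl⟩ | rfl
    · rw [Fin.snoc_castSucc]; exact hw i
    · rw [Fin.snoc_last]; exact hv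
  · rw [Fin.prod_univ_castSucc]
    simp only [Fin.snoc_castSucc, Fin.snoc_last, Fin.succ_last, ← Fin.castSucc_succ, hl]

/-- Chains are concatenated by induction on the length of the second one, whose last ratio is peeled
off and appended. -/
theorem variationProducts_mul {p p' : ℝ} (hp : p ∈ variationProducts L s r)
    (hp' : p' ∈ variationProducts L r t) : p * p' ∈ variationProducts L s t := by
  obtain ⟨k, σ, w, hσ, h0, hl, hw, rfl⟩ := hp'
  induction k generalizing t with
  | zero =>
    have : r = t := by rw [← h0, ← hl]; rfl
    subst this
    simpa using hp
  | succ k ih =>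
    have h1 := ih (t := σ (Fin.last k).castSucc) (σ ∘ Fin.castSucc) (w ∘ Fin.castSucc)
      (hσ.comp Fin.strictMono_castSucc.monotone) h0 rfl (fun j => hw _)
    have h2 := variationProducts_append h1 (t := t) (v := w (Fin.last k))
      (by rw [← hl]; exact hσ (Fin.le_last _)) (hw _)
    have e : σ (Fin.last k).succ = t := by rw [Fin.succ_last, hl]
    rw [Fin.prod_univ_castSucc, ← mul_assoc, e]
    exact h2

variable {a b C : ℝ}

theorem AssumptionL1.isEnergyForm (h : AssumptionL1 a b L C) (hC : 1 ≤ C) (ht : t ∈ Icc a b) :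
    IsEnergyForm (L t) C :=
  ⟨hC, h.symm t ht, h.lower t ht, h.upper t ht⟩

theorem variation_nonneg (L : ℝ → H →L[ℝ] StrongDual ℝ H) (s t : ℝ) : 0 ≤ variation L s t := by
  refine Real.sSup_nonneg ?_
  rintro p ⟨k, σ, w, -, -, -, -, rfl⟩
  exact Finset.prod_nonneg fun j _ => div_nonneg (Real.sqrt_nonneg _) (Real.sqrt_nonneg _)

theorem AssumptionL1.bddAbove (h : AssumptionL1 a b L C) (hs : a ≤ s) (hst : s ≤ t) (ht : t ≤ b) :
    BddAbove (variationProducts L s t) := by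
  obtain ⟨M, hM⟩ := h.finite_variation
  exact ⟨M, fun p hp => hM s t hs hst ht p hp⟩

theorem AssumptionL1.exists_variation_le (h : AssumptionL1 a b L C) :
    ∃ M, ∀ s t, a ≤ s → s ≤ t → t ≤ b → variation L s t ≤ M := by
  obtain ⟨M, hM⟩ := h.finite_variation
  exact ⟨max M 0, fun s t hs hst ht => Real.sSup_le
    (fun p hp => (hM s t hs hst ht p hp).trans (le_max_left _ _)) (le_max_right _ _)⟩

theorem AssumptionL1.one_le_variation (h : AssumptionL1 a b L C) (hs : s ∈ Icc a b) :
    1 ≤ variation L s s :=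
  le_csSup (h.bddAbove hs.1 le_rfl hs.2) (variationProducts_refl s)

theorem AssumptionL1.ratio_le_variation (h : AssumptionL1 a b L C) (hs : a ≤ s) (hst : s ≤ t)
    (ht : t ≤ b) {v : H} (hv : v ≠ 0) :
    energyNorm (L t) v / energyNorm (L s) v ≤ variation L s t := by
  have := variationProducts_append (variationProducts_refl (L := L) s) hst hv
  rw [one_mul] at this
  exact le_csSup (h.bddAbove hs hst ht) this

/-- A nonzero vector is needed: in a trivial space no chain has positive length, so for `s < t`
there are no products and the supremum is 0. -/
theorem AssumptionL1.variation_lower [Nontrivial H] (h : AssumptionL1 a b L C) (hC : 1 ≤ C)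
    (hs : a ≤ s) (hst : s ≤ t) (ht : t ≤ b) : C⁻¹ ^ 2 ≤ variation L s t := by
  obtain ⟨v, hv⟩ := exists_ne (0 : H)
  have hC0 : 0 < C := zero_lt_one.trans_le hC
  have hv0 : 0 < ‖v‖ := norm_pos_iff.2 hv
  have h1 := h.lower t ⟨hs.trans hst, ht⟩ v
  have h2 := h.upper s ⟨hs, hst.trans ht⟩ v
  have h3 : 0 < energyNorm (L s) v :=
    lt_of_lt_of_le (by positivity) (h.lower s ⟨hs, hst.trans ht⟩ v)
  refine le_trans ?_ (h.ratio_le_variation hs hst ht hv)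
  rw [le_div_iff₀ h3]
  calc C⁻¹ ^ 2 * energyNorm (L s) v ≤ C⁻¹ ^ 2 * (C * ‖v‖) := by gcongr
    _ = C⁻¹ * ‖v‖ := by field_simp
    _ ≤ _ := h1

theorem AssumptionL1.variation_mul_le (h : AssumptionL1 a b L C) (hs : a ≤ s) (hsr : s ≤ r)
    (hrt : r ≤ t) (ht : t ≤ b) : variation L s r * variation L r t ≤ variation L s t := by
  have hnn : ∀ {u v : ℝ} {p}, p ∈ variationProducts L u v → 0 ≤ p := by
    rintro u v p ⟨k, σ, w, -, -, -, -, rfl⟩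
    exact Finset.prod_nonneg fun j _ => div_nonneg (Real.sqrt_nonneg _) (Real.sqrt_nonneg _)
  have hbd := h.bddAbove hs (hsr.trans hrt) ht
  have h1 : ∀ p ∈ variationProducts L s r, p * variation L r t ≤ variation L s t := by
    intro p hp
    rw [variation, ← smul_eq_mul, ← Real.sSup_smul_of_nonneg (hnn hp)]
    refine Real.sSup_le ?_ (variation_nonneg L s t)
    rintro _ ⟨p', hp', rfl⟩
    exact le_csSup hbd (variationProducts_mul hp hp')
  rw [mul_comm]
  nth_rw 2 [variation]
  rw [← smul_eq_mul, ← Real.sSup_smul_of_nonneg (variation_nonneg L r t)]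
  refine Real.sSup_le ?_ (variation_nonneg L s t)
  rintro _ ⟨p, hp, rfl⟩
  change variation L r t * p ≤ _
  rw [mul_comm]
  exact h1 p hp

/-- The quotient of `energyNorm (L t) v` by `variation L s t` does not increase in `t`; this is the
only information on the time dependence of `L` that the energy estimate uses. -/
theorem AssumptionL1.energyNorm_mul_le (h : AssumptionL1 a b L C) (hC : 1 ≤ C) (hs : a ≤ s)
    (hsr : s ≤ r) (hrt : r ≤ t) (ht : t ≤ b) (v : H) :
    energyNorm (L t) v * variation L s r ≤ variation L s t * energyNorm (L r) v := by
  by_cases hv : v = 0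
  · simp [hv, energyNorm]
  have hr : r ∈ Icc a b := ⟨hs.trans hsr, hrt.trans ht⟩
  have h3 : 0 < energyNorm (L r) v :=
    lt_of_lt_of_le (mul_pos (inv_pos.2 (zero_lt_one.trans_le hC)) (norm_pos_iff.2 hv))
      (h.lower r hr v)
  have h1 := mul_le_mul_of_nonneg_left (h.ratio_le_variation hr.1 hrt ht hv)
    (variation_nonneg L s r)
  have h2 := h1.trans (h.variation_mul_le hs hsr hrt ht)
  rw [← mul_div_assoc, div_le_iff₀ h3, mul_comm] at h2
  exact h2

end Variation

end EnergyEstimate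

end EvolutionScale

/-! ### Yosida approximations and their conjugates under `Q` -/

namespace EvolutionScale

noncomputable section Yosida

open Set MeasureTheory Filter Topology

set_option linter.unusedSectionVars false

open Classical in
/-- The resolvent of `A` at `lam`, if it exists. -/
def resolvent {H : Type*} [NormedAddCommGroup H] [NormedSpace ℝ H] (A : H →ₗ.[ℝ] H) (lam : ℝ) :
    H →L[ℝ] H :=
  if h : ∃ R, IsResolvent A lam R then h.choose else 0

/-- A family of dissipative operators `A t` on `H` that are closures of operators `gen t` with
domain `Y`, together with isomorphisms `Q t` of `Y` with `H` whose commutators `K t` with `A t` are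
bounded from `Y` to `H`. The norms and operators are defined for all times; the isomorphisms `Q t`
are absolutely continuous on `[a, b]`. -/
structure HyperbolicSystem (H Y : Type*) [NormedAddCommGroup H] [NormedSpace ℝ H]
    [NormedAddCommGroup Y] [NormedSpace ℝ Y] where
  (a b C ρ₀ Cρ ω CQ CK Cg : ℝ)
  j : Y →L[ℝ] H
  form : ℝ → H →L[ℝ] StrongDual ℝ H
  ρ : ℝ → ℝ → ℝ
  A : ℝ → H →ₗ.[ℝ] H
  (gen Q Q' K : ℝ → Y →L[ℝ] H)
  hab : a ≤ b
  dense : DenseRange j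
  energy : ∀ t, IsEnergyForm (form t) C
  ρ_refl : ∀ s ∈ Icc a b, 1 ≤ ρ s s
  ρ₀_pos : 0 < ρ₀
  ρ_lower : ∀ s t, a ≤ s → s ≤ t → t ≤ b → ρ₀ ≤ ρ s t
  ρ_upper : ∀ s t, a ≤ s → s ≤ t → t ≤ b → ρ s t ≤ Cρ
  ρ_mul : ∀ s r t, a ≤ s → s ≤ r → r ≤ t → t ≤ b → ρ s r * ρ r t ≤ ρ s t
  ρ_energy : ∀ s r t, a ≤ s → s ≤ r → r ≤ t → t ≤ b → ∀ v,
    energyNorm (form t) v * ρ s r ≤ ρ s t * energyNorm (form r) v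
  gen_cont : Continuous gen
  gen_le : ∀ t, ‖gen t‖ ≤ Cg
  isClosureOf : ∀ t, IsClosureOf (A t) j (gen t)
  isDissipative : ∀ t, IsDissipative (form t) (A t) ω
  exists_resolvent : ∀ t lam, ω < lam → ∃ R, IsResolvent (A t) lam R
  Q_inv : ∀ t, (Q t).IsInvertible
  Q_le : ∀ t, ‖Q t‖ ≤ CQ
  Q_inv_le : ∀ t, ‖(Q t).inverse‖ ≤ CQ
  Q_cont : Continuous Q
  Q'_int : Integrable Q'
  Q_deriv : ∀ s t, a ≤ s → s ≤ t → t ≤ b → Q t - Q s = ∫ r in s..t, Q' r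
  comm : ∀ t, ∀ v w : Y, j w = Q t v → ∃ (hv : j v ∈ (A t).domain) (hw : j w ∈ (A t).domain)
    (z : Y), j z = A t ⟨j v, hv⟩ ∧ K t v = Q t z - A t ⟨j w, hw⟩
  K_cont : Continuous K
  K_le : ∀ t, ‖K t‖ ≤ CK

/-- Strong continuity of the inverses of a strongly continuous family. -/
theorem continuous_of_left_inverse {E : Type*} [NormedAddCommGroup E] [NormedSpace ℝ E]
    {T S : ℝ → E →L[ℝ] E} {M : ℝ} (hS : ∀ t, ‖S t‖ ≤ M) (hT : ∀ x, Continuous fun t => T t x)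
    (h1 : ∀ t x, S t (T t x) = x) (h2 : ∀ t x, T t (S t x) = x) (x : E) :
    Continuous fun t => S t x := by
  rw [continuous_iff_continuousAt]
  intro s
  have hlim : Tendsto (fun t => M * ‖T s (S s x) - T t (S s x)‖) (𝓝 s) (𝓝 0) := by
    have hc : Continuous fun t => M * ‖T s (S s x) - T t (S s x)‖ :=
      continuous_const.mul (continuous_const.sub (hT _)).norm
    simpa using hc.tendsto s
  rw [ContinuousAt, tendsto_iff_norm_sub_tendsto_zero]
  refine squeeze_zero (fun t => norm_nonneg _) (fun t => ?_) hlim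
  have e : S t x - S s x = S t (T s (S s x) - T t (S s x)) := by
    rw [map_sub, h1, h2]
  rw [e]
  exact (S t).le_of_opNorm_le (hS t) _

/-- Norm continuity of the inverses of a norm continuous family. -/
theorem continuous_inverse {E G : Type*} [NormedAddCommGroup E] [NormedSpace ℝ E]
    [NormedAddCommGroup G] [NormedSpace ℝ G] {Q : ℝ → G →L[ℝ] E} {M : ℝ} (hQ : Continuous Q)
    (hinv : ∀ t, (Q t).IsInvertible) (hM : ∀ t, ‖(Q t).inverse‖ ≤ M) :
    Continuous fun t => (Q t).inverse := by
  have hM0 : 0 ≤ M := (norm_nonneg _).trans (hM 0)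
  rw [continuous_iff_continuousAt]
  intro s
  rw [ContinuousAt, tendsto_iff_norm_sub_tendsto_zero]
  have hlim : Tendsto (fun t => M * ‖Q s - Q t‖ * M) (𝓝 s) (𝓝 0) := by
    have hc : Continuous fun t => M * ‖Q s - Q t‖ * M :=
      (continuous_const.mul (continuous_const.sub hQ).norm).mul continuous_const
    simpa using hc.tendsto s
  refine squeeze_zero (fun t => norm_nonneg _) (fun t => ?_) hlim
  have e : (Q t).inverse - (Q s).inverse =
      ((Q t).inverse.comp (Q s - Q t)).comp (Q s).inverse := by
    ext x
    simp only [ContinuousLinearMap.comp_apply, sub_apply, map_sub, (hinv t).inverse_apply_self,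
      (hinv s).self_apply_inverse]
  rw [e]
  refine (ContinuousLinearMap.opNorm_comp_le _ _).trans (mul_le_mul
    ((ContinuousLinearMap.opNorm_comp_le _ _).trans ?_) (hM s) (norm_nonneg _)
    (mul_nonneg hM0 (norm_nonneg _)))
  exact mul_le_mul_of_nonneg_right (hM t) (norm_nonneg _)

namespace HyperbolicSystem

variable {H Y : Type*} [NormedAddCommGroup H] [NormedSpace ℝ H] [CompleteSpace H]
  [NormedAddCommGroup Y] [NormedSpace ℝ Y] [CompleteSpace Y] (D : HyperbolicSystem H Y)

/-- The resolvent of `A t`. -/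
def R (lam t : ℝ) : H →L[ℝ] H := resolvent (D.A t) lam

/-- The bounded perturbation `[Q, A] Q⁻¹`. -/
def B (t : ℝ) : H →L[ℝ] H := (D.K t).comp (D.Q t).inverse

/-- The inverse of `1 - B R`. -/
def corr (lam t : ℝ) : H →L[ℝ] H := Ring.inverse (1 - D.B t * D.R lam t)

/-- The Yosida approximation of `A t`. -/
def yosida (lam t : ℝ) : H →L[ℝ] H := lam • (lam • D.R lam t - 1)

/-- The resolvent of `A t + B t`. -/
def R₁ (lam t : ℝ) : H →L[ℝ] H := D.R lam t * D.corr lam t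

/-- The difference of the Yosida approximations of `A t + B t` and `A t`. -/
def yosidaB (lam t : ℝ) : H →L[ℝ] H := (lam • D.R₁ lam t) * D.B t * (lam • D.R lam t)

/-- The restriction of the Yosida approximation to `Y`. -/
def yosidaY (lam t : ℝ) : Y →L[ℝ] Y :=
  ((D.Q t).inverse.comp (lam • (lam • D.R₁ lam t - 1))).comp (D.Q t)

/-- Bound of `lam R`. -/
def m : ℝ := 2 * D.C ^ 2

/-- The range of parameters where the approximations are well behaved. -/
def Λ : ℝ := 1 + 2 * |D.ω| + 4 * (D.CK * D.CQ) * D.C ^ 2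

theorem C_pos : 0 < D.C := (D.energy 0).pos

theorem CQ_nonneg : 0 ≤ D.CQ := (norm_nonneg _).trans (D.Q_le 0)

theorem CK_nonneg : 0 ≤ D.CK := (norm_nonneg _).trans (D.K_le 0)

theorem m_pos : 0 < D.m := by have := D.C_pos; unfold m; positivity

variable {D} {lam : ℝ}

theorem one_le (hl : D.Λ ≤ lam) : 1 ≤ lam := by
  have h1 := mul_nonneg D.CK_nonneg D.CQ_nonneg
  have h2 := abs_nonneg D.ω
  have h3 := sq_nonneg D.C
  unfold Λ at hl
  nlinarith [mul_nonneg h1 h3]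

/-- The summand `2 * |D.ω|` of `Λ` serves this bound, which makes `lam * R` bounded by `m = 2 * C ^
2`. -/
theorem half_le (hl : D.Λ ≤ lam) : lam / 2 ≤ lam - D.ω := by
  have h1 := mul_nonneg D.CK_nonneg D.CQ_nonneg
  have h2 := le_abs_self D.ω
  have h3 := sq_nonneg D.C
  unfold Λ at hl
  nlinarith [mul_nonneg h1 h3]

theorem pos (hl : D.Λ ≤ lam) : 0 < lam := zero_lt_one.trans_le (one_le hl)

theorem lt (hl : D.Λ ≤ lam) : D.ω < lam := by
  have := half_le hl
  have := pos hl
  linarith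

theorem isResolvent (hl : D.Λ ≤ lam) (t : ℝ) : IsResolvent (D.A t) lam (D.R lam t) := by
  have h := D.exists_resolvent t lam (lt hl)
  rw [R, resolvent, dif_pos h]
  exact h.choose_spec

theorem R_le (hl : D.Λ ≤ lam) (t : ℝ) : ‖D.R lam t‖ ≤ D.m / lam := by
  refine ((isResolvent hl t).norm_le (D.isDissipative t) (D.energy t) (lt hl)).trans ?_
  have h1 := half_le hl
  have h2 := pos hl
  have h3 : (lam - D.ω)⁻¹ ≤ (lam / 2)⁻¹ := inv_anti₀ (by positivity) h1
  refine (mul_le_mul_of_nonneg_left h3 (sq_nonneg _)).trans (le_of_eq ?_)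
  rw [m]
  field_simp

theorem smul_R_le (hl : D.Λ ≤ lam) (t : ℝ) : ‖lam • D.R lam t‖ ≤ D.m := by
  have h2 := pos hl
  rw [norm_smul, Real.norm_of_nonneg h2.le, mul_comm, ← le_div_iff₀ h2]
  exact R_le hl t

variable (D) in
theorem B_le (t : ℝ) : ‖D.B t‖ ≤ D.CK * D.CQ :=
  (ContinuousLinearMap.opNorm_comp_le _ _).trans
    (mul_le_mul (D.K_le t) (D.Q_inv_le t) (norm_nonneg _) D.CK_nonneg)

/-- The last summand of `Λ` is chosen for the value `1 / 2`: then `1 - B R` is invertible by a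
Neumann series with inverse of norm at most 2, uniformly in `lam`. -/
theorem BR_le (hl : D.Λ ≤ lam) (t : ℝ) : ‖D.B t * D.R lam t‖ ≤ 1 / 2 := by
  have h2 := pos hl
  have h1 := mul_nonneg D.CK_nonneg D.CQ_nonneg
  refine (norm_mul_le _ _).trans ((mul_le_mul (D.B_le t) (R_le hl t) (norm_nonneg _) h1).trans ?_)
  rw [← mul_div_assoc, div_le_iff₀ h2, m]
  have h3 := abs_nonneg D.ω
  unfold Λ at hl
  linarith

theorem isUnit_one_sub (hl : D.Λ ≤ lam) (t : ℝ) : IsUnit (1 - D.B t * D.R lam t) :=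
  isUnit_one_sub_of_norm_lt_one ((BR_le hl t).trans_lt (by norm_num))

theorem corr_right (hl : D.Λ ≤ lam) (t : ℝ) (x : H) :
    D.corr lam t x - D.B t (D.R lam t (D.corr lam t x)) = x := by
  have := Ring.mul_inverse_cancel _ (isUnit_one_sub hl t)
  exact congrArg (fun T : H →L[ℝ] H => T x) this

theorem corr_left (hl : D.Λ ≤ lam) (t : ℝ) (x : H) :
    D.corr lam t (x - D.B t (D.R lam t x)) = x := by
  have := Ring.inverse_mul_cancel _ (isUnit_one_sub hl t)
  exact congrArg (fun T : H →L[ℝ] H => T x) this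

theorem corr_le (hl : D.Λ ≤ lam) (t : ℝ) : ‖D.corr lam t‖ ≤ 2 := by
  refine ContinuousLinearMap.opNorm_le_bound _ (by norm_num) fun x => ?_
  have h1 := corr_right hl t x
  have h2 : ‖D.B t (D.R lam t (D.corr lam t x))‖ ≤ 1 / 2 * ‖D.corr lam t x‖ :=
    (D.B t * D.R lam t).le_of_opNorm_le (BR_le hl t) _
  have h3 : ‖D.corr lam t x‖ ≤ ‖x‖ + ‖D.B t (D.R lam t (D.corr lam t x))‖ := by
    nth_rw 1 [← sub_add_cancel (D.corr lam t x) (D.B t (D.R lam t (D.corr lam t x))), h1]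
    exact norm_add_le _ _
  linarith

theorem smul_R₁_le (hl : D.Λ ≤ lam) (t : ℝ) : ‖lam • D.R₁ lam t‖ ≤ D.m * 2 := by
  rw [R₁, ← smul_mul_assoc]
  exact (norm_mul_le _ _).trans
    (mul_le_mul (smul_R_le hl t) (corr_le hl t) (norm_nonneg _) D.m_pos.le)

theorem yosida_le (hl : D.Λ ≤ lam) (t : ℝ) : ‖D.yosida lam t‖ ≤ lam * (D.m + 1) := by
  have h2 := pos hl
  rw [yosida, norm_smul, Real.norm_of_nonneg h2.le]
  refine mul_le_mul_of_nonneg_left ((norm_sub_le _ _).trans (add_le_add (smul_R_le hl t) ?_)) h2.le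
  exact ContinuousLinearMap.norm_id_le

theorem yosidaB_le (hl : D.Λ ≤ lam) (t : ℝ) :
    ‖D.yosidaB lam t‖ ≤ D.m * 2 * (D.CK * D.CQ) * D.m := by
  have h1 := mul_nonneg D.CK_nonneg D.CQ_nonneg
  have h2 := D.m_pos.le
  refine (norm_mul_le _ _).trans (mul_le_mul ((norm_mul_le _ _).trans ?_) (smul_R_le hl t)
    (norm_nonneg _) (by positivity))
  exact mul_le_mul (smul_R₁_le hl t) (D.B_le t) (norm_nonneg _) (by positivity)

theorem yosidaY_le (hl : D.Λ ≤ lam) (t : ℝ) :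
    ‖D.yosidaY lam t‖ ≤ D.CQ * (lam * (D.m * 2 + 1)) * D.CQ := by
  have h2 := pos hl
  have h3 := D.CQ_nonneg
  have h4 := D.m_pos.le
  have h1 : ‖lam • (lam • D.R₁ lam t - 1)‖ ≤ lam * (D.m * 2 + 1) := by
    rw [norm_smul, Real.norm_of_nonneg h2.le]
    refine mul_le_mul_of_nonneg_left ((norm_sub_le _ _).trans
      (add_le_add (smul_R₁_le hl t) ?_)) h2.le
    exact ContinuousLinearMap.norm_id_le
  refine (ContinuousLinearMap.opNorm_comp_le _ _).trans (mul_le_mul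
    ((ContinuousLinearMap.opNorm_comp_le _ _).trans ?_) (D.Q_le t) (norm_nonneg _) (by positivity))
  exact mul_le_mul (D.Q_inv_le t) h1 (norm_nonneg _) h3

/-- The resolvent preserves `Y`, where it is conjugate to the resolvent of `A t + B t`. -/
theorem R_j_inverse (hl : D.Λ ≤ lam) (t : ℝ) (x : H) :
    D.R lam t (D.j ((D.Q t).inverse x)) = D.j ((D.Q t).inverse (D.R₁ lam t x)) := by
  have := (isResolvent hl t).commutator (D.isClosureOf t) (D.Q_inv t) (D.comm t) (D.corr lam t x)
  have h2 : D.corr lam t x - D.K t ((D.Q t).inverse (D.R lam t (D.corr lam t x))) = x :=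
    corr_right hl t x
  rw [h2] at this
  exact this

theorem yosida_j (hl : D.Λ ≤ lam) (t : ℝ) (v : Y) :
    D.yosida lam t (D.j v) = D.j (D.yosidaY lam t v) := by
  have h1 : D.R lam t (D.j v) = D.j ((D.Q t).inverse (D.R₁ lam t (D.Q t v))) := by
    rw [← R_j_inverse hl, (D.Q_inv t).inverse_apply_self]
  simp only [yosida, yosidaY, ContinuousLinearMap.comp_apply, smul_apply, sub_apply, map_smul,
    map_sub, one_apply_eq_self, h1, (D.Q_inv t).inverse_apply_self]

theorem R₁_sub_R (hl : D.Λ ≤ lam) (t : ℝ) (x : H) :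
    D.R₁ lam t x = D.R lam t x + D.R₁ lam t (D.B t (D.R lam t x)) := by
  have h : D.R₁ lam t (x - D.B t (D.R lam t x)) = D.R lam t x :=
    congrArg (D.R lam t) (corr_left hl t x)
  rw [map_sub] at h
  exact sub_eq_iff_eq_add.1 h

/-- The central identity. Conjugation with `Q` turns the Yosida approximation of `A` into that of `A
+ B`, and `R₁ = R + R₁ B R` shows that the two differ by `lam R₁ B lam R`, which is bounded
uniformly in `lam`. -/
theorem Q_yosidaY (hl : D.Λ ≤ lam) (t : ℝ) (v : Y) :
    D.Q t (D.yosidaY lam t v) = D.yosida lam t (D.Q t v) + D.yosidaB lam t (D.Q t v) := by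
  have h1 : D.yosidaB lam t (D.Q t v) =
      lam • lam • D.R₁ lam t (D.B t (D.R lam t (D.Q t v))) := by
    simp only [yosidaB, mul_apply_eq_comp, smul_apply, map_smul]
  have h2 : D.Q t (D.yosidaY lam t v) = lam • (lam • D.R₁ lam t (D.Q t v) - D.Q t v) := by
    simp only [yosidaY, ContinuousLinearMap.comp_apply, (D.Q_inv t).self_apply_inverse]
    rfl
  rw [h1, h2, R₁_sub_R hl]
  have h3 : D.yosida lam t (D.Q t v) = lam • (lam • D.R lam t (D.Q t v) - D.Q t v) := rfl
  rw [h3, smul_add, smul_sub, smul_sub, smul_add]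
  abel

/-- On `Y` the approximation is `lam R A`; hence it is bounded from `Y` to `H` uniformly in `lam`,
although its norm on `H` may grow like `lam`. -/
theorem yosida_apply_j (hl : D.Λ ≤ lam) (t : ℝ) (v : Y) :
    D.yosida lam t (D.j v) = lam • D.R lam t (D.gen t v) := by
  have h := (isResolvent hl t).apply_core (D.isClosureOf t) v
  rw [map_sub, map_smul, sub_eq_iff_eq_add] at h
  have h3 : D.yosida lam t (D.j v) = lam • (lam • D.R lam t (D.j v) - D.j v) := rfl
  rw [h3, h, add_sub_cancel_left]

/-- For `y = (lam - A s) v` with `v` in `Y` one has `R t y - R s y = R t (A t - A s) v`, which is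
small by continuity of the generator. Such `y` are dense and the resolvents are bounded uniformly in
time. -/
theorem R_strongly_continuous (hl : D.Λ ≤ lam) (x : H) : Continuous fun t => D.R lam t x := by
  rw [continuous_iff_continuousAt]
  intro s
  obtain ⟨v, hv⟩ := (isResolvent hl s).approx (D.isClosureOf s) x
  set μ := D.m / lam with hμ
  have hμ0 : 0 ≤ μ := (norm_nonneg _).trans (R_le hl s)
  rw [Metric.continuousAt_iff]
  intro ε hε
  have hε' : 0 < ε / (3 * (μ + 1)) := by positivity
  obtain ⟨n, hn⟩ := ((Metric.tendsto_nhds.1 hv) _ hε').exists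
  set y := lam • D.j (v n) - D.gen s (v n) with hy
  have hgen : Tendsto (fun t => D.gen t (v n)) (𝓝 s) (𝓝 (D.gen s (v n))) :=
    ((D.gen_cont.clm_apply continuous_const).tendsto s)
  obtain ⟨δ, hδ, Hδ⟩ := Metric.eventually_nhds_iff.1 ((Metric.tendsto_nhds.1 hgen) _ hε')
  refine ⟨δ, hδ, fun {t} ht => ?_⟩
  have h1 := Hδ ht
  rw [dist_eq_norm] at h1 hn ⊢
  have e1 : D.R lam t y - D.R lam s y = D.R lam t (D.gen t (v n) - D.gen s (v n)) := by
    have e : D.R lam s y = D.R lam t (lam • D.j (v n) - D.gen t (v n)) :=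
      ((isResolvent hl s).apply_core (D.isClosureOf s) (v n)).trans
        ((isResolvent hl t).apply_core (D.isClosureOf t) (v n)).symm
    rw [e, ← map_sub]
    congr 1
    rw [hy]
    abel
  have e2 : D.R lam t x - D.R lam s x =
      -D.R lam t (y - x) + D.R lam t (D.gen t (v n) - D.gen s (v n)) + D.R lam s (y - x) := by
    rw [← e1]; simp only [map_sub]; abel
  have key : ∀ r z, ‖z‖ < ε / (3 * (μ + 1)) → ‖D.R lam r z‖ < ε / 3 := fun r z hz => by
    have h2 := (D.R lam r).le_of_opNorm_le (R_le hl r) z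
    have h3 : μ * ‖z‖ ≤ μ * (ε / (3 * (μ + 1))) := mul_le_mul_of_nonneg_left hz.le hμ0
    have h4 : ε / 3 = (μ + 1) * (ε / (3 * (μ + 1))) := by field_simp
    have h5 : μ * (ε / (3 * (μ + 1))) < ε / 3 := by rw [h4]; nlinarith
    exact (h2.trans h3).trans_lt h5
  rw [e2]
  refine (norm_add₃_le).trans_lt ?_
  rw [norm_neg]
  have := key t _ hn
  have := key t _ h1
  have := key s _ hn
  linarith

variable (D) in
theorem Q_inverse_continuous : Continuous fun t => (D.Q t).inverse :=
  continuous_inverse D.Q_cont D.Q_inv D.Q_inv_le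

variable (D) in
theorem B_continuous : Continuous D.B := D.K_cont.clm_comp D.Q_inverse_continuous

/-- Composition of strongly continuous bounded families. -/
theorem continuous_clm_apply_apply {E G : Type*} [NormedAddCommGroup E] [NormedSpace ℝ E]
    [NormedAddCommGroup G] [NormedSpace ℝ G] {T : ℝ → E →L[ℝ] G} {M : ℝ} (hT : ∀ t, ‖T t‖ ≤ M)
    (h : ∀ x, Continuous fun t => T t x) {w : ℝ → E} (hw : Continuous w) :
    Continuous fun t => T t (w t) :=
  continuous_iff_continuousAt.2 fun s => tendsto_clm_apply (Eventually.of_forall hT)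
    ((h (w s)).tendsto s) (hw.tendsto s)

theorem corr_strongly_continuous (hl : D.Λ ≤ lam) (x : H) :
    Continuous fun t => D.corr lam t x := by
  refine continuous_of_left_inverse (T := fun t => 1 - D.B t * D.R lam t) (corr_le hl)
    (fun y => ?_) (corr_left hl) (corr_right hl) x
  exact continuous_const.sub (D.B_continuous.clm_apply (R_strongly_continuous hl y))

theorem R₁_strongly_continuous (hl : D.Λ ≤ lam) (x : H) : Continuous fun t => D.R₁ lam t x :=
  continuous_clm_apply_apply (R_le hl) (R_strongly_continuous hl) (corr_strongly_continuous hl x)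

theorem yosida_strongly_continuous (hl : D.Λ ≤ lam) (x : H) :
    Continuous fun t => D.yosida lam t x :=
  (((R_strongly_continuous hl x).const_smul lam).sub continuous_const).const_smul lam

theorem yosidaB_strongly_continuous (hl : D.Λ ≤ lam) (x : H) :
    Continuous fun t => D.yosidaB lam t x := by
  refine continuous_clm_apply_apply (T := fun t => lam • D.R₁ lam t) (smul_R₁_le hl)
    (fun y => (R₁_strongly_continuous hl y).const_smul lam) ?_
  exact D.B_continuous.clm_apply ((R_strongly_continuous hl x).const_smul lam)

theorem yosidaY_strongly_continuous (hl : D.Λ ≤ lam) (v : Y) :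
    Continuous fun t => D.yosidaY lam t v := by
  refine D.Q_inverse_continuous.clm_apply ?_
  have hQ : Continuous fun t => D.Q t v := D.Q_cont.clm_apply continuous_const
  have h1 : Continuous fun t => D.R₁ lam t (D.Q t v) := by
    refine (continuous_clm_apply_apply (T := fun t => lam⁻¹ • (lam • D.R₁ lam t))
      (M := ‖lam⁻¹‖ * (D.m * 2)) (fun t => ?_) (fun x => ?_) hQ).congr fun t => ?_
    · rw [norm_smul]
      exact mul_le_mul_of_nonneg_left (smul_R₁_le hl t) (norm_nonneg _)
    · exact ((R₁_strongly_continuous hl x).const_smul lam).const_smul lam⁻¹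
    · rw [inv_smul_smul₀ (pos hl).ne']
  exact ((h1.const_smul lam).sub hQ).const_smul lam

/-- Cauchy–Schwarz and the resolvent bound give the rate `lam * (lam / (lam - ω) - 1)`, which tends
to `ω`. Hence the limit keeps the exact exponent. -/
theorem yosida_dissipative (hl : D.Λ ≤ lam) (t : ℝ) (x : H) :
    D.form t x (D.yosida lam t x) ≤ D.ω * lam / (lam - D.ω) * D.form t x x := by
  have h1 := lt hl
  have h2 := pos hl
  have h3 : 0 < lam - D.ω := by linarith
  have hb := D.energy t
  have h4 := (hb.apply_le x (D.R lam t x)).trans (mul_le_mul_of_nonneg_left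
    ((isResolvent hl t).energyNorm_le (D.isDissipative t) hb h1 x)
    (IsEnergyForm.energyNorm_nonneg x))
  have e : D.form t x (D.yosida lam t x) =
      lam * (lam * D.form t x (D.R lam t x) - D.form t x x) := by
    simp only [yosida, smul_apply, sub_apply, one_apply_eq_self, map_smul, map_sub, smul_eq_mul]
  have h5 : D.form t x (D.R lam t x) ≤ (lam - D.ω)⁻¹ * D.form t x x := by
    rw [← hb.sq_energyNorm]
    linarith
  rw [e]
  have h6 := mul_le_mul_of_nonneg_left (mul_le_mul_of_nonneg_left h5 h2.le) h2.le
  have e2 : D.ω * lam / (lam - D.ω) * D.form t x x =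
      lam * (lam * ((lam - D.ω)⁻¹ * D.form t x x) - D.form t x x) := by
    field_simp; ring
  rw [e2]
  linarith

section Limits

variable (D) in
/-- A sequence of parameters tending to infinity. -/
def lamSeq (n : ℕ) : ℝ := D.Λ + n

variable (D) in
theorem le_lamSeq (n : ℕ) : D.Λ ≤ D.lamSeq n := by
  have : (0 : ℝ) ≤ n := n.cast_nonneg
  unfold lamSeq; linarith

variable (D) in
theorem tendsto_lamSeq : Tendsto D.lamSeq atTop atTop :=
  tendsto_atTop_add_const_left _ _ tendsto_natCast_atTop_atTop

variable (D) in
theorem tendsto_R (t : ℝ) (x : H) :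
    Tendsto (fun n => D.R (D.lamSeq n) t x) atTop (𝓝 0) := by
  have h : Tendsto (fun n => D.m / D.lamSeq n * ‖x‖) atTop (𝓝 0) := by
    have := (D.tendsto_lamSeq.const_div_atTop D.m).mul_const ‖x‖
    simpa using this
  exact squeeze_zero_norm (fun n => (D.R _ t).le_of_opNorm_le (R_le (D.le_lamSeq n) t) x) h

/-- Strong convergence on a dense set implies strong convergence for bounded sequences. -/
theorem tendsto_of_dense {E G : Type*} [NormedAddCommGroup E] [NormedSpace ℝ E]
    [NormedAddCommGroup G] [NormedSpace ℝ G] {T : ℕ → E →L[ℝ] G} {T₀ : E →L[ℝ] G} {M : ℝ}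
    (hT : ∀ n, ‖T n‖ ≤ M) {s : Set E} (hs : Dense s)
    (h : ∀ x ∈ s, Tendsto (fun n => T n x) atTop (𝓝 (T₀ x))) (x : E) :
    Tendsto (fun n => T n x) atTop (𝓝 (T₀ x)) := by
  have hM : 0 ≤ M := (norm_nonneg _).trans (hT 0)
  rw [Metric.tendsto_atTop]
  intro ε hε
  set K := M + ‖T₀‖ + 1 with hK
  have hK0 : 0 < K := by positivity
  obtain ⟨y, hys, hy⟩ := Metric.mem_closure_iff.1 (hs x) (ε / (2 * K)) (by positivity)
  obtain ⟨n₀, hn₀⟩ := Metric.tendsto_atTop.1 (h y hys) (ε / 2) (by positivity)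
  refine ⟨n₀, fun n hn => ?_⟩
  have h1 := hn₀ n hn
  rw [dist_eq_norm] at h1 hy ⊢
  have e : T n x - T₀ x = T n (x - y) - T₀ (x - y) + (T n y - T₀ y) := by
    simp only [map_sub]; abel
  have h2 := (T n).le_of_opNorm_le (hT n) (x - y)
  have h3 := T₀.le_opNorm (x - y)
  have h4 : (M + ‖T₀‖) * ‖x - y‖ ≤ (M + ‖T₀‖) * (ε / (2 * K)) :=
    mul_le_mul_of_nonneg_left hy.le (by positivity)
  have h5 : (M + ‖T₀‖) * (ε / (2 * K)) ≤ ε / 2 := by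
    have : ε / 2 = K * (ε / (2 * K)) := by field_simp
    rw [this]
    exact mul_le_mul_of_nonneg_right (by rw [hK]; linarith) (by positivity)
  rw [e]
  have h6 := norm_add_le (T n (x - y) - T₀ (x - y)) (T n y - T₀ y)
  have h7 := norm_sub_le (T n (x - y)) (T₀ (x - y))
  linarith

variable (D) in
-- On `Y`, `lam R v = v + R (A v)` and `R` tends to zero; density and uniform boundedness do the
-- rest.
theorem tendsto_smul_R (t : ℝ) (x : H) :
    Tendsto (fun n => (D.lamSeq n • D.R (D.lamSeq n) t) x) atTop (𝓝 x) := by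
  refine tendsto_of_dense (T₀ := ContinuousLinearMap.id ℝ H)
    (fun n => smul_R_le (D.le_lamSeq n) t) D.dense ?_ x
  rintro _ ⟨v, rfl⟩
  have h := (D.tendsto_R t (D.gen t v)).add_const (D.j v)
  rw [zero_add] at h
  refine h.congr fun n => ?_
  have h2 := (isResolvent (D.le_lamSeq n) t).apply_core (D.isClosureOf t) v
  rw [map_sub, map_smul, sub_eq_iff_eq_add] at h2
  rw [smul_apply, h2]
  abel

variable (D) in
theorem tendsto_corr (t : ℝ) (x : H) :
    Tendsto (fun n => D.corr (D.lamSeq n) t x) atTop (𝓝 x) := by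
  have h1 : Tendsto (fun n => D.corr (D.lamSeq n) t (D.B t (D.R (D.lamSeq n) t x))) atTop
      (𝓝 0) := by
    have h2 : Tendsto (fun n => 2 * ‖D.B t (D.R (D.lamSeq n) t x)‖) atTop (𝓝 0) := by
      have := (((D.B t).continuous.tendsto _).comp (D.tendsto_R t x)).norm.const_mul 2
      simpa using this
    exact squeeze_zero_norm (fun n => (D.corr _ t).le_of_opNorm_le (corr_le (D.le_lamSeq n) t) _) h2
  have h3 := h1.add_const x
  rw [zero_add] at h3
  refine h3.congr fun n => ?_
  have := corr_left (D.le_lamSeq n) t x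
  rw [map_sub, sub_eq_iff_eq_add] at this
  rw [this]
  abel

variable (D) in
-- The operator is `(lam R) (1 - B R)⁻¹ B (lam R)`, in which every factor except `B` tends strongly
-- to the identity and stays bounded.
theorem tendsto_yosidaB (t : ℝ) (x : H) :
    Tendsto (fun n => D.yosidaB (D.lamSeq n) t x) atTop (𝓝 (D.B t x)) := by
  have h1 := ((D.B t).continuous.tendsto _).comp (D.tendsto_smul_R t x)
  have h2 : Tendsto (fun n => D.corr (D.lamSeq n) t (D.B t ((D.lamSeq n • D.R (D.lamSeq n) t) x)))
      atTop (𝓝 (D.B t x)) :=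
    tendsto_clm_apply (T := fun n => D.corr (D.lamSeq n) t) (T₀ := ContinuousLinearMap.id ℝ H)
      (Eventually.of_forall fun n => corr_le (D.le_lamSeq n) t) (D.tendsto_corr t _) h1
  exact tendsto_clm_apply (T := fun n => D.lamSeq n • D.R (D.lamSeq n) t)
    (T₀ := ContinuousLinearMap.id ℝ H)
    (Eventually.of_forall fun n => smul_R_le (D.le_lamSeq n) t) (D.tendsto_smul_R t _) h2

end Limits

end HyperbolicSystem

end Yosida

end EvolutionScale

/-! ### Uniform bounds and Cauchy property of the approximating evolution families -/

namespace EvolutionScale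

noncomputable section Approximation

open Set MeasureTheory Filter Topology

set_option linter.unusedSectionVars false

section Coefficient

variable {E G : Type*} [NormedAddCommGroup E] [NormedSpace ℝ E] [NormedAddCommGroup G]
  [NormedSpace ℝ G]

theorem aestronglyMeasurable_clm_apply {T : ℝ → E →L[ℝ] G} {w : ℝ → E} {μ : Measure ℝ}
    (hT : AEStronglyMeasurable T μ) (hw : AEStronglyMeasurable w μ) :
    AEStronglyMeasurable (fun r => T r (w r)) μ := by
  have hc : Continuous fun p : (E →L[ℝ] G) × E => p.1 p.2 := by fun_prop
  exact hc.comp_aestronglyMeasurable (hT.prodMk hw)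

theorem intervalIntegrable_clm_apply {T : ℝ → E →L[ℝ] G} (hT : Integrable T) {w : ℝ → E}
    (hw : Continuous w) (s t : ℝ) : IntervalIntegrable (fun r => T r (w r)) volume s t := by
  have h1 : IntervalIntegrable (fun r => ‖T r‖ * ‖w r‖) volume s t :=
    hT.norm.intervalIntegrable.mul_continuousOn hw.norm.continuousOn
  exact h1.mono_fun' (aestronglyMeasurable_clm_apply hT.1 hw.aestronglyMeasurable).restrict
    (ae_of_all _ fun r => (T r).le_opNorm _)

theorem isCoefficient_indicator {F : ℝ → E →L[ℝ] E} {M : ℝ} (hM : ∀ t, ‖F t‖ ≤ M)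
    (hF : ∀ x, Continuous fun t => F t x) (a b : ℝ) :
    IsCoefficient ((Icc a b).indicator F) ((Icc a b).indicator fun _ => M) where
  integrable := (integrable_indicator_iff measurableSet_Icc).2 (integrableOn_const (by simp))
  norm_le r := by
    by_cases h : r ∈ Icc a b <;> simp [h, hM]
  meas w hw := by
    have : (fun r => (Icc a b).indicator F r (w r)) = (Icc a b).indicator fun r => F r (w r) := by
      ext r
      by_cases h : r ∈ Icc a b <;> simp [h]
    rw [this]
    exact (HyperbolicSystem.continuous_clm_apply_apply hM hF hw).aestronglyMeasurable.indicator
      measurableSet_Icc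

theorem isCoefficient_of_integrable {F : ℝ → E →L[ℝ] E} {φ : ℝ → ℝ}
    (hF : AEStronglyMeasurable F volume) (hφ : Integrable φ) (h : ∀ r, ‖F r‖ ≤ φ r) :
    IsCoefficient F φ :=
  ⟨hφ, h, fun _ hw => aestronglyMeasurable_clm_apply hF hw.aestronglyMeasurable⟩

theorem IsCoefficient.add {F F' : ℝ → E →L[ℝ] E} {φ φ' : ℝ → ℝ} (h : IsCoefficient F φ)
    (h' : IsCoefficient F' φ') : IsCoefficient (fun r => F r + F' r) (fun r => φ r + φ' r) where
  integrable := h.integrable.add h'.integrable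
  norm_le r := norm_add_le_of_le (h.norm_le r) (h'.norm_le r)
  meas w hw := by
    simp only [add_apply]
    exact (h.meas w hw).add (h'.meas w hw)

end Coefficient

open Classical in
/-- The evolution family of a bounded coefficient, if it exists. -/
def boundedEvolution {E : Type*} [NormedAddCommGroup E] [NormedSpace ℝ E]
    (F : ℝ → E →L[ℝ] E) (a b : ℝ) : ℝ → ℝ → E →L[ℝ] E :=
  if h : ∃ S, IsDyson (idFamily E) F a b S then h.choose else 0

theorem boundedEvolution_spec {E : Type*} [NormedAddCommGroup E] [NormedSpace ℝ E] [CompleteSpace E]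
    {F : ℝ → E →L[ℝ] E} {φ : ℝ → ℝ} (hF : IsCoefficient F φ) {a b : ℝ} (hab : a ≤ b) :
    IsBoundedEvolution F a b (boundedEvolution F a b) := by
  have h : ∃ S, IsDyson (idFamily E) F a b S := exists_isBoundedEvolution hF hab
  rw [boundedEvolution, dif_pos h]
  exact h.choose_spec

namespace HyperbolicSystem

variable {H Y : Type*} [NormedAddCommGroup H] [NormedSpace ℝ H] [CompleteSpace H]
  [NormedAddCommGroup Y] [NormedSpace ℝ Y] [CompleteSpace Y] (D : HyperbolicSystem H Y)

/-- The Yosida approximations on `[a, b]`. -/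
def coef (lam : ℝ) : ℝ → H →L[ℝ] H := (Icc D.a D.b).indicator (D.yosida lam)

/-- The Yosida approximations on `Y`. -/
def coefY (lam : ℝ) : ℝ → Y →L[ℝ] Y := (Icc D.a D.b).indicator (D.yosidaY lam)

/-- The perturbation `Q' Q⁻¹`. -/
def coefQ (t : ℝ) : H →L[ℝ] H := (D.Q' t).comp (D.Q t).inverse

/-- The perturbation obtained by conjugation of the Yosida approximations with `Q`. -/
def coefB (lam t : ℝ) : H →L[ℝ] H := (Icc D.a D.b).indicator (D.yosidaB lam) t + D.coefQ t

/-- A bound of the perturbations. -/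
def boundB (t : ℝ) : ℝ := (Icc D.a D.b).indicator (fun _ => D.m * 2 * (D.CK * D.CQ) * D.m) t +
  ‖D.Q' t‖ * D.CQ

/-- The evolution family of the Yosida approximation. -/
def S (lam : ℝ) : ℝ → ℝ → H →L[ℝ] H := boundedEvolution (D.coef lam) D.a D.b

/-- The evolution family of the Yosida approximation on `Y`. -/
def SY (lam : ℝ) : ℝ → ℝ → Y →L[ℝ] Y := boundedEvolution (D.coefY lam) D.a D.b

/-- The energy norms. -/
def N (t : ℝ) : Seminorm ℝ H := (D.energy t).seminorm

/-- The growth bound with exponential rate `η`. -/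
def growth (η s t : ℝ) : ℝ := D.ρ s t * Real.exp (η * (t - s))

variable {D} {lam : ℝ}

theorem isCoefficient_coef (hl : D.Λ ≤ lam) : IsCoefficient (D.coef lam)
    ((Icc D.a D.b).indicator fun _ => lam * (D.m + 1)) :=
  isCoefficient_indicator (yosida_le hl) (yosida_strongly_continuous hl) _ _

theorem isCoefficient_coefY (hl : D.Λ ≤ lam) : IsCoefficient (D.coefY lam)
    ((Icc D.a D.b).indicator fun _ => D.CQ * (lam * (D.m * 2 + 1)) * D.CQ) :=
  isCoefficient_indicator (yosidaY_le hl) (yosidaY_strongly_continuous hl) _ _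

variable (D) in
theorem isCoefficient_coefQ : IsCoefficient D.coefQ (fun r => ‖D.Q' r‖ * D.CQ) := by
  refine isCoefficient_of_integrable ?_ (D.Q'_int.norm.mul_const _) fun r => ?_
  · have hc : Continuous fun p : (Y →L[ℝ] H) × (H →L[ℝ] Y) => p.1.comp p.2 := by fun_prop
    exact hc.comp_aestronglyMeasurable
      (D.Q'_int.1.prodMk D.Q_inverse_continuous.aestronglyMeasurable)
  · exact (ContinuousLinearMap.opNorm_comp_le _ _).trans
      (mul_le_mul_of_nonneg_left (D.Q_inv_le r) (norm_nonneg _))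

theorem isCoefficient_coefB (hl : D.Λ ≤ lam) : IsCoefficient (D.coefB lam) D.boundB :=
  (isCoefficient_indicator (yosidaB_le hl) (yosidaB_strongly_continuous hl) _ _).add
    D.isCoefficient_coefQ

theorem S_spec (hl : D.Λ ≤ lam) : IsBoundedEvolution (D.coef lam) D.a D.b (D.S lam) :=
  boundedEvolution_spec (isCoefficient_coef hl) D.hab

theorem SY_spec (hl : D.Λ ≤ lam) : IsBoundedEvolution (D.coefY lam) D.a D.b (D.SY lam) :=
  boundedEvolution_spec (isCoefficient_coefY hl) D.hab

theorem S_continuous (hl : D.Λ ≤ lam) (s : ℝ) (x : H) : Continuous fun r => D.S lam r s x :=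
  (S_spec hl).continuous_left (isCoefficient_coef hl) D.hab s x

theorem SY_continuous (hl : D.Λ ≤ lam) (s : ℝ) (v : Y) : Continuous fun r => D.SY lam r s v :=
  (SY_spec hl).continuous_left (isCoefficient_coefY hl) D.hab s v

theorem coef_apply {r : ℝ} (hr : r ∈ Icc D.a D.b) : D.coef lam r = D.yosida lam r :=
  indicator_of_mem hr _

theorem coefY_apply {r : ℝ} (hr : r ∈ Icc D.a D.b) : D.coefY lam r = D.yosidaY lam r :=
  indicator_of_mem hr _

theorem coef_j (hl : D.Λ ≤ lam) (r : ℝ) (v : Y) :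
    D.coef lam r (D.j v) = D.j (D.coefY lam r v) := by
  by_cases hr : r ∈ Icc D.a D.b
  · rw [coef_apply hr, coefY_apply hr, yosida_j hl]
  · simp [coef, coefY, hr]

theorem coefQ_apply_Q (r : ℝ) (v : Y) : D.coefQ r (D.Q r v) = D.Q' r v := by
  rw [coefQ, ContinuousLinearMap.comp_apply, (D.Q_inv r).inverse_apply_self]

theorem yosida_comp_continuous (hl : D.Λ ≤ lam) {w : ℝ → H} (hw : Continuous w) :
    Continuous fun r => D.yosida lam r (w r) :=
  continuous_clm_apply_apply (yosida_le hl) (yosida_strongly_continuous hl) hw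

theorem S_sub (hl : D.Λ ≤ lam) {s r t : ℝ} (hs : D.a ≤ s) (hsr : s ≤ r) (hrt : r ≤ t)
    (ht : t ≤ D.b) (x : H) :
    D.S lam t s x - D.S lam r s x = ∫ u in r..t, D.yosida lam u (D.S lam u s x) := by
  have hF := isCoefficient_coef hl
  have hi := hF.intervalIntegrable (S_continuous hl s x)
  rw [(S_spec hl).forward hF hs (hsr.trans hrt) ht, (S_spec hl).forward hF hs hsr (hrt.trans ht),
    add_sub_add_left_eq_sub, intervalIntegral.integral_interval_sub_left (hi _ _) (hi _ _)]
  refine intervalIntegral.integral_congr fun u hu => ?_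
  rw [uIcc_of_le hrt] at hu
  rw [coef_apply ⟨hs.trans (hsr.trans hu.1), hu.2.trans ht⟩]

/-- The image under `j` of the family on `Y` solves the integral equation on `H`, whose solution is
unique. -/
theorem S_j (hl : D.Λ ≤ lam) {s t : ℝ} (hs : D.a ≤ s) (hst : s ≤ t) (ht : t ≤ D.b) (v : Y) :
    D.S lam t s (D.j v) = D.j (D.SY lam t s v) := by
  refine ((S_spec hl).unique (isCoefficient_coef hl) hs (y := fun r => D.j (D.SY lam r s v))
    (D.j.continuous.comp (SY_continuous hl s v)) (fun r hsr hr => ?_) hst ht).symm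
  have hi := (isCoefficient_coefY hl).intervalIntegrable (SY_continuous hl s v) s r
  rw [(SY_spec hl).forward (isCoefficient_coefY hl) hs hsr hr v, map_add,
    ← ContinuousLinearMap.intervalIntegral_comp_comm _ hi]
  simp only [coef_j hl]

/-- The exponential rate of the Yosida approximation. -/
def rate (D : HyperbolicSystem H Y) (lam : ℝ) : ℝ := D.ω * lam / (lam - D.ω)

theorem abs_rate_le (hl : D.Λ ≤ lam) : |D.rate lam| ≤ 2 * |D.ω| := by
  have h1 := half_le hl
  have h2 := pos hl
  have h3 : 0 < lam - D.ω := by linarith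
  rw [rate, abs_div, abs_mul, abs_of_pos h2, abs_of_pos h3, div_le_iff₀ h3]
  nlinarith [abs_nonneg D.ω]

theorem S_energy (hl : D.Λ ≤ lam) {s t : ℝ} (hs : D.a ≤ s) (hst : s ≤ t) (ht : t ≤ D.b) (x : H) :
    energyNorm (D.form t) (D.S lam t s x) ≤
      D.growth (D.rate lam) s t * energyNorm (D.form s) x := by
  have hSc := S_continuous hl s x
  have hsI : s ∈ Icc D.a D.b := ⟨hs, hst.trans ht⟩
  have h := energy_estimate (b := D.form) (C := D.C) (ω := D.rate lam) (ε := 0) (ρ₀ := D.ρ₀)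
    (ρ := D.ρ s) (d := fun r => D.S lam r s x) (g := fun r => D.yosida lam r (D.S lam r s x)) hst
    (fun r _ => D.energy r) (D.ρ_refl s hsI) D.ρ₀_pos
    (fun r hr => D.ρ_lower s r hs hr.1 (hr.2.trans ht))
    (fun p q hp hpq hq v => D.ρ_energy s p q hs hp hpq (hq.trans ht) v)
    hSc.continuousOn (yosida_comp_continuous hl hSc).continuousOn
    (fun p q hp hpq hq => S_sub hl hs hp hpq (hq.trans ht) x) le_rfl
    (fun r _ => by rw [add_zero]; exact yosida_dissipative hl r _)
  rw [(S_spec hl).refl (isCoefficient_coef hl) hs (hst.trans ht)] at h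
  have hρ0 : 0 ≤ D.ρ s t := D.ρ₀_pos.le.trans (D.ρ_lower s t hs hst ht)
  have hg0 : 0 ≤ D.growth (D.rate lam) s t := mul_nonneg hρ0 (Real.exp_pos _).le
  refine abs_le_of_sq_le_sq' ?_ (mul_nonneg hg0 (IsEnergyForm.energyNorm_nonneg x)) |>.2
  rw [mul_pow, (D.energy t).sq_energyNorm, (D.energy s).sq_energyNorm]
  refine h.trans (le_of_eq ?_)
  rw [growth, mul_pow, ← Real.exp_nat_mul]
  push_cast
  ring_nf

variable (D) in
theorem growth_mul_le (η : ℝ) {s r t : ℝ} (hs : D.a ≤ s) (hsr : s ≤ r) (hrt : r ≤ t)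
    (ht : t ≤ D.b) : D.growth η s r * D.growth η r t ≤ D.growth η s t := by
  have h := D.ρ_mul s r t hs hsr hrt ht
  have e : D.growth η s r * D.growth η r t = D.ρ s r * D.ρ r t * Real.exp (η * (t - s)) := by
    have : Real.exp (η * (t - s)) = Real.exp (η * (r - s)) * Real.exp (η * (t - r)) := by
      rw [← Real.exp_add]; congr 1; ring
    rw [this, growth, growth]; ring
  rw [e]
  exact mul_le_mul_of_nonneg_right h (Real.exp_pos _).le

/-- A uniform growth constant. -/
def growthConst (D : HyperbolicSystem H Y) : ℝ := D.Cρ * Real.exp (2 * |D.ω| * (D.b - D.a))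

variable (D) in
theorem isGrowthBound_of {η : ℝ} (hη : |η| ≤ 2 * |D.ω|) {V : ℝ → ℝ → H →L[ℝ] H}
    (hV : ∀ s t, D.a ≤ s → s ≤ t → t ≤ D.b → ∀ x,
      energyNorm (D.form t) (V t s x) ≤ D.growth η s t * energyNorm (D.form s) x) :
    IsGrowthBound D.N (D.growth η) D.a D.b D.C D.growthConst V where
  const_nonneg := D.C_pos.le
  seminorm_le t _ x := (D.energy t).upper x
  norm_le t _ x := (D.energy t).norm_le x
  nonneg s t hs hst ht :=
    mul_nonneg (D.ρ₀_pos.le.trans (D.ρ_lower s t hs hst ht)) (Real.exp_pos _).le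
  mul_le s r t hs hsr hrt ht := D.growth_mul_le η hs hsr hrt ht
  le_const s t hs hst ht := by
    have h0 := D.ρ₀_pos.le.trans (D.ρ_lower s t hs hst ht)
    have h1 := D.ρ_upper s t hs hst ht
    refine mul_le_mul h1 (Real.exp_le_exp.2 ?_) (Real.exp_pos _).le (h0.trans h1)
    have h2 : η * (t - s) ≤ |η| * (t - s) :=
      mul_le_mul_of_nonneg_right (le_abs_self η) (by linarith)
    refine h2.trans (mul_le_mul hη (by linarith) (by linarith) (by positivity))
  bound := hV

theorem S_isGrowthBound (hl : D.Λ ≤ lam) :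
    IsGrowthBound D.N (D.growth (D.rate lam)) D.a D.b D.C D.growthConst (D.S lam) :=
  D.isGrowthBound_of (abs_rate_le hl) fun _ _ hs hst ht x => S_energy hl hs hst ht x

/-- A uniform bound of the approximations. -/
def MS (D : HyperbolicSystem H Y) : ℝ := D.C * (D.growthConst * D.C)

theorem norm_le_MS {η : ℝ} {V : ℝ → ℝ → H →L[ℝ] H}
    (h : IsGrowthBound D.N (D.growth η) D.a D.b D.C D.growthConst V) {s t : ℝ} (hs : D.a ≤ s)
    (hst : s ≤ t) (ht : t ≤ D.b) : ‖V t s‖ ≤ D.MS := by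
  have hC := D.C_pos.le
  have hG := h.growth_const_nonneg D.hab
  refine ContinuousLinearMap.opNorm_le_bound _ (mul_nonneg hC (mul_nonneg hG hC)) fun x => ?_
  refine (h.norm_le t ⟨hs.trans hst, ht⟩ _).trans ?_
  have h1 := (h.bound s t hs hst ht x).trans (mul_le_mul (h.le_const s t hs hst ht)
    (h.seminorm_le s ⟨hs, hst.trans ht⟩ x) (apply_nonneg _ _) hG)
  refine (mul_le_mul_of_nonneg_left h1 hC).trans (le_of_eq ?_)
  rw [MS]; ring

/-- `D.S` composed with the projection on the triangle, for which uniform bounds hold. -/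
def Sc (D : HyperbolicSystem H Y) (lam t s : ℝ) : H →L[ℝ] H :=
  D.S lam (clamp D.a D.b (max s t)) (clamp D.a D.b s)

variable (D) in
theorem clamp_tri (t s : ℝ) : D.a ≤ clamp D.a D.b s ∧
    clamp D.a D.b s ≤ clamp D.a D.b (max s t) ∧ clamp D.a D.b (max s t) ≤ D.b :=
  ⟨le_clamp _ _ _, clamp_mono _ _ (le_max_left _ _), clamp_le D.hab _⟩

theorem Sc_eq {s t : ℝ} (hs : D.a ≤ s) (hst : s ≤ t) (ht : t ≤ D.b) :
    D.Sc lam t s = D.S lam t s := by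
  rw [Sc, max_eq_right hst, clamp_of_mem (hs.trans hst) ht, clamp_of_mem hs (hst.trans ht)]

theorem Sc_isStrongFamily (hl : D.Λ ≤ lam) : IsStrongFamily (D.Sc lam) D.MS where
  cont x := by
    refine (((S_spec hl).isStrongFamily (isCoefficient_coef hl) D.hab).cont x).comp
      (f := fun p : ℝ × ℝ => (clamp D.a D.b (max p.2 p.1), clamp D.a D.b p.2)) ?_
    have := continuous_clamp D.a D.b
    fun_prop
  bound t s := by
    obtain ⟨h1, h2, h3⟩ := D.clamp_tri t s
    exact norm_le_MS (S_isGrowthBound hl) h1 h2 h3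

theorem Sc_isGrowthBound (hl : D.Λ ≤ lam) :
    IsGrowthBound D.N (D.growth (D.rate lam)) D.a D.b D.C D.growthConst (D.Sc lam) :=
  D.isGrowthBound_of (abs_rate_le hl) fun s t hs hst ht x => by
    rw [Sc_eq hs hst ht]; exact S_energy hl hs hst ht x

variable (D) in
theorem Q_deriv_apply {s t : ℝ} (hs : D.a ≤ s) (hst : s ≤ t) (ht : t ≤ D.b) (v : Y) :
    D.Q t v - D.Q s v = ∫ r in s..t, D.Q' r v := by
  have h := congrArg (fun T : Y →L[ℝ] H => T v) (D.Q_deriv s t hs hst ht)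
  have h2 := ContinuousLinearMap.intervalIntegral_comp_comm (ContinuousLinearMap.apply ℝ H v)
    (D.Q'_int.intervalIntegrable (a := s) (b := t))
  simp only [ContinuousLinearMap.apply_apply] at h2
  rw [h2]
  exact h

/-- Conjugation of the approximations on `Y` with `Q` gives a perturbation of the approximations
on `H`. -/
theorem Q_SY (hl : D.Λ ≤ lam) {W : ℝ → ℝ → H →L[ℝ] H}
    (hW : IsDyson (D.Sc lam) (D.coefB lam) D.a D.b W) {s t : ℝ} (hs : D.a ≤ s) (hst : s ≤ t)
    (ht : t ≤ D.b) (v : Y) : D.Q t (D.SY lam t s v) = W t s (D.Q s v) := by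
  set z : ℝ → Y := fun r => D.SY lam r s v with hz
  have hzc : Continuous z := SY_continuous hl s v
  set y : ℝ → H := fun r => D.Q r (z r) with hy
  have hyc : Continuous y := D.Q_cont.clm_apply hzc
  have hFB := isCoefficient_coefB hl
  have hFY := isCoefficient_coefY hl
  refine hW.unique (Sc_isGrowthBound hl) (Sc_isStrongFamily hl) hFB hs (y := y) hyc
    (fun t hst ht => ?_) hst ht
  have hzs : z s = v := (SY_spec hl).refl hFY hs (hst.trans ht) v
  have hzsub : ∀ u w, s ≤ u → u ≤ w → w ≤ t → z w - z u = ∫ r in u..w, D.coefY lam r (z r) := by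
    intro u w hu huw hw
    have hi := hFY.intervalIntegrable hzc
    simp only [hz]
    rw [(SY_spec hl).forward hFY hs (hu.trans huw) (hw.trans ht),
      (SY_spec hl).forward hFY hs hu (huw.trans (hw.trans ht)), add_sub_add_left_eq_sub,
      intervalIntegral.integral_interval_sub_left (hi _ _) (hi _ _)]
  -- With `y = Q z`, the equation `y' = A_lam y + coefB y` turns by variation of constants into the
  -- Volterra equation that characterizes `W`.
  have hduh := (S_spec hl).duhamel (isCoefficient_coef hl) hs hst ht (y := y)
    (f := fun r => D.coefB lam r (y r)) hyc (hFB.intervalIntegrable hyc _ _)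
    fun u w hu huw hw => ?_
  · have e1 : D.Sc lam t s = D.S lam t s := Sc_eq hs hst ht
    have e2 : (∫ r in s..t, D.Sc lam t r (D.coefB lam r (y r))) =
        ∫ r in s..t, D.S lam t r (D.coefB lam r (y r)) := by
      refine intervalIntegral.integral_congr fun r hr => ?_
      rw [uIcc_of_le hst] at hr
      simp only [Sc_eq (lam := lam) (hs.trans hr.1) hr.2 ht]
    rw [e1, e2, hduh]
    simp only [hy, hzs]
  -- The product rule gives `(Q z)' = Q' z + Q (yosidaY z)`; the first term is `coefQ (Q z)` and the
  -- second is evaluated by `Q_yosidaY`.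
  · have hpr := integral_product_rule (P := D.Q) (P' := D.Q') (y := z)
      (y' := fun r => D.coefY lam r (z r)) (p := fun r => ‖D.Q' r‖) huw
      D.Q'_int.norm.intervalIntegrable (fun _ _ => le_rfl) (hFY.intervalIntegrable hzc _ _)
      (fun x => intervalIntegrable_clm_apply D.Q'_int continuous_const _ _)
      (fun x p q hp hpq hq => D.Q_deriv_apply (hs.trans (hu.trans hp)) hpq
        (hq.trans (hw.trans ht)) x)
      (fun p q hp hpq hq => hzsub p q (hu.trans hp) hpq (hq.trans hw))
      D.Q_cont.continuousOn hzc.continuousOn (intervalIntegrable_clm_apply D.Q'_int hzc _ _) ?_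
    · simp only [hy]
      rw [hpr]
      refine intervalIntegral.integral_congr fun r hr => ?_
      rw [uIcc_of_le huw] at hr
      have hrI : r ∈ Icc D.a D.b := ⟨hs.trans (hu.trans hr.1), hr.2.trans (hw.trans ht)⟩
      simp only [coefB, add_apply, coef_apply hrI, coefY_apply hrI, indicator_of_mem hrI,
        coefQ_apply_Q, Q_yosidaY hl]
      abel
    · have hcont : Continuous fun r => D.yosidaY lam r (z r) :=
        continuous_clm_apply_apply (yosidaY_le hl) (yosidaY_strongly_continuous hl) hzc
      refine ((D.Q_cont.clm_apply hcont).intervalIntegrable u w).congr fun r hr => ?_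
      rw [uIoc_of_le huw] at hr
      have hrI : r ∈ Icc D.a D.b := ⟨hs.trans (hu.trans hr.1.le), hr.2.trans (hw.trans ht)⟩
      simp only [coefY_apply hrI]

/-- A uniform bound of the conjugated approximations. -/
def MW (D : HyperbolicSystem H Y) : ℝ :=
  D.C ^ 2 * D.growthConst * Real.exp (D.C ^ 2 * ∫ r, D.boundB r)

theorem exists_conjugate (hl : D.Λ ≤ lam) :
    ∃ W, IsDyson (D.Sc lam) (D.coefB lam) D.a D.b W :=
  exists_isDyson (Sc_isGrowthBound hl) (Sc_isStrongFamily hl) (isCoefficient_coefB hl) D.hab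

theorem SY_eq (hl : D.Λ ≤ lam) {W : ℝ → ℝ → H →L[ℝ] H}
    (hW : IsDyson (D.Sc lam) (D.coefB lam) D.a D.b W) {s t : ℝ} (hs : D.a ≤ s) (hst : s ≤ t)
    (ht : t ≤ D.b) (v : Y) : D.SY lam t s v = (D.Q t).inverse (W t s (D.Q s v)) := by
  rw [← Q_SY hl hW hs hst ht, (D.Q_inv t).inverse_apply_self]

/-- Uniform bound of the approximations on `Y`. -/
theorem SY_norm_le (hl : D.Λ ≤ lam) {s t : ℝ} (hs : D.a ≤ s) (hst : s ≤ t) (ht : t ≤ D.b)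
    (v : Y) : ‖D.SY lam t s v‖ ≤ D.CQ * (D.MW * (D.CQ * ‖v‖)) := by
  obtain ⟨W, hW⟩ := exists_conjugate hl
  have hWb := (hW.isStrongFamily (Sc_isGrowthBound hl) (Sc_isStrongFamily hl)
    (isCoefficient_coefB hl) D.hab).bound t s
  rw [SY_eq hl hW hs hst ht]
  exact (D.Q t).inverse.le_of_opNorm_le_of_le (D.Q_inv_le t)
    ((W t s).le_of_opNorm_le_of_le hWb ((D.Q s).le_of_opNorm_le (D.Q_le s) v))

/-- Along solutions starting in `Y` the approximate generator is bounded uniformly in `lam`, through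
the bound on `Y`. This gives the Cauchy rate and a dominating function for the limit. -/
theorem yosida_S_le (hl : D.Λ ≤ lam) {s t : ℝ} (hs : D.a ≤ s) (hst : s ≤ t) (ht : t ≤ D.b)
    (v : Y) : ‖D.yosida lam t (D.S lam t s (D.j v))‖ ≤
      D.m * (D.Cg * (D.CQ * (D.MW * (D.CQ * ‖v‖)))) := by
  rw [S_j hl hs hst ht, yosida_apply_j hl]
  exact (lam • D.R lam t).le_of_opNorm_le_of_le (smul_R_le hl t)
    ((D.gen t).le_of_opNorm_le_of_le (D.gen_le t) (SY_norm_le hl hs hst ht v))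

/-- The form of a difference of Yosida approximations. -/
theorem form_yosida_sub {mu : ℝ} (hl : D.Λ ≤ lam) (hm : D.Λ ≤ mu) (t : ℝ) {x x' : H} {M G : ℝ}
    (hM : ‖x - x'‖ ≤ M) (hx : ‖D.yosida lam t x‖ ≤ G) (hx' : ‖D.yosida mu t x'‖ ≤ G) :
    D.form t (x - x') (D.yosida lam t x - D.yosida mu t x') ≤
      D.ω * D.form t (x - x') (x - x') +
        (D.C ^ 2 * (2 * G ^ 2 + 2 * |D.ω| * (M * G + G ^ 2))) * (lam⁻¹ + mu⁻¹) := by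
  have hl0 := pos hl
  have hm0 := pos hm
  have hb := D.energy t
  have hG0 : 0 ≤ G := (norm_nonneg _).trans hx
  have hM0 : 0 ≤ M := (norm_nonneg _).trans hM
  set g := D.yosida lam t x - D.yosida mu t x' with hg
  set e := lam⁻¹ • D.yosida lam t x - mu⁻¹ • D.yosida mu t x' with he
  set d := x - x' with hd
  set τ := lam⁻¹ + mu⁻¹ with hτ
  have hτ0 : 0 ≤ τ := by positivity
  -- This reduces the term quadratic in `τ` to a linear one.
  have hτ2 : τ ≤ 2 := by
    have h1 : lam⁻¹ ≤ 1 := inv_le_one_of_one_le₀ (one_le hl)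
    have h2 : mu⁻¹ ≤ 1 := inv_le_one_of_one_le₀ (one_le hm)
    linarith
  have e1 : ∀ (l : ℝ) (x : H), l ≠ 0 → l • D.R l t x = x + l⁻¹ • D.yosida l t x := by
    intro l x hl
    have : D.yosida l t x = l • (l • D.R l t x - x) := rfl
    rw [this, inv_smul_smul₀ hl]; abel
  have e2 : ∀ (l : ℝ) (x : H), D.yosida l t x = l • (l • D.R l t x) - l • x := fun l x =>
    smul_sub _ _ _
  -- Dissipativity is available only on the domain, at `lam R x - mu R x'`. This vector is `d + e`,
  -- where `e` is of size `τ` because `lam R x = x + lam⁻¹ A_lam x`.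
  have hdis := (isResolvent hl t).dissipative_sub (isResolvent hm t) (D.isDissipative t)
    (lam • x) (mu • x')
  simp only [map_smul] at hdis
  rw [← e2, ← e2, ← hg, e1 lam x hl0.ne', e1 mu x' hm0.ne'] at hdis
  have e3 : x + lam⁻¹ • D.yosida lam t x - (x' + mu⁻¹ • D.yosida mu t x') = d + e := by
    rw [hd, he]; abel
  rw [e3] at hdis
  have hgG : ‖g‖ ≤ 2 * G := (norm_sub_le _ _).trans (by linarith)
  have heG : ‖e‖ ≤ τ * G := by
    refine (norm_sub_le _ _).trans ?_
    rw [norm_smul, norm_smul, Real.norm_of_nonneg (inv_nonneg.2 hl0.le),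
      Real.norm_of_nonneg (inv_nonneg.2 hm0.le), hτ, add_mul]
    exact add_le_add (mul_le_mul_of_nonneg_left hx (inv_nonneg.2 hl0.le))
      (mul_le_mul_of_nonneg_left hx' (inv_nonneg.2 hm0.le))
  have h1 : -D.form t e g ≤ D.C ^ 2 * (τ * G) * (2 * G) := by
    have := hb.apply_le_norm (-e) g
    rw [map_neg, neg_apply, norm_neg] at this
    refine this.trans ?_
    gcongr
  have h2 : |D.form t d e| ≤ D.C ^ 2 * M * (τ * G) := by
    rw [abs_le]
    constructor
    · have := hb.apply_le_norm (-d) e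
      rw [map_neg, neg_apply, norm_neg] at this
      have h3 : D.C ^ 2 * ‖d‖ * ‖e‖ ≤ D.C ^ 2 * M * (τ * G) := by gcongr
      linarith
    · refine (hb.apply_le_norm d e).trans ?_
      gcongr
  have h3 : D.form t e e ≤ D.C ^ 2 * (τ * G) * (τ * G) := by
    refine (hb.apply_le_norm e e).trans ?_
    gcongr
  have h3' : D.form t e e ≤ 2 * (D.C ^ 2 * G ^ 2 * τ) := by
    have : D.C ^ 2 * (τ * G) * (τ * G) = τ * (D.C ^ 2 * G ^ 2 * τ) := by ring
    rw [this] at h3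
    exact h3.trans (mul_le_mul_of_nonneg_right hτ2 (by positivity))
  have h4 : D.form t (d + e) g = D.form t d g + D.form t e g := by
    rw [map_add, add_apply]
  have h5 : D.form t (d + e) (d + e) =
      D.form t d d + (2 * D.form t d e + D.form t e e) := by
    simp only [map_add, add_apply]
    rw [hb.symm e d]; ring
  rw [h4, h5, mul_add] at hdis
  have h6 : |2 * D.form t d e + D.form t e e| ≤
      2 * (D.C ^ 2 * M * (τ * G)) + 2 * (D.C ^ 2 * G ^ 2 * τ) := by
    refine (abs_add_le _ _).trans (add_le_add ?_ ?_)
    · rw [abs_mul, abs_two]; linarith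
    · rw [abs_of_nonneg (hb.nonneg e)]; exact h3'
  have h7 : D.ω * (2 * D.form t d e + D.form t e e) ≤
      |D.ω| * (2 * (D.C ^ 2 * M * (τ * G)) + 2 * (D.C ^ 2 * G ^ 2 * τ)) := by
    refine (le_abs_self _).trans ?_
    rw [abs_mul]
    exact mul_le_mul_of_nonneg_left h6 (abs_nonneg _)
  have h8 : D.C ^ 2 * (2 * G ^ 2 + 2 * |D.ω| * (M * G + G ^ 2)) * τ =
      D.C ^ 2 * (τ * G) * (2 * G) +
        |D.ω| * (2 * (D.C ^ 2 * M * (τ * G)) + 2 * (D.C ^ 2 * G ^ 2 * τ)) := by ring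
  rw [h8]
  linarith

variable (D) in
/-- The approximations form a Cauchy sequence on `Y`. -/
theorem exists_cauchy_bound (v : Y) : ∃ K : ℝ, ∀ lam mu, D.Λ ≤ lam → D.Λ ≤ mu → ∀ s t,
    D.a ≤ s → s ≤ t → t ≤ D.b →
      ‖D.S lam t s (D.j v) - D.S mu t s (D.j v)‖ ^ 2 ≤ K * (lam⁻¹ + mu⁻¹) := by
  set M := 2 * (D.MS * ‖D.j v‖) with hM
  set G := D.m * (D.Cg * (D.CQ * (D.MW * (D.CQ * ‖v‖)))) with hG
  set c := D.C ^ 2 * (2 * G ^ 2 + 2 * |D.ω| * (M * G + G ^ 2)) with hc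
  set E := D.ρ₀⁻¹ ^ 2 * Real.exp (2 * |D.ω| * (D.b - D.a)) with hE
  refine ⟨D.C ^ 2 * (D.Cρ ^ 2 * Real.exp (2 * |D.ω| * (D.b - D.a)) *
    (2 * c * E * (D.b - D.a))), fun lam mu hl hm s t hs hst ht => ?_⟩
  set τ := lam⁻¹ + mu⁻¹ with hτ
  have hl0 := pos hl
  have hm0 := pos hm
  have hτ0 : 0 ≤ τ := by positivity
  have hsb := hst.trans ht
  have hG0 : 0 ≤ G := (norm_nonneg _).trans (yosida_S_le hl hs le_rfl hsb v)
  have hMS : ∀ l, D.Λ ≤ l → ∀ r ∈ Icc s t, ‖D.S l r s (D.j v)‖ ≤ D.MS * ‖D.j v‖ :=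
    fun l hl r hr => (D.S l r s).le_of_opNorm_le
      (norm_le_MS (S_isGrowthBound hl) hs hr.1 (hr.2.trans ht)) _
  have hM' : ∀ r ∈ Icc s t, ‖D.S lam r s (D.j v) - D.S mu r s (D.j v)‖ ≤ M := fun r hr =>
    (norm_sub_le _ _).trans (by rw [hM]; linarith [hMS lam hl r hr, hMS mu hm r hr])
  have hM0 : 0 ≤ M := (norm_nonneg _).trans (hM' s ⟨le_rfl, hst⟩)
  have hc0 : 0 ≤ c := by positivity
  have hc1 := S_continuous hl s (D.j v)
  have hc2 := S_continuous hm s (D.j v)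
  have hc3 := yosida_comp_continuous hl hc1
  have hc4 := yosida_comp_continuous hm hc2
  -- The two approximations have the same initial value, so only the error `c * τ` contributes.
  have h := energy_estimate (b := D.form) (C := D.C) (ω := D.ω) (ε := c * τ) (ρ₀ := D.ρ₀)
    (ρ := D.ρ s) (d := fun r => D.S lam r s (D.j v) - D.S mu r s (D.j v))
    (g := fun r => D.yosida lam r (D.S lam r s (D.j v)) - D.yosida mu r (D.S mu r s (D.j v))) hst
    (fun r _ => D.energy r) (D.ρ_refl s ⟨hs, hsb⟩) D.ρ₀_pos
    (fun r hr => D.ρ_lower s r hs hr.1 (hr.2.trans ht))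
    (fun p q hp hpq hq v => D.ρ_energy s p q hs hp hpq (hq.trans ht) v)
    (hc1.sub hc2).continuousOn (hc3.sub hc4).continuousOn
    (fun p q hp hpq hq => by
      rw [intervalIntegral.integral_sub (hc3.intervalIntegrable _ _) (hc4.intervalIntegrable _ _),
        ← S_sub hl hs hp hpq (hq.trans ht), ← S_sub hm hs hp hpq (hq.trans ht)]
      abel) (by positivity)
    (fun r hr => form_yosida_sub hl hm r (hM' r hr)
      (yosida_S_le hl hs hr.1 (hr.2.trans ht) v) (yosida_S_le hm hs hr.1 (hr.2.trans ht) v))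
  rw [(S_spec hl).refl (isCoefficient_coef hl) hs hsb,
    (S_spec hm).refl (isCoefficient_coef hm) hs hsb, sub_self, map_zero, zero_add] at h
  have h1 := (D.energy t).norm_le (D.S lam t s (D.j v) - D.S mu t s (D.j v))
  have h2 : ‖D.S lam t s (D.j v) - D.S mu t s (D.j v)‖ ^ 2 ≤ D.C ^ 2 *
      D.form t (D.S lam t s (D.j v) - D.S mu t s (D.j v))
        (D.S lam t s (D.j v) - D.S mu t s (D.j v)) := by
    rw [← (D.energy t).sq_energyNorm, ← mul_pow]
    exact pow_le_pow_left₀ (norm_nonneg _) h1 2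
  refine h2.trans ?_
  rw [mul_assoc]
  refine mul_le_mul_of_nonneg_left (h.trans ?_) (sq_nonneg _)
  have hts : t - s ≤ D.b - D.a := by linarith
  have hts0 : 0 ≤ t - s := by linarith
  have hba0 : 0 ≤ D.b - D.a := by linarith
  have hρ0 := D.ρ₀_pos.le.trans (D.ρ_lower s t hs hst ht)
  have hρ1 := D.ρ_upper s t hs hst ht
  have hx1 : Real.exp (2 * D.ω * (t - s)) ≤ Real.exp (2 * |D.ω| * (D.b - D.a)) := by
    refine Real.exp_le_exp.2 (mul_le_mul ?_ hts hts0 (by positivity))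
    linarith [le_abs_self D.ω]
  have hx2 : Real.exp (2 * |D.ω| * (t - s)) ≤ Real.exp (2 * |D.ω| * (D.b - D.a)) :=
    Real.exp_le_exp.2 (mul_le_mul_of_nonneg_left hts (by positivity))
  have hρ₀ := D.ρ₀_pos
  rw [mul_assoc]
  have e9 : D.Cρ ^ 2 * Real.exp (2 * |D.ω| * (D.b - D.a)) * (2 * c * E * (D.b - D.a)) * τ =
      D.Cρ ^ 2 * (Real.exp (2 * |D.ω| * (D.b - D.a)) * (2 * (c * τ) * E * (D.b - D.a))) := by ring
  rw [e9, hE]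
  have hcτ : 0 ≤ c * τ := by positivity
  gcongr

end HyperbolicSystem

end Approximation

end EvolutionScale

/-! ### The limit evolution operator, its restriction to `Y` and its differential equations -/

namespace EvolutionScale

noncomputable section Limit

open Set MeasureTheory Filter Topology

set_option linter.unusedSectionVars false

section Conjugation

variable {E G : Type*} [NormedAddCommGroup E] [NormedSpace ℝ E] [NormedAddCommGroup G]
  [NormedSpace ℝ G]

/-- The conjugate `Q(t)⁻¹ W(t, s) Q(s)` of a family of operators. -/
def conjugate (Q : ℝ → G →L[ℝ] E) (W : ℝ → ℝ → E →L[ℝ] E) (t s : ℝ) : G →L[ℝ] G :=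
  (Q t).inverse.comp ((W t s).comp (Q s))

theorem conjugate_apply (Q : ℝ → G →L[ℝ] E) (W : ℝ → ℝ → E →L[ℝ] E) (t s : ℝ) (v : G) :
    conjugate Q W t s v = (Q t).inverse (W t s (Q s v)) := rfl

/-- The operators `P(t) Q(t)⁻¹`. -/
def quotient (P Q : ℝ → G →L[ℝ] E) (t : ℝ) : E →L[ℝ] E := (P t).comp (Q t).inverse

/-- Bounded isomorphisms depending continuously on a parameter. -/
structure IsIsoFamily (Q : ℝ → G →L[ℝ] E) (CQ : ℝ) : Prop where
  cont : Continuous Q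
  isInvertible : ∀ t, (Q t).IsInvertible
  norm_le : ∀ t, ‖Q t‖ ≤ CQ
  norm_inverse_le : ∀ t, ‖(Q t).inverse‖ ≤ CQ

variable {P Q : ℝ → G →L[ℝ] E} {CQ : ℝ}

theorem IsIsoFamily.cont_inverse (hQ : IsIsoFamily Q CQ) : Continuous fun t => (Q t).inverse :=
  continuous_inverse hQ.cont hQ.isInvertible hQ.norm_inverse_le

theorem IsIsoFamily.isCoefficient (hQ : IsIsoFamily Q CQ) (hP : Integrable P) :
    IsCoefficient (quotient P Q) (fun r => ‖P r‖ * CQ) := by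
  refine isCoefficient_of_integrable ?_ (hP.norm.mul_const _) fun r => ?_
  · have hc : Continuous fun p : (G →L[ℝ] E) × (E →L[ℝ] G) => p.1.comp p.2 := by fun_prop
    exact hc.comp_aestronglyMeasurable (hP.1.prodMk hQ.cont_inverse.aestronglyMeasurable)
  · exact (ContinuousLinearMap.opNorm_comp_le _ _).trans
      (mul_le_mul_of_nonneg_left (hQ.norm_inverse_le r) (norm_nonneg _))

theorem IsIsoFamily.conjugate_isStrongFamily (hQ : IsIsoFamily Q CQ) {W : ℝ → ℝ → E →L[ℝ] E}
    {M : ℝ} (hW : IsStrongFamily W M) : IsStrongFamily (conjugate Q W) (CQ * (M * CQ)) where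
  cont x := by
    have h1 : Continuous fun p : ℝ × ℝ => W p.1 p.2 (Q p.2 x) :=
      hW.continuous_apply.comp (continuous_fst.prodMk (continuous_snd.prodMk
        ((hQ.cont.comp continuous_snd).clm_apply continuous_const)))
    exact (hQ.cont_inverse.comp continuous_fst).clm_apply h1
  bound t s := by
    refine (ContinuousLinearMap.opNorm_comp_le _ _).trans (mul_le_mul (hQ.norm_inverse_le t) ?_
      (norm_nonneg _) ((norm_nonneg _).trans (hQ.norm_le 0)))
    exact (ContinuousLinearMap.opNorm_comp_le _ _).trans
      (mul_le_mul (hW.bound t s) (hQ.norm_le s) (norm_nonneg _) hW.const_nonneg)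

/-- Measured in `N t (Q t ·)`, conjugation keeps the growth function; only the constant of
equivalence with the norm worsens, by the factor `CQ`. -/
theorem IsIsoFamily.conjugate_isGrowthBound (hQ : IsIsoFamily Q CQ) {W : ℝ → ℝ → E →L[ℝ] E}
    {N : ℝ → Seminorm ℝ E} {κ : ℝ → ℝ → ℝ} {a b c C : ℝ} (hW : IsGrowthBound N κ a b c C W) :
    IsGrowthBound (fun t => (N t).comp (Q t).toLinearMap) κ a b (c * CQ) C (conjugate Q W) where
  const_nonneg := mul_nonneg hW.const_nonneg ((norm_nonneg _).trans (hQ.norm_le 0))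
  seminorm_le t ht x := by
    refine (hW.seminorm_le t ht (Q t x)).trans ?_
    rw [mul_assoc]
    exact mul_le_mul_of_nonneg_left ((Q t).le_of_opNorm_le (hQ.norm_le t) x) hW.const_nonneg
  norm_le t ht x := by
    have h1 := (Q t).inverse.le_of_opNorm_le_of_le (hQ.norm_inverse_le t)
      (hW.norm_le t ht (Q t x))
    rw [(hQ.isInvertible t).inverse_apply_self] at h1
    refine h1.trans (le_of_eq ?_)
    rw [← mul_assoc, mul_comm CQ]
    rfl
  nonneg := hW.nonneg
  mul_le := hW.mul_le
  le_const := hW.le_const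
  bound s t hs hst ht x := by
    change N t (Q t (conjugate Q W t s x)) ≤ κ s t * N s (Q s x)
    rw [conjugate_apply, (hQ.isInvertible t).self_apply_inverse]
    exact hW.bound s t hs hst ht _

end Conjugation

namespace HyperbolicSystem

variable {H Y : Type*} [NormedAddCommGroup H] [NormedSpace ℝ H] [CompleteSpace H]
  [NormedAddCommGroup Y] [NormedSpace ℝ Y] [CompleteSpace Y] (D : HyperbolicSystem H Y)

theorem tendsto_inv_lamSeq : Tendsto (fun n => (D.lamSeq n)⁻¹) atTop (𝓝 0) :=
  tendsto_inv_atTop_zero.comp D.tendsto_lamSeq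

/-- The Cauchy rate on `Y`, density and the common bound `MS`. Uniformity in the times `p` gives
continuity of the limit. -/
theorem Sc_cauchy (x : H) {ε : ℝ} (hε : 0 < ε) : ∃ n₀, ∀ m ≥ n₀, ∀ n ≥ n₀, ∀ p : ℝ × ℝ,
    ‖D.Sc (D.lamSeq m) p.1 p.2 x - D.Sc (D.lamSeq n) p.1 p.2 x‖ < ε := by
  have hMS : 0 ≤ D.MS := (Sc_isStrongFamily (D.le_lamSeq 0)).const_nonneg
  obtain ⟨v, hv⟩ := D.dense.exists_dist_lt x (show 0 < ε / (3 * (D.MS + 1)) by positivity)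
  rw [dist_eq_norm] at hv
  obtain ⟨K, hK⟩ := D.exists_cauchy_bound v
  have hlim : Tendsto (fun n => (|K| + 1) * (2 * (D.lamSeq n)⁻¹)) atTop (𝓝 0) := by
    simpa using (D.tendsto_inv_lamSeq.const_mul 2).const_mul (|K| + 1)
  obtain ⟨n₀, hn₀⟩ := eventually_atTop.1 (hlim.eventually_lt_const (show 0 < (ε / 3) ^ 2 by positivity))
  have hmono : ∀ n ≥ n₀, (D.lamSeq n)⁻¹ ≤ (D.lamSeq n₀)⁻¹ := fun n hn => by
    refine inv_anti₀ (pos (D.le_lamSeq n₀)) ?_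
    have : (n₀ : ℝ) ≤ n := by exact_mod_cast hn
    unfold lamSeq; linarith
  refine ⟨n₀, fun m hm n hn p => ?_⟩
  obtain ⟨h1, h2, h3⟩ := D.clamp_tri p.1 p.2
  have hKp := hK _ _ (D.le_lamSeq m) (D.le_lamSeq n) _ _ h1 h2 h3
  have hj : ‖D.Sc (D.lamSeq m) p.1 p.2 (D.j v) - D.Sc (D.lamSeq n) p.1 p.2 (D.j v)‖ < ε / 3 := by
    refine lt_of_pow_lt_pow_left₀ 2 (by positivity) (lt_of_le_of_lt hKp
      (lt_of_le_of_lt ?_ (hn₀ n₀ le_rfl)))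
    have := inv_nonneg.2 (pos (D.le_lamSeq m)).le
    have := inv_nonneg.2 (pos (D.le_lamSeq n)).le
    have h5 : (D.lamSeq m)⁻¹ + (D.lamSeq n)⁻¹ ≤ 2 * (D.lamSeq n₀)⁻¹ := by
      linarith [hmono m hm, hmono n hn]
    refine mul_le_mul ?_ h5 (by positivity) (by positivity)
    linarith [le_abs_self K]
  have hb : ∀ n, ‖D.Sc (D.lamSeq n) p.1 p.2 (x - D.j v)‖ ≤ ε / 3 := fun n => by
    refine ((D.Sc _ _ _).le_of_opNorm_le_of_le
      ((Sc_isStrongFamily (D.le_lamSeq n)).bound _ _) hv.le).trans ?_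
    rw [mul_div_assoc', div_le_div_iff₀ (by positivity) (by positivity)]
    nlinarith
  have e : D.Sc (D.lamSeq m) p.1 p.2 x - D.Sc (D.lamSeq n) p.1 p.2 x =
      (D.Sc (D.lamSeq m) p.1 p.2 (D.j v) - D.Sc (D.lamSeq n) p.1 p.2 (D.j v)) +
        D.Sc (D.lamSeq m) p.1 p.2 (x - D.j v) - D.Sc (D.lamSeq n) p.1 p.2 (x - D.j v) := by
    simp only [map_sub]; abel
  rw [e]
  have h6 := norm_sub_le ((D.Sc (D.lamSeq m) p.1 p.2 (D.j v) -
    D.Sc (D.lamSeq n) p.1 p.2 (D.j v)) + D.Sc (D.lamSeq m) p.1 p.2 (x - D.j v))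
    (D.Sc (D.lamSeq n) p.1 p.2 (x - D.j v))
  have h7 := norm_add_le (D.Sc (D.lamSeq m) p.1 p.2 (D.j v) -
    D.Sc (D.lamSeq n) p.1 p.2 (D.j v)) (D.Sc (D.lamSeq m) p.1 p.2 (x - D.j v))
  linarith [hb m, hb n]

theorem exists_limit : ∃ U : ℝ → ℝ → H →L[ℝ] H, IsStrongFamily U D.MS ∧
    ∀ t s x, Tendsto (fun n => D.Sc (D.lamSeq n) t s x) atTop (𝓝 (U t s x)) := by
  have hlim : ∀ t s x, ∃ y, Tendsto (fun n => D.Sc (D.lamSeq n) t s x) atTop (𝓝 y) := by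
    intro t s x
    refine cauchySeq_tendsto_of_complete (Metric.cauchySeq_iff.2 fun ε hε => ?_)
    obtain ⟨n₀, h⟩ := D.Sc_cauchy x hε
    exact ⟨n₀, fun m hm n hn => by rw [dist_eq_norm]; exact h m hm n hn (t, s)⟩
  choose f hf using hlim
  set U : ℝ → ℝ → H →L[ℝ] H := fun t s => continuousLinearMapOfTendsto
    (fun n => D.Sc (D.lamSeq n) t s) (tendsto_pi_nhds.2 (hf t s)) with hU
  have hUf : ∀ t s x, Tendsto (fun n => D.Sc (D.lamSeq n) t s x) atTop (𝓝 (U t s x)) := hf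
  refine ⟨U, ⟨fun x => ?_, fun t s => ?_⟩, hUf⟩
  · have hu : TendstoUniformly (fun n (p : ℝ × ℝ) => D.Sc (D.lamSeq n) p.1 p.2 x)
        (fun p => U p.1 p.2 x) atTop := by
      rw [← tendstoUniformlyOn_univ]
      refine UniformCauchySeqOn.tendstoUniformlyOn_of_tendsto
        (Metric.uniformCauchySeqOn_iff.2 fun ε hε => ?_) fun p _ => hUf p.1 p.2 x
      obtain ⟨n₀, h⟩ := D.Sc_cauchy x hε
      exact ⟨n₀, fun m hm n hn p _ => by rw [dist_eq_norm]; exact h m hm n hn p⟩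
    exact hu.continuous (Frequently.of_forall fun n =>
      (Sc_isStrongFamily (D.le_lamSeq n)).cont x)
  · refine ContinuousLinearMap.opNorm_le_bound _
      (Sc_isStrongFamily (D.le_lamSeq 0)).const_nonneg fun x => ?_
    exact le_of_tendsto (hUf t s x).norm (Eventually.of_forall fun n =>
      (D.Sc _ t s).le_of_opNorm_le ((Sc_isStrongFamily (D.le_lamSeq n)).bound t s) x)

/-- The evolution operator. -/
def U : ℝ → ℝ → H →L[ℝ] H := D.exists_limit.choose

theorem U_isStrongFamily : IsStrongFamily D.U D.MS := D.exists_limit.choose_spec.1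

theorem tendsto_U (t s : ℝ) (x : H) :
    Tendsto (fun n => D.Sc (D.lamSeq n) t s x) atTop (𝓝 (D.U t s x)) :=
  D.exists_limit.choose_spec.2 t s x

theorem tendsto_S {s t : ℝ} (hs : D.a ≤ s) (hst : s ≤ t) (ht : t ≤ D.b) (x : H) :
    Tendsto (fun n => D.S (D.lamSeq n) t s x) atTop (𝓝 (D.U t s x)) :=
  (D.tendsto_U t s x).congr fun n => by rw [Sc_eq hs hst ht]

theorem tendsto_rate : Tendsto (fun n => D.rate (D.lamSeq n)) atTop (𝓝 D.ω) := by
  have h : Tendsto (fun n => D.ω / (1 - D.ω * (D.lamSeq n)⁻¹)) atTop (𝓝 D.ω) := by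
    have := (tendsto_const_nhds (x := D.ω)).div
      ((D.tendsto_inv_lamSeq.const_mul D.ω).const_sub 1) (by simp)
    simpa [Pi.div_def] using this
  refine h.congr fun n => ?_
  have h0 := pos (D.le_lamSeq n)
  rw [rate, ← mul_div_mul_right _ _ h0.ne', sub_mul, one_mul, mul_assoc, inv_mul_cancel₀ h0.ne',
    mul_one]

theorem U_isGrowthBound :
    IsGrowthBound D.N (D.growth D.ω) D.a D.b D.C D.growthConst D.U := by
  refine D.isGrowthBound_of (by linarith [abs_nonneg D.ω]) fun s t hs hst ht x => ?_
  have h1 : Tendsto (fun n => energyNorm (D.form t) (D.S (D.lamSeq n) t s x)) atTop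
      (𝓝 (energyNorm (D.form t) (D.U t s x))) := by
    have hc : Continuous (energyNorm (D.form t)) := by unfold energyNorm; fun_prop
    exact (hc.tendsto _).comp (D.tendsto_S hs hst ht x)
  have h2 : Tendsto (fun n => D.growth (D.rate (D.lamSeq n)) s t * energyNorm (D.form s) x) atTop
      (𝓝 (D.growth D.ω s t * energyNorm (D.form s) x)) := by
    have hc : Continuous fun η => D.growth η s t * energyNorm (D.form s) x := by
      unfold growth; fun_prop
    exact (hc.tendsto _).comp D.tendsto_rate
  exact le_of_tendsto_of_tendsto' h1 h2 fun n => S_energy (D.le_lamSeq n) hs hst ht x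

theorem U_refl {s : ℝ} (hs : D.a ≤ s) (hsb : s ≤ D.b) (x : H) : D.U s s x = x := by
  refine tendsto_nhds_unique (D.tendsto_S hs le_rfl hsb x) (tendsto_const_nhds.congr fun n => ?_)
  rw [(S_spec (D.le_lamSeq n)).refl (isCoefficient_coef (D.le_lamSeq n)) hs hsb]

theorem U_comp {s r t : ℝ} (hs : D.a ≤ s) (hsr : s ≤ r) (hrt : r ≤ t) (ht : t ≤ D.b) (x : H) :
    D.U t r (D.U r s x) = D.U t s x := by
  refine tendsto_nhds_unique (tendsto_clm_apply (T := fun n => D.S (D.lamSeq n) t r)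
    (Eventually.of_forall fun n => norm_le_MS (S_isGrowthBound (D.le_lamSeq n)) (hs.trans hsr) hrt
      ht) (D.tendsto_S (hs.trans hsr) hrt ht _) (D.tendsto_S hs hsr (hrt.trans ht) x))
    ((D.tendsto_S hs (hsr.trans hrt) ht x).congr fun n => ?_)
  rw [(S_spec (D.le_lamSeq n)).comp (isCoefficient_coef (D.le_lamSeq n)) hs hsr hrt ht]

theorem isIsoFamily : IsIsoFamily D.Q D.CQ :=
  ⟨D.Q_cont, D.Q_inv, D.Q_le, D.Q_inv_le⟩

/-- The operators `Q' + [Q, A]` on `[a, b]`. -/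
def P (t : ℝ) : Y →L[ℝ] H := D.Q' t + (Icc D.a D.b).indicator D.K t

theorem P_integrable : Integrable D.P :=
  D.Q'_int.add ((integrable_indicator_iff measurableSet_Icc).2
    (D.K_cont.continuousOn.integrableOn_compact isCompact_Icc))

theorem isCoefficient_P : IsCoefficient (quotient D.P D.Q) (fun r => ‖D.P r‖ * D.CQ) :=
  D.isIsoFamily.isCoefficient D.P_integrable

variable {D}

/-- The approximations on `Y` are conjugates of Dyson series whose families and coefficients
converge strongly, so they converge in the norm of `Y`, and the limit is itself a conjugated Dyson
series. -/
theorem tendsto_SY {W : ℝ → ℝ → H →L[ℝ] H} (hW : IsDyson D.U (quotient D.P D.Q) D.a D.b W)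
    {s t : ℝ} (hs : D.a ≤ s) (hst : s ≤ t) (ht : t ≤ D.b) (v : Y) :
    Tendsto (fun n => D.SY (D.lamSeq n) t s v) atTop (𝓝 (conjugate D.Q W t s v)) := by
  choose W' hW' using fun n => exists_conjugate (D.le_lamSeq n)
  have h := IsDyson.tendsto hW hW' (fun n => Sc_isGrowthBound (D.le_lamSeq n))
    (fun n => Sc_isStrongFamily (D.le_lamSeq n)) (fun n => isCoefficient_coefB (D.le_lamSeq n))
    (fun s t _ _ _ x => D.tendsto_U t s x) (fun r hr x => ?_) hs hst ht (D.Q s v)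
  · refine (((D.Q t).inverse.continuous.tendsto _).comp h).congr fun n => ?_
    rw [SY_eq (D.le_lamSeq n) (hW' n) hs hst ht]
    rfl
  · have e : quotient D.P D.Q r x = D.B r x + D.coefQ r x := by
      simp only [quotient, P, indicator_of_mem hr, ContinuousLinearMap.comp_apply,
        add_apply, B, coefQ, add_comm]
    rw [e]
    refine ((D.tendsto_yosidaB r x).add_const (D.coefQ r x)).congr fun n => ?_
    simp only [coefB, indicator_of_mem hr, add_apply]

/-- `U` preserves `Y`: the approximations converge both in `Y` and in `H`, and the limits agree. -/
theorem j_conjugate {W : ℝ → ℝ → H →L[ℝ] H} (hW : IsDyson D.U (quotient D.P D.Q) D.a D.b W)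
    {s t : ℝ} (hs : D.a ≤ s) (hst : s ≤ t) (ht : t ≤ D.b) (v : Y) :
    D.j (conjugate D.Q W t s v) = D.U t s (D.j v) :=
  tendsto_nhds_unique ((D.j.continuous.tendsto _).comp (tendsto_SY hW hs hst ht v))
    ((D.tendsto_S hs hst ht (D.j v)).congr fun n => S_j (D.le_lamSeq n) hs hst ht v)

theorem conjugate_isStrongFamily {W : ℝ → ℝ → H →L[ℝ] H}
    (hW : IsDyson D.U (quotient D.P D.Q) D.a D.b W) :
    ∃ M, IsStrongFamily (conjugate D.Q W) M :=
  ⟨_, D.isIsoFamily.conjugate_isStrongFamily (hW.isStrongFamily D.U_isGrowthBound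
    D.U_isStrongFamily D.isCoefficient_P D.hab)⟩

/-- The integrand is `lam R A` applied to the approximation on `Y`, and it converges because that
approximation converges in the norm of `Y`. -/
theorem U_forward {W : ℝ → ℝ → H →L[ℝ] H} (hW : IsDyson D.U (quotient D.P D.Q) D.a D.b W)
    {s t : ℝ} (hs : D.a ≤ s) (hst : s ≤ t) (ht : t ≤ D.b) (v : Y) :
    D.U t s (D.j v) = D.j v + ∫ r in s..t, D.gen r (conjugate D.Q W r s v) := by
  have h : Tendsto (fun n => ∫ r in s..t, D.yosida (D.lamSeq n) r (D.S (D.lamSeq n) r s (D.j v)))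
      atTop (𝓝 (∫ r in s..t, D.gen r (conjugate D.Q W r s v))) := by
    refine intervalIntegral.tendsto_integral_filter_of_dominated_convergence
      (fun _ => D.m * (D.Cg * (D.CQ * (D.MW * (D.CQ * ‖v‖))))) (Eventually.of_forall fun n => ?_)
      (Eventually.of_forall fun n => ae_of_all _ fun r hr => ?_)
      intervalIntegrable_const (ae_of_all _ fun r hr => ?_)
    · exact (yosida_comp_continuous (D.le_lamSeq n)
        (S_continuous (D.le_lamSeq n) s _)).aestronglyMeasurable
    · rw [uIoc_of_le hst] at hr
      exact yosida_S_le (D.le_lamSeq n) hs hr.1.le (hr.2.trans ht) v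
    · rw [uIoc_of_le hst] at hr
      have h1 := ((D.gen r).continuous.tendsto _).comp
        (tendsto_SY hW hs hr.1.le (hr.2.trans ht) v)
      refine (tendsto_clm_apply (T := fun n => D.lamSeq n • D.R (D.lamSeq n) r)
        (T₀ := ContinuousLinearMap.id ℝ H) (Eventually.of_forall fun n =>
          smul_R_le (D.le_lamSeq n) r) (D.tendsto_smul_R r _) h1).congr fun n => ?_
      rw [S_j (D.le_lamSeq n) hs hr.1.le (hr.2.trans ht), yosida_apply_j (D.le_lamSeq n)]
      rfl
  refine tendsto_nhds_unique (D.tendsto_S hs hst ht (D.j v)) ((h.const_add (D.j v)).congr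
    fun n => ?_)
  rw [← S_sub (D.le_lamSeq n) hs le_rfl hst ht,
    (S_spec (D.le_lamSeq n)).refl (isCoefficient_coef (D.le_lamSeq n)) hs (hst.trans ht),
    add_sub_cancel]

/-- Here the generator acts on the fixed vector `v`, so strong convergence on `H` suffices. -/
theorem U_backward {s t : ℝ} (hs : D.a ≤ s) (hst : s ≤ t) (ht : t ≤ D.b) (v : Y) :
    D.U t s (D.j v) = D.j v + ∫ r in s..t, D.U t r (D.gen r v) := by
  have h : Tendsto (fun n => ∫ r in s..t, D.S (D.lamSeq n) t r (D.coef (D.lamSeq n) r (D.j v)))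
      atTop (𝓝 (∫ r in s..t, D.U t r (D.gen r v))) := by
    refine intervalIntegral.tendsto_integral_filter_of_dominated_convergence
      (fun _ => D.MS * (D.m * (D.Cg * ‖v‖))) (Eventually.of_forall fun n => ?_)
      (Eventually.of_forall fun n => ae_of_all _ fun r hr => ?_)
      intervalIntegrable_const (ae_of_all _ fun r hr => ?_)
    · have hl := D.le_lamSeq n
      exact (volterra_intervalIntegrable ((S_spec hl).isStrongFamily (isCoefficient_coef hl) D.hab)
        (isCoefficient_coef hl) continuous_const t s t).def'.aestronglyMeasurable
    · rw [uIoc_of_le hst] at hr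
      have hl := D.le_lamSeq n
      refine (D.S _ t r).le_of_opNorm_le_of_le (norm_le_MS (S_isGrowthBound hl)
        (hs.trans hr.1.le) hr.2 ht) ?_
      rw [coef_apply ⟨hs.trans hr.1.le, hr.2.trans ht⟩, yosida_apply_j hl]
      exact (D.lamSeq n • D.R _ r).le_of_opNorm_le_of_le (smul_R_le hl r)
        ((D.gen r).le_of_opNorm_le (D.gen_le r) v)
    · rw [uIoc_of_le hst] at hr
      refine tendsto_clm_apply (T := fun n => D.S (D.lamSeq n) t r)
        (Eventually.of_forall fun n => norm_le_MS (S_isGrowthBound (D.le_lamSeq n))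
          (hs.trans hr.1.le) hr.2 ht) (D.tendsto_S (hs.trans hr.1.le) hr.2 ht _)
        ((D.tendsto_smul_R r (D.gen r v)).congr fun n => ?_)
      rw [coef_apply ⟨hs.trans hr.1.le, hr.2.trans ht⟩, yosida_apply_j (D.le_lamSeq n)]
      rfl
  refine tendsto_nhds_unique (D.tendsto_S hs hst ht (D.j v)) ((h.const_add (D.j v)).congr
    fun n => ?_)
  rw [← (S_spec (D.le_lamSeq n)).backward (isCoefficient_coef (D.le_lamSeq n)) hs hst ht]

theorem U_hasDerivWithinAt_left {W : ℝ → ℝ → H →L[ℝ] H}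
    (hW : IsDyson D.U (quotient D.P D.Q) D.a D.b W) {s t : ℝ} (hs : D.a ≤ s) (hst : s ≤ t)
    (ht : t ≤ D.b) (v : Y) :
    HasDerivWithinAt (fun r => D.U r s (D.j v)) (D.gen t (conjugate D.Q W t s v)) (Icc s D.b) t := by
  obtain ⟨M, hM⟩ := conjugate_isStrongFamily hW
  have hc : Continuous fun r => D.gen r (conjugate D.Q W r s v) :=
    D.gen_cont.clm_apply ((hM.cont v).comp (continuous_id.prodMk continuous_const))
  have h := (intervalIntegral.integral_hasDerivAt_right (hc.intervalIntegrable s t)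
    (hc.stronglyMeasurableAtFilter _ _) hc.continuousAt).const_add (D.j v)
  exact h.hasDerivWithinAt.congr (fun r hr => U_forward hW hs hr.1 hr.2 v)
    (U_forward hW hs hst ht v)

theorem U_hasDerivWithinAt_right {s t : ℝ} (hs : D.a ≤ s) (hst : s ≤ t) (ht : t ≤ D.b) (v : Y) :
    HasDerivWithinAt (fun r => D.U t r (D.j v)) (-(D.U t s (D.gen s v))) (Icc D.a t) s := by
  have hc : Continuous fun r => D.U t r (D.gen r v) :=
    D.U_isStrongFamily.continuous_apply.comp (continuous_const.prodMk (continuous_id.prodMk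
      (D.gen_cont.clm_apply continuous_const)))
  have h := (intervalIntegral.integral_hasDerivAt_left (hc.intervalIntegrable s t)
    (hc.stronglyMeasurableAtFilter _ _) hc.continuousAt).const_add (D.j v)
  exact h.hasDerivWithinAt.congr (fun r hr => U_backward hr.1 hr.2 ht v) (U_backward hs hst ht v)

end HyperbolicSystem

end Limit

end EvolutionScale

/-! ### Lifting the evolution operator along the scale -/

namespace EvolutionScale

noncomputable section Lift

open Set MeasureTheory Filter Topology

set_option linter.unusedSectionVars false

open Classical in
/-- The perturbation of a family `V` by a coefficient `F`, if it exists. -/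
def perturb {E : Type*} [NormedAddCommGroup E] [NormedSpace ℝ E] (V : ℝ → ℝ → E →L[ℝ] E)
    (F : ℝ → E →L[ℝ] E) (a b : ℝ) : ℝ → ℝ → E →L[ℝ] E :=
  if h : ∃ W, IsDyson V F a b W then h.choose else 0

theorem perturb_spec {E : Type*} [NormedAddCommGroup E] [NormedSpace ℝ E] [CompleteSpace E]
    {V : ℝ → ℝ → E →L[ℝ] E} {F : ℝ → E →L[ℝ] E} {N : ℝ → Seminorm ℝ E} {κ : ℝ → ℝ → ℝ}
    {a b c C M : ℝ} {φ : ℝ → ℝ} (hN : IsGrowthBound N κ a b c C V) (hV : IsStrongFamily V M)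
    (hF : IsCoefficient F φ) (hab : a ≤ b) : IsDyson V F a b (perturb V F a b) := by
  have h : ∃ W, IsDyson V F a b W := exists_isDyson hN hV hF hab
  rw [perturb, dif_pos h]
  exact h.choose_spec

/-- Functions all of whose integrals over subintervals of `[a, b]` vanish. -/
theorem ae_eq_zero_of_integral_eq_zero {E : Type*} [NormedAddCommGroup E] [NormedSpace ℝ E]
    [CompleteSpace E] {f : ℝ → E} {a b : ℝ} (hab : a ≤ b) (hf : IntervalIntegrable f volume a b)
    (h : ∀ t ∈ Icc a b, ∫ r in a..t, f r = 0) : ∀ᵐ r, r ∈ Icc a b → f r = 0 := by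
  have h₁ : ∀ᵐ x : ℝ, x ≠ a := by simp [ae_iff, measure_singleton]
  have h₂ : ∀ᵐ x : ℝ, x ≠ b := by simp [ae_iff, measure_singleton]
  filter_upwards [hf.ae_hasDerivAt_integral, h₁, h₂] with x hx hxa hxb hxI
  rw [uIcc_of_le hab] at hx
  have h3 := hx hxI a ⟨le_rfl, hab⟩
  have h4 : HasDerivAt (fun t => ∫ r in a..t, f r) 0 x := by
    refine (hasDerivAt_const x (0 : E)).congr_of_eventuallyEq ?_
    filter_upwards [Ioo_mem_nhds (lt_of_le_of_ne hxI.1 hxa.symm) (lt_of_le_of_ne hxI.2 hxb)]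
      with t ht using h t ⟨ht.1.le, ht.2.le⟩
  exact h3.unique h4

section W11

variable {E G : Type*} [NormedAddCommGroup E] [NormedSpace ℝ E] [NormedAddCommGroup G]
  [NormedSpace ℝ G] {a b : ℝ} {f f' : ℝ → E}

theorem HasW11Deriv.intervalIntegrable (h : HasW11Deriv a b f f') {s t : ℝ} (hs : s ∈ Icc a b)
    (ht : t ∈ Icc a b) : IntervalIntegrable f' volume s t := by
  rw [intervalIntegrable_iff]
  refine h.integrable.mono_set (uIoc_subset_uIcc.trans ?_)
  exact uIcc_subset_Icc hs ht

theorem HasW11Deriv.sub_eq (h : HasW11Deriv a b f f') {s t : ℝ} (hs : s ∈ Icc a b)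
    (ht : t ∈ Icc a b) : f t - f s = ∫ r in s..t, f' r := by
  have ha : a ∈ Icc a b := ⟨le_rfl, hs.1.trans hs.2⟩
  rw [h.eq_integral t ht, h.eq_integral s hs, add_sub_add_left_eq_sub,
    intervalIntegral.integral_interval_sub_left (h.intervalIntegrable ha ht)
      (h.intervalIntegrable ha hs)]

theorem HasW11Deriv.continuousOn (h : HasW11Deriv a b f f') : ContinuousOn f (Icc a b) := by
  by_cases hab : a ≤ b
  · have h1 : ContinuousOn (fun t => ∫ r in a..t, f' r) (uIcc a b) :=
      intervalIntegral.continuousOn_primitive_interval (by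
        rw [uIcc_of_le hab]; exact h.integrable)
    rw [uIcc_of_le hab] at h1
    exact (h1.const_add (f a)).congr h.eq_integral
  · rw [Icc_eq_empty hab]; exact continuousOn_empty _

theorem HasW11Deriv.clm_comp [CompleteSpace E] [CompleteSpace G] (h : HasW11Deriv a b f f')
    (T : E →L[ℝ] G) : HasW11Deriv a b (fun t => T (f t)) (fun t => T (f' t)) where
  integrable := T.integrable_comp h.integrable
  eq_integral t ht := by
    have ha : a ∈ Icc a b := ⟨le_rfl, ht.1.trans ht.2⟩
    rw [h.eq_integral t ht, map_add,
      ← T.intervalIntegral_comp_comm (h.intervalIntegrable ha ht)]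

/-- Needed because the derivatives `Q'` on successive levels are related only through their
primitives. -/
theorem HasW11Deriv.ae_unique [CompleteSpace E] {g g' : ℝ → E} (hab : a ≤ b)
    (hf : HasW11Deriv a b f f') (hg : HasW11Deriv a b g g') (h : ∀ t ∈ Icc a b, f t = g t) :
    ∀ᵐ r, r ∈ Icc a b → f' r = g' r := by
  have ha : a ∈ Icc a b := ⟨le_rfl, hab⟩
  have hb : b ∈ Icc a b := ⟨hab, le_rfl⟩
  have h0 : ∀ t ∈ Icc a b, ∫ r in a..t, (f' r - g' r) = 0 := fun t ht => by
    rw [intervalIntegral.integral_sub (hf.intervalIntegrable ha ht) (hg.intervalIntegrable ha ht),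
      ← hf.sub_eq ha ht, ← hg.sub_eq ha ht, h t ht, h a ha, sub_self]
  filter_upwards [ae_eq_zero_of_integral_eq_zero hab
    ((hf.intervalIntegrable ha hb).sub (hg.intervalIntegrable ha hb)) h0] with r hr hrI
  exact sub_eq_zero.1 (hr hrI)

end W11

variable {X : ℕ → Type*} [∀ n, NormedAddCommGroup (X n)] [∀ n, NormedSpace ℝ (X n)]

/-- The realizations on the spaces of a scale of an evolution operator `U` that is conjugated by
`Q n` to a perturbation of itself with coefficient `P n`. -/
def lift (U : ℝ → ℝ → X 0 →L[ℝ] X 0) (P Q : ∀ n, ℝ → X (n + 1) →L[ℝ] X n) (a b : ℝ) :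
    ∀ n, ℝ → ℝ → X n →L[ℝ] X n
  | 0 => U
  | n + 1 => conjugate (Q n) (perturb (lift U P Q a b n) (quotient (P n) (Q n)) a b)

/-- The growth bounds of the families `lift`. -/
def liftGrowth (κ : ℝ → ℝ → ℝ) (P : ∀ n, ℝ → X (n + 1) →L[ℝ] X n) (c CQ : ℝ) : ℕ → ℝ → ℝ → ℝ
  | 0 => κ
  | n + 1 => fun s t => liftGrowth κ P c CQ n s t *
      Real.exp (∫ r in s..t, (c * CQ ^ n) ^ 2 * (‖P n r‖ * CQ))

/-- The norms `N t (Q(t)ⁿ v)`. -/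
def powSeminorm (N : ℝ → Seminorm ℝ (X 0)) (Q : ∀ n, ℝ → X (n + 1) →L[ℝ] X n) (n : ℕ) (t : ℝ) :
    Seminorm ℝ (X n) := (N t).comp (powQ (fun k => Q k t) n).toLinearMap

variable [∀ n, CompleteSpace (X n)] {U : ℝ → ℝ → X 0 →L[ℝ] X 0}
  {P Q : ∀ n, ℝ → X (n + 1) →L[ℝ] X n} {N : ℝ → Seminorm ℝ (X 0)} {κ : ℝ → ℝ → ℝ}
  {a b c C CQ M : ℝ} {n₀ : ℕ}

/-- At each level the Dyson series multiplies the growth by an exponential computed with the current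
equivalence constant `c * CQ ^ n`; conjugation then raises that constant by one factor `CQ`. -/
theorem lift_bounds (hU : IsStrongFamily U M) (hN : IsGrowthBound N κ a b c C U) (hab : a ≤ b)
    (hQ : ∀ n < n₀, IsIsoFamily (Q n) CQ) (hP : ∀ n < n₀, Integrable (P n)) : ∀ n ≤ n₀,
    (∃ M, IsStrongFamily (lift U P Q a b n) M) ∧
    ∃ C, IsGrowthBound (powSeminorm N Q n) (liftGrowth κ P c CQ n) a b (c * CQ ^ n) C
      (lift U P Q a b n) := by
  intro n
  induction n with
  | zero =>
    intro _
    refine ⟨⟨M, hU⟩, C, ?_⟩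
    rw [pow_zero, mul_one]
    exact hN
  | succ n ih =>
    intro hn
    obtain ⟨⟨M, hM⟩, C, hC⟩ := ih (by lia)
    have hQn := hQ n (by lia)
    have hF := hQn.isCoefficient (hP n (by lia))
    have hW := perturb_spec hC hM hF hab
    have h := hQn.conjugate_isGrowthBound (hW.isGrowthBound hC hM hF hab)
    rw [mul_assoc, ← pow_succ] at h
    exact ⟨⟨_, hQn.conjugate_isStrongFamily (hW.isStrongFamily hC hM hF hab)⟩, _, h⟩

/-- Approximation of the generator is used only for the base case `h₀`. Afterwards `ι n` intertwines
the families by induction and the coefficients `P Q⁻¹` by hypothesis, hence the Dyson series, hence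
their conjugates by `Q`. -/
theorem ι_lift {ι : ∀ n, X (n + 1) →L[ℝ] X n} (hU : IsStrongFamily U M)
    (hN : IsGrowthBound N κ a b c C U) (hab : a ≤ b)
    (hQ : ∀ n < n₀, IsIsoFamily (Q n) CQ) (hP : ∀ n < n₀, Integrable (P n))
    (hιQ : ∀ n, n + 1 < n₀ → ∀ t ∈ Icc a b, ∀ v, ι n (Q (n + 1) t v) = Q n t (ι (n + 1) v))
    (hιP : ∀ n, n + 1 < n₀ → ∀ᵐ t, t ∈ Icc a b → ∀ v, ι n (P (n + 1) t v) = P n t (ι (n + 1) v))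
    (h₀ : ∀ s t, a ≤ s → s ≤ t → t ≤ b → ∀ v, ι 0 (lift U P Q a b 1 t s v) = U t s (ι 0 v)) :
    ∀ n < n₀, ∀ s t, a ≤ s → s ≤ t → t ≤ b → ∀ v,
      ι n (lift U P Q a b (n + 1) t s v) = lift U P Q a b n t s (ι n v) := by
  intro n
  induction n with
  | zero => exact fun _ => h₀
  | succ n ih =>
    intro hn s t hs hst ht v
    have ih := ih (by lia)
    obtain ⟨⟨M, hM⟩, C, hC⟩ := lift_bounds hU hN hab hQ hP n (by lia)
    obtain ⟨⟨M', hM'⟩, C', hC'⟩ := lift_bounds hU hN hab hQ hP (n + 1) (by lia)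
    have hQn := hQ n (by lia)
    have hQn' := hQ (n + 1) hn
    have hF := hQn.isCoefficient (hP n (by lia))
    have hF' := hQn'.isCoefficient (hP (n + 1) hn)
    have hinv : ∀ r ∈ Icc a b, ∀ x,
        ι (n + 1) ((Q (n + 1) r).inverse x) = (Q n r).inverse (ι n x) := fun r hr x => by
      have h1 := hιQ n hn r hr ((Q (n + 1) r).inverse x)
      rw [(hQn'.isInvertible r).self_apply_inverse] at h1
      rw [h1, (hQn.isInvertible r).inverse_apply_self]
    have key := IsDyson.intertwine (T := ι n) (perturb_spec hC' hM' hF' hab)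
      (perturb_spec hC hM hF hab) hC' hM' hF' ih (by
        filter_upwards [hιP n hn] with r hr hrI x
        rw [quotient, quotient, ContinuousLinearMap.comp_apply, ContinuousLinearMap.comp_apply,
          hr hrI, hinv r hrI]) hs hst ht (Q (n + 1) s v)
    change ι (n + 1) ((Q (n + 1) t).inverse _) = (Q n t).inverse _
    rw [hinv t ⟨hs.trans hst, ht⟩]
    refine congrArg _ (key.trans ?_)
    rw [hιQ n hn s ⟨hs, hst.trans ht⟩]
    rfl

theorem incl_lift {ι : ∀ n, X (n + 1) →L[ℝ] X n} {s t : ℝ}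
    (h : ∀ n < n₀, ∀ v, ι n (lift U P Q a b (n + 1) t s v) = lift U P Q a b n t s (ι n v)) :
    ∀ n ≤ n₀, ∀ v, incl ι n (lift U P Q a b n t s v) = U t s (incl ι n v) := by
  intro n
  induction n with
  | zero => exact fun _ _ => rfl
  | succ n ih =>
    intro hn v
    rw [incl, ContinuousLinearMap.comp_apply, ContinuousLinearMap.comp_apply, h n (by lia),
      ih (by lia)]

/-- Level `n` contributes `(c * CQ ^ n) ^ 2 * CQ = c ^ 2 * CQ ^ (2 * n + 1)`, which is the summand
`j = n + 1`; hence the exponents `2 * j - 1` and the indices `j - 1`. -/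
theorem liftGrowth_eq (P : ∀ n, ℝ → X (n + 1) →L[ℝ] X n) (n : ℕ) (s t : ℝ) :
    liftGrowth κ P c CQ n s t = κ s t * Real.exp (c ^ 2 * ∑ j ∈ Finset.Icc 1 n,
      CQ ^ (2 * j - 1) * ∫ r in s..t, ‖P (j - 1) r‖) := by
  induction n with
  | zero => simp [liftGrowth]
  | succ n ih =>
    simp only [liftGrowth]
    rw [ih, Finset.sum_Icc_succ_top (by lia), mul_assoc, ← Real.exp_add, mul_add,
      add_tsub_cancel_right, intervalIntegral.integral_const_mul,
      intervalIntegral.integral_mul_const]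
    have e : 2 * (n + 1) - 1 = 2 * n + 1 := by lia
    rw [e]
    ring_nf

theorem incl_injective {ι : ∀ n, X (n + 1) →L[ℝ] X n} (h : IsDenseScale ι) (n : ℕ) :
    Function.Injective (incl ι n) := by
  induction n with
  | zero => exact fun _ _ h => h
  | succ n ih => exact ih.comp (h.injective n)

end Lift

end EvolutionScale

/-! ### Uniqueness, and reduction of the assumptions to a hyperbolic system -/

namespace EvolutionScale

noncomputable section Existence

open Set MeasureTheory Filter Topology

set_option linter.unusedSectionVars false

/-- Derivative of a product of a strongly differentiable family with a differentiable function. -/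
theorem hasDerivWithinAt_clm_apply {E : Type*} [NormedAddCommGroup E] [NormedSpace ℝ E]
    {T : ℝ → E →L[ℝ] E} {u : ℝ → E} {I : Set ℝ} {s M : ℝ} {y w : E}
    (hM : ∀ r ∈ I, ‖T r‖ ≤ M) (hT : ContinuousWithinAt (fun r => T r y) I s)
    (h1 : HasDerivWithinAt (fun r => T r (u s)) w I s) (h2 : HasDerivWithinAt u y I s) :
    HasDerivWithinAt (fun r => T r (u r)) (w + T s y) I s := by
  have h3 : HasDerivWithinAt (fun r => T r (u r - u s)) (T s y) I s := by
    rw [hasDerivWithinAt_iff_tendsto_slope] at h2 ⊢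
    have hI : I \ {s} ⊆ I := sdiff_subset
    refine (tendsto_clm_apply (T := T) (T₀ := T s) (M := M) ?_
      (hT.mono_left (nhdsWithin_mono _ hI)) h2).congr fun r => ?_
    · filter_upwards [self_mem_nhdsWithin] with r hr using hM r hr.1
    · simp only [slope_def_module, map_smul, sub_self, map_zero, sub_zero]
  refine (h1.add h3).congr (fun r _ => ?_) ?_
  all_goals simp

variable {X : ℕ → Type*} [∀ n, NormedAddCommGroup (X n)] [∀ n, NormedSpace ℝ (X n)]
  [∀ n, CompleteSpace (X n)] {ι : ∀ n, X (n + 1) →L[ℝ] X n} {T₀ T₁ : ℝ} {n₀ : ℕ}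

theorem IsEvolutionOperator.continuousOn {A : ℝ → X 0 →ₗ.[ℝ] X 0} {V : ℝ → ℝ → X 0 →L[ℝ] X 0}
    (hV : IsEvolutionOperator ι T₀ T₁ n₀ A V) (v : X 0) :
    ContinuousOn (fun p : ℝ × ℝ => V p.1 p.2 v) (triangle T₀ T₁) := by
  obtain ⟨W, h1, h2⟩ := hV.regular 0 (Nat.zero_le _)
  exact (h2 v).congr fun p hp => (h1 p.1 p.2 hp v).symm

/-- The function `s ↦ V t s (U s t₀ v)` is constant for `v` in `X 1`: the two derivatives cancel
since both equal `V t s (A s (U s t₀ v))` up to sign. -/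
theorem IsEvolutionOperator.unique {A : ℝ → X 0 →ₗ.[ℝ] X 0} {U V : ℝ → ℝ → X 0 →L[ℝ] X 0}
    (hι : IsDenseScale ι) (hn₀ : 1 ≤ n₀) (hU : IsEvolutionOperator ι T₀ T₁ n₀ A U)
    (hV : IsEvolutionOperator ι T₀ T₁ n₀ A V) {t t₀ : ℝ} (ht : (t, t₀) ∈ triangle T₀ T₁) :
    V t t₀ = U t t₀ := by
  obtain ⟨hT₀, htt, hT₁⟩ := ht
  simp only at hT₀ htt hT₁
  have hVc : ∀ v, ContinuousOn (fun s => V t s v) (Icc t₀ t) := fun v =>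
    (hV.continuousOn v).comp (f := fun s => (t, s)) (by fun_prop)
      fun s hs => ⟨hT₀.trans hs.1, hs.2, hT₁⟩
  -- An evolution operator is only strongly continuous by definition; the operator bound required by
  -- the product rule comes from uniform boundedness.
  obtain ⟨M, hM⟩ : ∃ M, ∀ s : Icc t₀ t, ‖V t s‖ ≤ M := by
    refine banach_steinhaus fun v => ?_
    obtain ⟨C, hC⟩ := isCompact_Icc.exists_bound_of_continuousOn (hVc v)
    exact ⟨C, fun s => hC s s.2⟩
  have key : ∀ v : X 1, V t t₀ (ι 0 v) = U t t₀ (ι 0 v) := by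
    intro v
    -- The derivative in the initial time is known only on `X 1`, so `U s t₀ v` must lie there; this
    -- is the use of `1 ≤ n₀`.
    obtain ⟨W, hW, -⟩ := hU.regular 1 hn₀
    have hder : ∀ s ∈ Icc t₀ t,
        HasDerivWithinAt (fun s => V t s (U s t₀ (ι 0 v))) 0 (Icc t₀ t) s := by
      intro s hs
      have hs1 : (s, t₀) ∈ triangle T₀ T₁ := ⟨hT₀, hs.1, hs.2.trans hT₁⟩
      have hs2 : (t, s) ∈ triangle T₀ T₁ := ⟨hT₀.trans hs.1, hs.2, hT₁⟩
      have hw : ι 0 (W s t₀ v) = U s t₀ (ι 0 v) := hW s t₀ hs1 v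
      obtain ⟨h1, h2⟩ := hU.deriv_fst s t₀ hs1 v
      obtain ⟨h3, h4⟩ := hV.deriv_snd t s hs2 (W s t₀ v)
      have e : A s ⟨ι 0 (W s t₀ v), h3⟩ = A s ⟨U s t₀ (ι 0 v), h1⟩ :=
        congrArg (A s) (Subtype.ext hw)
      rw [e] at h4
      simp only [hw] at h4
      have := hasDerivWithinAt_clm_apply (T := V t) (u := fun s => U s t₀ (ι 0 v))
        (fun r hr => hM ⟨r, hr⟩) ((hVc _) s hs) (h4.mono (Icc_subset_Icc hT₀ le_rfl))
        (h2.mono (Icc_subset_Icc le_rfl hT₁))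
      rwa [neg_add_cancel] at this
    have h := constant_of_derivWithin_zero (fun s hs => (hder s hs).differentiableWithinAt)
      (fun s hs => (hder s ⟨hs.1, hs.2.le⟩).derivWithin
        (uniqueDiffOn_Icc (hs.1.trans_lt hs.2) s ⟨hs.1, hs.2.le⟩)) t ⟨htt, le_rfl⟩
    simp only [hV.refl t ⟨hT₀.trans htt, hT₁⟩, hU.refl t₀ ⟨hT₀, htt.trans hT₁⟩,
      ContinuousLinearMap.id_apply] at h
    exact h.symm
  refine ContinuousLinearMap.ext fun x => ?_
  exact congrFun ((hι.dense 1).equalizer (V t t₀).continuous (U t t₀).continuous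
    (funext key)) x

/-- Weights that control the growth of the norms `energyNorm (L t)` along `[T₀, T₁]`. -/
structure IsWeight {H : Type*} [NormedAddCommGroup H] [NormedSpace ℝ H]
    (L : ℝ → H →L[ℝ] StrongDual ℝ H) (T₀ T₁ ρ₀ ρ₁ : ℝ) (ρ : ℝ → ℝ → ℝ) : Prop where
  refl : ∀ s ∈ Icc T₀ T₁, 1 ≤ ρ s s
  lower : ∀ s t, T₀ ≤ s → s ≤ t → t ≤ T₁ → ρ₀ ≤ ρ s t
  upper : ∀ s t, T₀ ≤ s → s ≤ t → t ≤ T₁ → ρ s t ≤ ρ₁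
  mul : ∀ s r t, T₀ ≤ s → s ≤ r → r ≤ t → t ≤ T₁ → ρ s r * ρ r t ≤ ρ s t
  energy : ∀ s r t, T₀ ≤ s → s ≤ r → r ≤ t → t ≤ T₁ → ∀ v,
    energyNorm (L t) v * ρ s r ≤ ρ s t * energyNorm (L r) v

/-- The variation itself is the weight, except on a trivial space, where it can vanish; there the
constant 1 works because all energy norms are zero. -/
theorem AssumptionL1.exists_isWeight {H : Type*} [NormedAddCommGroup H] [NormedSpace ℝ H]
    {L : ℝ → H →L[ℝ] StrongDual ℝ H} {C : ℝ} (h : AssumptionL1 T₀ T₁ L C) (hC : 1 ≤ C) :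
    ∃ (ρ : ℝ → ℝ → ℝ) (ρ₀ ρ₁ : ℝ), 0 < ρ₀ ∧ IsWeight L T₀ T₁ ρ₀ ρ₁ ρ ∧
      ∀ s t v, ρ s t * energyNorm (L s) v ≤ variation L s t * energyNorm (L s) v := by
  rcases subsingleton_or_nontrivial H with hH | hH
  · have h0 : ∀ s v, energyNorm (L s) v = 0 := fun s v => by
      rw [Subsingleton.elim v 0]; simp [energyNorm]
    refine ⟨fun _ _ => 1, 1, 1, one_pos, ⟨?_, ?_, ?_, ?_, ?_⟩, ?_⟩ <;> simp [h0]
  · obtain ⟨M, hM⟩ := h.exists_variation_le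
    have hC0 : 0 < C := zero_lt_one.trans_le hC
    refine ⟨variation L, C⁻¹ ^ 2, M, by positivity, ⟨fun s => h.one_le_variation,
      fun s t => h.variation_lower hC, hM, fun s r t => h.variation_mul_le,
      fun s r t => h.energyNorm_mul_le hC⟩, fun _ _ _ => le_rfl⟩

/-- The restriction of `f` to `[a, b]`, extended by constants. -/
def freeze {E : Type*} (a b : ℝ) (f : ℝ → E) (t : ℝ) : E := f (clamp a b t)

theorem freeze_eq {E : Type*} {a b t : ℝ} (f : ℝ → E) (ht : t ∈ Icc a b) : freeze a b f t = f t := by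
  rw [freeze, clamp_of_mem ht.1 ht.2]

theorem continuous_freeze {E : Type*} [TopologicalSpace E] {a b : ℝ} (hab : a ≤ b) {f : ℝ → E}
    (hf : ContinuousOn f (Icc a b)) : Continuous (freeze a b f) :=
  hf.comp_continuous (continuous_clamp a b) (clamp_mem hab)

variable {L : ℝ → X 0 →L[ℝ] StrongDual ℝ (X 0)} {A : ℝ → X 0 →ₗ.[ℝ] X 0}
  {Q Q' K : ∀ n, ℝ → X (n + 1) →L[ℝ] X n} {C_L C_Q ω : ℝ}

theorem AssumptionL2.isClosureOf (h : AssumptionL2 ι T₀ T₁ L A ω) {A₁ : ℝ → X 1 →L[ℝ] X 0}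
    (hA₁ : ∀ t ∈ Icc T₀ T₁, ∀ v : X 1, ∃ h : ι 0 v ∈ (A t).domain, A t ⟨ι 0 v, h⟩ = A₁ t v)
    {t : ℝ} (ht : t ∈ Icc T₀ T₁) : IsClosureOf (A t) (ι 0) (A₁ t) :=
  isClosureOf_of_hasCore (h.closed t ht) (h.core t ht) (hA₁ t ht)

theorem AssumptionL2.isDissipative (h : AssumptionL2 ι T₀ T₁ L A ω) {A₁ : ℝ → X 1 →L[ℝ] X 0}
    (hA₁ : ∀ t ∈ Icc T₀ T₁, ∀ v : X 1, ∃ h : ι 0 v ∈ (A t).domain, A t ⟨ι 0 v, h⟩ = A₁ t v)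
    {t : ℝ} (ht : t ∈ Icc T₀ T₁) : IsDissipative (L t) (A t) ω :=
  (h.isClosureOf hA₁ ht).isDissipative fun v => by
    obtain ⟨h1, h2⟩ := hA₁ t ht v
    rw [← h2]
    exact h.dissipative t ht v h1

/-- The hyperbolic system on the first two spaces of the scale. -/
def hyperbolicSystem (hι : IsDenseScale ι) (hT : T₀ ≤ T₁) (hn₀ : 0 < n₀) (hC_L : 1 ≤ C_L)
    (hL1 : AssumptionL1 T₀ T₁ L C_L) (hL2 : AssumptionL2 ι T₀ T₁ L A ω)
    (hL3 : AssumptionL3 ι T₀ T₁ n₀ A Q Q' K C_Q) {A₁ : ℝ → X 1 →L[ℝ] X 0}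
    (hc : ContinuousOn A₁ (Icc T₀ T₁))
    (hA₁ : ∀ t ∈ Icc T₀ T₁, ∀ v : X 1, ∃ h : ι 0 v ∈ (A t).domain, A t ⟨ι 0 v, h⟩ = A₁ t v)
    {ρ : ℝ → ℝ → ℝ} {ρ₀ ρ₁ : ℝ} (hρ₀ : 0 < ρ₀) (hρ : IsWeight L T₀ T₁ ρ₀ ρ₁ ρ) :
    HyperbolicSystem (X 0) (X 1) where
  a := T₀
  b := T₁
  C := C_L
  ρ₀ := ρ₀
  Cρ := ρ₁
  ω := ω
  CQ := C_Q
  CK := (isCompact_Icc.exists_bound_of_continuousOn (hL3.commutator_continuous 0 hn₀)).choose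
  Cg := (isCompact_Icc.exists_bound_of_continuousOn hc).choose
  j := ι 0
  form := freeze T₀ T₁ L
  ρ := ρ
  A := freeze T₀ T₁ A
  gen := freeze T₀ T₁ A₁
  Q := freeze T₀ T₁ (Q 0)
  Q' := (Icc T₀ T₁).indicator (Q' 0)
  K := freeze T₀ T₁ (K 0)
  hab := hT
  dense := hι.dense 1
  energy t := hL1.isEnergyForm hC_L (clamp_mem hT t)
  ρ_refl := hρ.refl
  ρ₀_pos := hρ₀
  ρ_lower := hρ.lower
  ρ_upper := hρ.upper
  ρ_mul := hρ.mul
  ρ_energy s r t hs hsr hrt ht v := by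
    rw [freeze_eq L ⟨hs.trans (hsr.trans hrt), ht⟩, freeze_eq L ⟨hs.trans hsr, hrt.trans ht⟩]
    exact hρ.energy s r t hs hsr hrt ht v
  gen_cont := continuous_freeze hT hc
  gen_le t := (isCompact_Icc.exists_bound_of_continuousOn hc).choose_spec _ (clamp_mem hT t)
  isClosureOf t := hL2.isClosureOf hA₁ (clamp_mem hT t)
  isDissipative t := hL2.isDissipative hA₁ (clamp_mem hT t)
  exists_resolvent t lam hlam := by
    have ht := clamp_mem hT t
    obtain ⟨lam₀, hlam₀, hs⟩ := hL2.surjective _ ht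
    have hd := hL2.isDissipative hA₁ ht
    have he := hL1.isEnergyForm hC_L ht
    exact hd.exists_isResolvent he hlam (hd.surjective he hlam₀ hs hlam)
  Q_inv t := hL3.invertible 0 hn₀ _ (clamp_mem hT t)
  Q_le t := hL3.norm_le 0 hn₀ _ (clamp_mem hT t)
  Q_inv_le t := hL3.norm_inverse_le 0 hn₀ _ (clamp_mem hT t)
  Q_cont := continuous_freeze hT (hL3.regular 0 hn₀).continuousOn
  Q'_int := (integrable_indicator_iff measurableSet_Icc).2 (hL3.regular 0 hn₀).integrable
  Q_deriv s t hs hst ht := by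
    have h1 : s ∈ Icc T₀ T₁ := ⟨hs, hst.trans ht⟩
    have h2 : t ∈ Icc T₀ T₁ := ⟨hs.trans hst, ht⟩
    rw [freeze_eq _ h1, freeze_eq _ h2, (hL3.regular 0 hn₀).sub_eq h1 h2]
    refine intervalIntegral.integral_congr fun r hr => ?_
    exact (indicator_of_mem (uIcc_subset_Icc h1 h2 hr) _).symm
  comm t := hL3.commutator _ (clamp_mem hT t)
  K_cont := continuous_freeze hT (hL3.commutator_continuous 0 hn₀)
  K_le t := (isCompact_Icc.exists_bound_of_continuousOn
    (hL3.commutator_continuous 0 hn₀)).choose_spec _ (clamp_mem hT t)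

theorem AssumptionL3.isIsoFamily (h : AssumptionL3 ι T₀ T₁ n₀ A Q Q' K C_Q) (hT : T₀ ≤ T₁) {n : ℕ}
    (hn : n < n₀) : IsIsoFamily (freeze T₀ T₁ (Q n)) C_Q where
  cont := continuous_freeze hT (h.regular n hn).continuousOn
  isInvertible t := h.invertible n hn _ (clamp_mem hT t)
  norm_le t := h.norm_le n hn _ (clamp_mem hT t)
  norm_inverse_le t := h.norm_inverse_le n hn _ (clamp_mem hT t)

/-- The operators `Q' + [Q, A]` on `[T₀, T₁]`. -/
def source (T₀ T₁ : ℝ) (Q' K : ∀ n, ℝ → X (n + 1) →L[ℝ] X n) (n : ℕ) (t : ℝ) : X (n + 1) →L[ℝ] X n :=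
  (Icc T₀ T₁).indicator (Q' n) t + (Icc T₀ T₁).indicator (freeze T₀ T₁ (K n)) t

theorem source_eq {n : ℕ} {t : ℝ} (ht : t ∈ Icc T₀ T₁) :
    source T₀ T₁ Q' K n t = Q' n t + K n t := by
  rw [source, indicator_of_mem ht, indicator_of_mem ht, freeze_eq _ ht]

theorem AssumptionL3.integrable_source (h : AssumptionL3 ι T₀ T₁ n₀ A Q Q' K C_Q) (hT : T₀ ≤ T₁)
    {n : ℕ} (hn : n < n₀) : Integrable (source T₀ T₁ Q' K n) :=
  ((integrable_indicator_iff measurableSet_Icc).2 (h.regular n hn).integrable).add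
    ((integrable_indicator_iff measurableSet_Icc).2
      ((continuous_freeze hT (h.commutator_continuous n hn)).continuousOn.integrableOn_compact
        isCompact_Icc))

/-- Both sides are weak derivatives of one `W^{1,1}` function with values in the operators from `X
(n + 2)` to `X n`. -/
theorem AssumptionL3.restrict_deriv (h : AssumptionL3 ι T₀ T₁ n₀ A Q Q' K C_Q) (hT : T₀ ≤ T₁)
    {n : ℕ} (hn : n + 1 < n₀) : ∀ᵐ t, t ∈ Icc T₀ T₁ → ∀ v,
      ι n (Q' (n + 1) t v) = Q' n t (ι (n + 1) v) := by
  have h1 := (h.regular (n + 1) hn).clm_comp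
    (ContinuousLinearMap.compL ℝ (X (n + 2)) (X (n + 1)) (X n) (ι n))
  have h2 := (h.regular n (by lia)).clm_comp
    ((ContinuousLinearMap.compL ℝ (X (n + 2)) (X (n + 1)) (X n)).flip (ι (n + 1)))
  filter_upwards [h1.ae_unique hT h2 fun t ht =>
    ContinuousLinearMap.ext (h.restrict n hn t ht)] with t ht htI v
  exact congrArg (fun T : X (n + 2) →L[ℝ] X n => T v) (ht htI)

theorem AssumptionL3.restrict_source (h : AssumptionL3 ι T₀ T₁ n₀ A Q Q' K C_Q) (hT : T₀ ≤ T₁)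
    {n : ℕ} (hn : n + 1 < n₀) : ∀ᵐ t, t ∈ Icc T₀ T₁ → ∀ v,
      ι n (source T₀ T₁ Q' K (n + 1) t v) = source T₀ T₁ Q' K n t (ι (n + 1) v) := by
  filter_upwards [h.restrict_deriv hT hn] with t ht htI v
  rw [source_eq htI, source_eq htI, add_apply, add_apply, map_add, ht htI,
    h.commutator_restrict n hn t htI]

theorem powQ_freeze {n : ℕ} {t : ℝ} (ht : t ∈ Icc T₀ T₁) :
    powQ (fun k => freeze T₀ T₁ (Q k) t) n = powQ (fun k => Q k t) n := by
  simp only [freeze_eq _ ht]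

end Existence

end EvolutionScale

/-! ### The main theorem -/

open EvolutionScale in
theorem propositionP
    {X : ℕ → Type*} [∀ n, NormedAddCommGroup (X n)] [∀ n, NormedSpace ℝ (X n)]
    [∀ n, CompleteSpace (X n)]
    (ι : ∀ n, X (n + 1) →L[ℝ] X n) (hι : IsDenseScale ι)
    (T₀ T₁ : ℝ) (hT : T₀ < T₁) (n₀ : ℕ) (hn₀ : 1 ≤ n₀)
    (L : ℝ → X 0 →L[ℝ] StrongDual ℝ (X 0))
    (A : ℝ → X 0 →ₗ.[ℝ] X 0)
    (Q Q' K : ∀ n, ℝ → X (n + 1) →L[ℝ] X n)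
    (C_L C_Q ω : ℝ) (hC_L : 1 ≤ C_L) (hC_Q : 1 ≤ C_Q)
    (hL1 : AssumptionL1 T₀ T₁ L C_L)
    (hL2 : AssumptionL2 ι T₀ T₁ L A ω)
    (hL3 : AssumptionL3 ι T₀ T₁ n₀ A Q Q' K C_Q) :
    ∃ U : ℝ → ℝ → X 0 →L[ℝ] X 0,
      IsEvolutionOperator ι T₀ T₁ n₀ A U ∧
      (∀ V : ℝ → ℝ → X 0 →L[ℝ] X 0, IsEvolutionOperator ι T₀ T₁ n₀ A V →
        ∀ t t₀, (t, t₀) ∈ triangle T₀ T₁ → V t t₀ = U t t₀) ∧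
      ∀ n ≤ n₀, ∀ t t₀, (t, t₀) ∈ triangle T₀ T₁ → ∀ v w : X n,
        incl ι n w = U t t₀ (incl ι n v) →
        energyNorm (L t) (powQ (fun k => Q k t) n w) ≤
          variation L t₀ t *
            Real.exp (ω * (t - t₀) + C_L ^ 2 * ∑ j ∈ Finset.Icc 1 n,
              C_Q ^ (2 * j - 1) * ∫ τ in t₀..t, ‖Q' (j - 1) τ + K (j - 1) τ‖) *
            energyNorm (L t₀) (powQ (fun k => Q k t₀) n v) := by
  obtain ⟨A₁, hc, hA₁⟩ := hL2.continuous
  obtain ⟨ρ, ρ₀, ρ₁, hρ₀, hρ, hρv⟩ := hL1.exists_isWeight hC_L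
  set D := hyperbolicSystem hι hT.le hn₀ hC_L hL1 hL2 hL3 hc hA₁ hρ₀ hρ
  set Qf : ∀ n, ℝ → X (n + 1) →L[ℝ] X n := fun n => freeze T₀ T₁ (Q n) with hQf
  set P := source T₀ T₁ Q' K with hP
  have hW : IsDyson D.U (quotient D.P D.Q) D.a D.b
      (perturb D.U (quotient D.P D.Q) D.a D.b) :=
    perturb_spec D.U_isGrowthBound D.U_isStrongFamily D.isCoefficient_P D.hab
  have hQi : ∀ n < n₀, IsIsoFamily (Qf n) C_Q := fun n hn => hL3.isIsoFamily hT.le hn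
  have hPi : ∀ n < n₀, MeasureTheory.Integrable (P n) := fun n hn => hL3.integrable_source hT.le hn
  have hbound := lift_bounds (a := T₀) (b := T₁) (C := D.growthConst) (c := C_L) D.U_isStrongFamily D.U_isGrowthBound
    hT.le hQi hPi
  -- The first lift is by definition the conjugated Dyson series of the system `D`, since `D.P` and
  -- `D.Q` unfold to `P 0` and `Qf 0`.
  have hι0 : ∀ s t, T₀ ≤ s → s ≤ t → t ≤ T₁ → ∀ v,
      ι 0 (lift D.U P Qf T₀ T₁ 1 t s v) = D.U t s (ι 0 v) := fun s t hs hst ht v =>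
    HyperbolicSystem.j_conjugate hW hs hst ht v
  have hlift := ι_lift (a := T₀) (b := T₁) (C := D.growthConst) (c := C_L) D.U_isStrongFamily D.U_isGrowthBound
    hT.le hQi hPi (fun n hn t ht v => by
      have ht : t ∈ Set.Icc T₀ T₁ := ht
      simp only [hQf]
      rw [freeze_eq _ ht, freeze_eq _ ht]
      exact hL3.restrict n hn t ht v)
    (fun n hn => hL3.restrict_source hT.le hn) hι0
  have hincl : ∀ n ≤ n₀, ∀ t t₀, (t, t₀) ∈ triangle T₀ T₁ → ∀ v,
      incl ι n (lift D.U P Qf T₀ T₁ n t t₀ v) = D.U t t₀ (incl ι n v) :=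
    fun n hn t t₀ ht => incl_lift (fun n hn => hlift n hn t₀ t ht.1 ht.2.1 ht.2.2) n hn
  have hev : IsEvolutionOperator ι T₀ T₁ n₀ A D.U := by
    refine ⟨fun n hn => ⟨lift D.U P Qf T₀ T₁ n, hincl n hn, fun v => ?_⟩, fun s hs => ?_,
      fun t r s hs hsr hrt ht => ?_, fun t s hts v => ?_, fun t s hts v => ?_⟩
    · obtain ⟨⟨M, hM⟩, -⟩ := hbound n hn
      exact (hM.cont v).continuousOn
    · exact ContinuousLinearMap.ext (D.U_refl hs.1 hs.2)
    · exact ContinuousLinearMap.ext (D.U_comp hs hsr hrt ht)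
    · obtain ⟨hs, hst, ht⟩ := hts
      have hd := HyperbolicSystem.U_hasDerivWithinAt_left hW hs hst ht v
      set w := conjugate D.Q (perturb D.U (quotient D.P D.Q) D.a D.b) t s v with hw
      have e : ι 0 w = D.U t s (ι 0 v) := HyperbolicSystem.j_conjugate hW hs hst ht v
      obtain ⟨h1, h2⟩ := hA₁ t ⟨hs.trans hst, ht⟩ w
      refine ⟨e ▸ h1, ?_⟩
      have e2 : D.gen t w = A t ⟨D.U t s (ι 0 v), e ▸ h1⟩ := by
        have e3 : D.gen t w = A₁ t w :=
          congrArg (fun T : X 1 →L[ℝ] X 0 => T w) (freeze_eq A₁ ⟨hs.trans hst, ht⟩)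
        rw [e3, ← h2]
        exact congrArg (A t) (Subtype.ext e)
      rw [← e2]
      exact hd
    · obtain ⟨hs, hst, ht⟩ := hts
      have hsI : s ∈ Set.Icc T₀ T₁ := ⟨hs, hst.trans ht⟩
      have hd := HyperbolicSystem.U_hasDerivWithinAt_right (D := D) hs hst ht v
      obtain ⟨h1, h2⟩ := hA₁ s hsI v
      refine ⟨h1, ?_⟩
      have e3 : D.gen s v = A₁ s v :=
        congrArg (fun T : X 1 →L[ℝ] X 0 => T v) (freeze_eq A₁ hsI)
      rw [h2, ← e3]
      exact hd
  refine ⟨D.U, hev, fun V hV t t₀ ht => hev.unique hι hn₀ hV ht, fun n hn t t₀ ht v w hvw => ?_⟩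
  -- The vector `w` representing `U(t, t₀) v` in `X n` is unique because the inclusion is injective.
  obtain rfl : w = lift D.U P Qf T₀ T₁ n t t₀ v :=
    incl_injective hι n (hvw.trans (hincl n hn t t₀ ht v).symm)
  obtain ⟨-, C, hC⟩ := hbound n hn
  obtain ⟨hs, hst, htT⟩ := ht
  have htI : t ∈ Set.Icc T₀ T₁ := ⟨hs.trans hst, htT⟩
  have hsI : t₀ ∈ Set.Icc T₀ T₁ := ⟨hs, hst.trans htT⟩
  have hN : ∀ r ∈ Set.Icc T₀ T₁, ∀ x, powSeminorm D.N Qf n r x =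
      energyNorm (L r) (powQ (fun k => Q k r) n x) := by
    intro r hr x
    have : powSeminorm D.N Qf n r x =
        energyNorm (freeze T₀ T₁ L r) (powQ (fun k => freeze T₀ T₁ (Q k) r) n x) := rfl
    rw [this, freeze_eq L hr, powQ_freeze hr]
  have h := hC.bound t₀ t hs hst htT v
  rw [hN t htI, hN t₀ hsI, liftGrowth_eq, HyperbolicSystem.growth, mul_assoc (D.ρ t₀ t),
    ← Real.exp_add] at h
  have e : ∀ j, (∫ τ in t₀..t, ‖P (j - 1) τ‖) = ∫ τ in t₀..t, ‖Q' (j - 1) τ + K (j - 1) τ‖ :=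
    fun j => intervalIntegral.integral_congr fun r hr => by
      rw [hP]
      simp only [source_eq (Set.uIcc_subset_Icc hsI htI hr)]
  simp only [e] at h
  refine h.trans ?_
  -- The weight `ρ` is exchanged for the variation; next to the energy norm this is legitimate even
  -- on a trivial space.
  have h1 := mul_le_mul_of_nonneg_right (hρv t₀ t (powQ (fun k => Q k t₀) n v)) (Real.exp_pos
    (ω * (t - t₀) + C_L ^ 2 * ∑ j ∈ Finset.Icc 1 n,
      C_Q ^ (2 * j - 1) * ∫ τ in t₀..t, ‖Q' (j - 1) τ + K (j - 1) τ‖)).le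
  rw [mul_right_comm, mul_right_comm (variation L t₀ t)] at h1
  exact h1
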